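/- Let $X$ and $Y$ be manifolds of one of the following kinds: $C^\infty$, real-analytic, or complex (finite-dimensional, without boundary), and let $f\colon Y\to X$ be a map of such manifolds ($C^\infty$, real-analytic, or holomorphic, respectively). Let $\mathcal O$ denote the sheaf of real-valued or of complex-valued $C^\infty$ (resp. real-analytic) functions, or the sheaf of holomorphic functions; let $k=\mathbb R$ or $\mathbb C$ be its field of values, and let $\mathcal T$ and $\Omega^i$ be the sheaves of vector fields and of differential forms with coefficients in $\mathcal O$. A *Courant algebroid* on $X$ is a sheaf of $\mathcal O_X$-modules $\mathcal Q$ with a $k$-bilinear bracket $[\ ,\ ]$ satisfying $[q,[p,r]]=[[q,p],r]+[p,[q,r]]$, an $\mathcal O_X$-linear anchor $\pi\colon\mathcal Q\to\mathcal T_X$ with $\pi([q,p])=[\pi(q),\pi(p)]$, a symmetric $\mathcal O_X$-bilinear pairing $\langle\ ,\ \rangle\colon\mathcal Q\otimes_{\mathcal O_X}\mathcal Q\to\mathcal O_X$ (not assumed non-degenerate), and an $\mathcal O_X$-linear co-anchor $\pi^\dagger\colon\Omega^1_X\to\mathcal Q$, such that for $g\in\mathcal O_X$, $\alpha\in\Omega^1_X$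 and $q,q_1,q_2\in\mathcal Q$: $$\pi\pi^\dagger=0,\qquad [q_1,gq_2]=g[q_1,q_2]+\pi(q_1)(g)\,q_2,\qquad \langle[q,q_1],q_2\rangle+\langle q_1,[q,q_2]\rangle=\pi(q)\big(\langle q_1,q_2\rangle\big),$$ $$[q,\pi^\dagger(\alpha)]=\pi^\dagger(L_{\pi(q)}\alpha),\qquad \langle q,\pi^\dagger(\alpha)\rangle=\iota_{\pi(q)}\alpha,\qquad [q_1,q_2]+[q_2,q_1]=\pi^\dagger(d\langle q_1,q_2\rangle).$$ For a closed 3-form $H$ on $X$, the *twist* $\mathcal Q_H$ is the Courant algebroid with the same module, anchor, co-anchor and pairing as $\mathcal Q$ and with the bracket $$[q,p]_H=[q,p]+\pi^\dagger\big(\iota_{\pi(p)}\iota_{\pi(q)}H\big).$$ The *inverse image* $f^{++}\mathcal Q$ is the Courant algebroid on $Y$ whose sheaf of $\mathcal O_Y$-modules is $$f^{++}\mathcal Q=\Big(\Omega^1_Y\oplus\big(f^*\mathcal Q\times_{f^*\mathcal T_X}\mathcal T_Y\big)\Big)\Big/\big\{(f^*\gamma,\,-(f^*\pi^\dagger)(\gamma),\,0)\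 :\ \gamma\in f^*\Omega^1_X\big\},\qquad f^*\mathcal Q=\mathcal O_Y\otimes_{f^{-1}\mathcal O_X}f^{-1}\mathcal Q,$$ where in the first component $f^*\gamma$ is the image of $\gamma$ under the canonical map $f^*\Omega^1_X\to\Omega^1_Y$. Its anchor is $(\alpha,t,\xi)\mapsto\xi$, its co-anchor is $\alpha\mapsto(\alpha,0,0)$, its pairing is induced by $$\langle(\alpha,t,\xi),(\beta,s,\eta)\rangle=\langle t,s\rangle+\iota_\eta\alpha+\iota_\xi\beta,$$ and its bracket is induced by $$[(\alpha,h\otimes q,\xi),(\beta,j\otimes p,\eta)]=\big(-\iota_\eta d\alpha+L_\xi\beta+j\langle q,p\rangle\,dh,\ \ hj\otimes[q,p]-\eta(h)\otimes q+\xi(j)\otimes p,\ \ [\xi,\eta]\big),$$ extended bi-additively (the functions $\langle q,p\rangle$ are pulled back to $Y$). **Lemma.** For every Courant algebroid $\mathcal Q$ on $X$, every closed 3-form $H$ on $X$ and every map of manifolds $f\colon Y\to X$, $$(f^{++}\mathcal Q)_{f^*H}=f^{++}(\mathcal Q_H)$$ as Courant algebroids on $Y$: the two have the same underlying $\mathcal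 O_Y$-module, anchor, co-anchor, pairing and bracket. -/

import Mathlib

open TopologicalSpace Filter Topology
open scoped TensorProduct

universe u v w z u' v' t

set_option linter.unusedSimpArgs false
set_option linter.unusedVariables false
set_option linter.checkUnivs false

/-- A common interface to the calculus of `𝕂`-valued functions on smooth, real-analytic and complex
manifolds: points, tangent spaces (with scalars in `𝕂`), functions regular at a point, and
differentials; `frames` says that locally there are coordinate functions `a i` and coordinate fields
`D i`, with the symmetry of second derivatives. The spaces used are those of manifolds, see
`manifoldSpace` at the end of the file. -/
structure DiffSpace (𝕂 : Type w) [Field 𝕂] where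
  pt : Type u
  [top : TopologicalSpace pt]
  V : pt → Type v
  [acg : ∀ x, AddCommGroup (V x)]
  [mod : ∀ x, Module 𝕂 (V x)]
  Reg : (pt → 𝕂) → pt → Prop
  d : (pt → 𝕂) → ∀ x, V x →ₗ[𝕂] 𝕂
  reg_congr : ∀ {f g : pt → 𝕂} {x : pt}, f =ᶠ[𝓝 x] g → Reg f x → Reg g x
  d_congr : ∀ {f g : pt → 𝕂} {x : pt}, f =ᶠ[𝓝 x] g → d f x = d g x
  reg_const : ∀ (c : 𝕂) (x : pt), Reg (fun _ => c) x
  reg_add : ∀ {f g : pt → 𝕂} {x : pt}, Reg f x → Reg g x → Reg (fun y => f y + g y) x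
  reg_mul : ∀ {f g : pt → 𝕂} {x : pt}, Reg f x → Reg g x → Reg (fun y => f y * g y) x
  d_const : ∀ (c : 𝕂) (x : pt), d (fun _ => c) x = 0
  d_add : ∀ {f g : pt → 𝕂} {x : pt}, Reg f x → Reg g x →
    d (fun y => f y + g y) x = d f x + d g x
  d_mul : ∀ {f g : pt → 𝕂} {x : pt}, Reg f x → Reg g x →
    d (fun y => f y * g y) x = f x • d g x + g x • d f x
  frames : ∀ x₀ : pt, ∃ (U : Opens pt) (m : ℕ) (a : Fin m → pt → 𝕂) (D : Fin m → ∀ x, V x),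
    x₀ ∈ U ∧ ∀ x ∈ U, (∀ i, Reg (a i) x) ∧ (∀ v : V x, v = ∑ i, d (a i) x v • D i x) ∧
      ∀ f : pt → 𝕂, Reg f x → (∀ i, Reg (fun y => d f y (D i y)) x) ∧
        ∀ i j, d (fun y => d f y (D j y)) x (D i x) = d (fun y => d f y (D i y)) x (D j x)

attribute [instance] DiffSpace.top DiffSpace.acg DiffSpace.mod

noncomputable section


namespace DiffSpace
variable {𝕂 : Type w} [Field 𝕂] (X : DiffSpace.{u, v} 𝕂)

/-- extension by zero -/
def ext {U : Opens X.pt} (h : U → 𝕂) : X.pt → 𝕂 := by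
  classical exact fun x => if hx : x ∈ U then h ⟨x, hx⟩ else 0

variable {X}
theorem ext_apply {U : Opens X.pt} (h : U → 𝕂) (x : U) : X.ext h x = h x := by
  simp [ext]

theorem ext_eventuallyEq {U W : Opens X.pt} {h : U → 𝕂} {g : X.pt → 𝕂} {x : X.pt} (hx : x ∈ W)
    (hW : W ≤ U) (H : ∀ (y : X.pt) (hy : y ∈ W), h ⟨y, hW hy⟩ = g y) : X.ext h =ᶠ[𝓝 x] g := by
  filter_upwards [W.isOpen.mem_nhds hx] with y hy
  rw [← H y hy, ← ext_apply h ⟨y, hW hy⟩]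

variable (X)
/-- Regular functions on `U`, as a subalgebra of all functions. -/
def Osub (U : Opens X.pt) : Subalgebra 𝕂 (U → 𝕂) where
  carrier := {h | ∀ x : U, X.Reg (X.ext h) x}
  mul_mem' {a b} ha hb x := X.reg_congr (ext_eventuallyEq x.2 le_rfl fun y hy => by
    simp [ext, hy]).symm (X.reg_mul (ha x) (hb x))
  add_mem' {a b} ha hb x := X.reg_congr (ext_eventuallyEq x.2 le_rfl fun y hy => by
    simp [ext, hy]).symm (X.reg_add (ha x) (hb x))
  algebraMap_mem' c x := X.reg_congr (ext_eventuallyEq x.2 le_rfl fun y hy => by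
    simp).symm (X.reg_const c x)


/-- Regular functions on `U`. -/
def O (U : Opens X.pt) : Type _ := X.Osub U

instance (U : Opens X.pt) : CommRing (X.O U) := inferInstanceAs (CommRing (X.Osub U))
instance (U : Opens X.pt) : Algebra 𝕂 (X.O U) := inferInstanceAs (Algebra 𝕂 (X.Osub U))
instance (U : Opens X.pt) : CommSemiring (X.O U) := inferInstance
instance (U : Opens X.pt) : Semiring (X.O U) := inferInstance
instance (U : Opens X.pt) : AddCommGroup (X.O U) := inferInstance
instance (U : Opens X.pt) : AddCommMonoid (X.O U) := inferInstance
instance (U : Opens X.pt) : Mul (X.O U) := inferInstance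
instance (U : Opens X.pt) : Add (X.O U) := inferInstance

variable {X}

section coe
variable {U : Opens X.pt} (f g : X.O U) (x : U)
theorem O_add : (f + g).1 x = f.1 x + g.1 x := rfl
theorem O_sub : (f - g).1 x = f.1 x - g.1 x := rfl
theorem O_mul : (f * g).1 x = f.1 x * g.1 x := rfl
theorem O_neg : (-f).1 x = - f.1 x := rfl
theorem O_zero : (0 : X.O U).1 x = 0 := rfl
theorem O_one : (1 : X.O U).1 x = 1 := rfl
theorem O_algebraMap (c : 𝕂) : (algebraMap 𝕂 (X.O U) c).1 x = c := rfl
end coe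

theorem O_of_local {U : Opens X.pt} (h : U → 𝕂)
    (H : ∀ x ∈ U, ∃ (W : Opens X.pt) (hW : W ≤ U), x ∈ W ∧ ∃ g : X.O W, ∀ y : W,
      h ⟨y, hW y.2⟩ = g.1 y) : h ∈ X.Osub U := fun x => by
  obtain ⟨W, hW, hx, g, hg⟩ := H x x.2
  refine X.reg_congr (ext_eventuallyEq hx hW fun y hy => ?_).symm (g.2 ⟨x, hx⟩)
  rw [hg ⟨y, hy⟩, ← ext_apply g.1 ⟨y, hy⟩]

/-- Restriction of functions. -/
def resO {V U : Opens X.pt} (h : V ≤ U) : X.O U →ₐ[𝕂] X.O V where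
  toFun f := ⟨fun x => f.1 ⟨x, h x.2⟩, fun x => X.reg_congr
    (ext_eventuallyEq x.2 h fun y hy => by simp [ext, hy]) (f.2 ⟨x, h x.2⟩)⟩
  map_one' := rfl
  map_mul' _ _ := rfl
  map_zero' := rfl
  map_add' _ _ := rfl
  commutes' _ := rfl

@[simp] theorem resO_apply {V U : Opens X.pt} (h : V ≤ U) (f : X.O U) (x : V) :
    (resO h f).1 x = f.1 ⟨x, h x.2⟩ := rfl

@[simp] theorem resO_resO {W V U : Opens X.pt} (h : W ≤ V) (h' : V ≤ U) (f : X.O U) :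
    resO h (resO h' f) = resO (h.trans h') f := rfl

/-- The differential of a function at a point. -/
def dAt {U : Opens X.pt} (h : X.O U) (x : U) : X.V x →ₗ[𝕂] 𝕂 := X.d (X.ext h.1) x

theorem dAt_eq {U V W : Opens X.pt} (h : X.O U) (g : X.O V) (hU : W ≤ U) (hV : W ≤ V)
    (H : ∀ y (hy : y ∈ W), h.1 ⟨y, hU hy⟩ = g.1 ⟨y, hV hy⟩) (x : W) :
    dAt h ⟨x, hU x.2⟩ = dAt g ⟨x, hV x.2⟩ :=
  X.d_congr (ext_eventuallyEq x.2 hU fun y hy => by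
    rw [H y hy, ← ext_apply g.1 ⟨y, hV hy⟩])

theorem dAt_res {U V : Opens X.pt} (h : V ≤ U) (f : X.O U) (x : V) :
    dAt (resO h f) x = dAt f ⟨x, h x.2⟩ :=
  dAt_eq (W := V) _ _ le_rfl h (fun _ _ => rfl) x

theorem dAt_add {U : Opens X.pt} (f g : X.O U) (x : U) :
    dAt (f + g) x = dAt f x + dAt g x := by
  rw [dAt, dAt, dAt, ← X.d_add (f.2 x) (g.2 x)]
  exact X.d_congr (ext_eventuallyEq x.2 le_rfl fun y hy => by simp [ext, hy, O_add])

theorem dAt_mul {U : Opens X.pt} (f g : X.O U) (x : U) :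
    dAt (f * g) x = f.1 x • dAt g x + g.1 x • dAt f x := by
  rw [dAt, dAt, dAt, ← ext_apply f.1, ← ext_apply g.1, ← X.d_mul (f.2 x) (g.2 x)]
  exact X.d_congr (ext_eventuallyEq x.2 le_rfl fun y hy => by simp [ext, hy, O_mul])

theorem dAt_algebraMap {U : Opens X.pt} (c : 𝕂) (x : U) :
    dAt (algebraMap 𝕂 (X.O U) c) x = 0 := by
  rw [dAt, ← X.d_const c x]
  exact X.d_congr (ext_eventuallyEq x.2 le_rfl fun y hy => O_algebraMap ⟨y, hy⟩ c)

theorem dAt_zero {U : Opens X.pt} (x : U) : dAt (0 : X.O U) x = 0 := by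
  simpa using dAt_algebraMap (U := U) (0 : 𝕂) x

theorem dAt_one {U : Opens X.pt} (x : U) : dAt (1 : X.O U) x = 0 := by
  simpa using dAt_algebraMap (U := U) (1 : 𝕂) x

theorem dAt_neg {U : Opens X.pt} (f : X.O U) (x : U) : dAt (-f) x = - dAt f x := by
  have := dAt_add f (-f) x
  rw [add_neg_cancel, dAt_zero] at this
  exact (neg_eq_of_add_eq_zero_right this.symm).symm

theorem dAt_sub {U : Opens X.pt} (f g : X.O U) (x : U) : dAt (f - g) x = dAt f x - dAt g x := by
  rw [sub_eq_add_neg, dAt_add, dAt_neg, sub_eq_add_neg]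

theorem dAt_sum {U : Opens X.pt} {ι : Type*} (s : Finset ι) (f : ι → X.O U) (x : U) :
    dAt (∑ i ∈ s, f i) x = ∑ i ∈ s, dAt (f i) x := by
  classical
  induction s using Finset.induction_on with
  | empty => simp [dAt_zero]
  | insert a s ha ih => rw [Finset.sum_insert ha, Finset.sum_insert ha, dAt_add, ih]

variable (X) in
/-- Vector fields on `U`: families of tangent vectors taking regular functions to regular
functions. -/
def Tsub (U : Opens X.pt) : Submodule (X.Osub U) (∀ x : U, X.V x) where
  carrier := {ξ | ∀ (V : Opens X.pt) (hV : V ≤ U) (h : X.O V),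
    (fun x : V => dAt h x (ξ ⟨x, hV x.2⟩)) ∈ X.Osub V}
  add_mem' {a b} ha hb V hV h := by
    convert (X.Osub V).add_mem (ha V hV h) (hb V hV h) using 1
    ext x; simp
  zero_mem' V hV h := by
    convert (X.Osub V).zero_mem using 1
    ext x; simp
  smul_mem' c a ha V hV h := by
    convert (X.Osub V).mul_mem (resO hV c).2 (ha V hV h) using 1
    ext x
    exact map_smul (dAt h x) _ _

variable (X) in
/-- Vector fields on `U`. -/
def T (U : Opens X.pt) : Type _ := X.Tsub U

instance (U : Opens X.pt) : AddCommGroup (X.T U) := inferInstanceAs (AddCommGroup (X.Tsub U))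
instance (U : Opens X.pt) : AddCommMonoid (X.T U) := inferInstance
instance (U : Opens X.pt) : Module (X.O U) (X.T U) :=
  inferInstanceAs (Module (X.Osub U) (X.Tsub U))

/-- The action of a vector field on a function. -/
def act {U : Opens X.pt} (ξ : X.T U) (h : X.O U) : X.O U :=
  ⟨fun x => dAt h x (ξ.1 x), ξ.2 U le_rfl h⟩

theorem act_apply {U : Opens X.pt} (ξ : X.T U) (h : X.O U) (x : U) :
    (act ξ h).1 x = dAt h x (ξ.1 x) := rfl

def resT {V U : Opens X.pt} (h : V ≤ U) : X.T U →+ X.T V where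
  toFun ξ := ⟨fun x => ξ.1 ⟨x, h x.2⟩, fun W hW g => ξ.2 W (hW.trans h) g⟩
  map_zero' := rfl
  map_add' _ _ := rfl

@[simp] theorem resT_apply {V U : Opens X.pt} (h : V ≤ U) (ξ : X.T U) (x : V) :
    (resT h ξ).1 x = ξ.1 ⟨x, h x.2⟩ := rfl
@[simp] theorem resT_resT {W V U : Opens X.pt} (h : W ≤ V) (h' : V ≤ U) (f : X.T U) :
    resT h (resT h' f) = resT (h.trans h') f := rfl
@[simp] theorem resT_self {U : Opens X.pt} (f : X.T U) : resT le_rfl f = f := rfl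
@[simp] theorem resO_self {U : Opens X.pt} (f : X.O U) : resO le_rfl f = f := rfl
theorem resT_smul {V U : Opens X.pt} (h : V ≤ U) (f : X.O U) (ξ : X.T U) :
    resT h (f • ξ) = resO h f • resT h ξ := rfl

theorem O_ext {U : Opens X.pt} {f g : X.O U} (h : ∀ x : U, f.1 x = g.1 x) : f = g :=
  Subtype.ext (funext h)
theorem T_ext' {U : Opens X.pt} {f g : X.T U} (h : ∀ x : U, f.1 x = g.1 x) : f = g :=
  Subtype.ext (funext h)

theorem res_act {V U : Opens X.pt} (h : V ≤ U) (ξ : X.T U) (f : X.O U) :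
    resO h (act ξ f) = act (resT h ξ) (resO h f) :=
  O_ext fun x => by simp [act_apply, dAt_res]

section actlemmas
variable {U : Opens X.pt} (ξ η : X.T U) (f g : X.O U)
theorem act_add : act ξ (f + g) = act ξ f + act ξ g :=
  O_ext fun x => by simp [act_apply, O_add, dAt_add]
theorem act_sub : act ξ (f - g) = act ξ f - act ξ g :=
  O_ext fun x => by simp [act_apply, O_sub, dAt_sub]
theorem act_zero : act ξ (0 : X.O U) = 0 :=
  O_ext fun x => by simp [act_apply, O_zero, dAt_zero]
theorem act_neg : act ξ (-f) = - act ξ f := by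
  rw [← zero_sub, act_sub, act_zero, zero_sub]
theorem act_one : act ξ (1 : X.O U) = 0 :=
  O_ext fun x => by simp [act_apply, O_zero, dAt_one]
theorem act_mul : act ξ (f * g) = f * act ξ g + g * act ξ f :=
  O_ext fun x => by simp [act_apply, O_mul, O_add, dAt_mul]
theorem add_act : act (ξ + η) f = act ξ f + act η f :=
  O_ext fun x => map_add (dAt f x) _ _
theorem sub_act : act (ξ - η) f = act ξ f - act η f :=
  O_ext fun x => map_sub (dAt f x) _ _
theorem neg_act : act (-ξ) f = - act ξ f :=
  O_ext fun x => map_neg (dAt f x) _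
theorem zero_act : act (0 : X.T U) f = 0 :=
  O_ext fun x => map_zero (dAt f x)
theorem smul_act : act (f • ξ) g = f * act ξ g :=
  O_ext fun x => map_smul (dAt g x) _ _
theorem act_sum {ι : Type*} (s : Finset ι) (F : ι → X.O U) :
    act ξ (∑ i ∈ s, F i) = ∑ i ∈ s, act ξ (F i) :=
  map_sum (AddMonoidHom.mk' (act ξ) (act_add ξ)) F s
theorem sum_act {ι : Type*} (s : Finset ι) (F : ι → X.T U) :
    act (∑ i ∈ s, F i) f = ∑ i ∈ s, act (F i) f :=
  map_sum (AddMonoidHom.mk' (fun ξ => act ξ f) fun ξ η => add_act ξ η f) F s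
end actlemmas

variable (X) in
/-- 1-forms on `U`: families of covectors taking vector fields to regular functions. -/
def Ωsub (U : Opens X.pt) : Submodule (X.Osub U) (∀ x : U, X.V x →ₗ[𝕂] 𝕂) where
  carrier := {α | ∀ (V : Opens X.pt) (hV : V ≤ U) (ξ : X.T V),
    (fun x : V => α ⟨x, hV x.2⟩ (ξ.1 x)) ∈ X.Osub V}
  add_mem' ha hb V hV h := (X.Osub V).add_mem (ha V hV h) (hb V hV h)
  zero_mem' V _ _ := (X.Osub V).zero_mem
  smul_mem' c _ ha V hV h := (X.Osub V).mul_mem (resO hV c).2 (ha V hV h)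

variable (X) in
/-- 1-forms on `U`. -/
def Ω (U : Opens X.pt) : Type _ := X.Ωsub U

instance (U : Opens X.pt) : AddCommGroup (X.Ω U) := inferInstanceAs (AddCommGroup (X.Ωsub U))
instance (U : Opens X.pt) : AddCommMonoid (X.Ω U) := inferInstance
instance (U : Opens X.pt) : Module (X.O U) (X.Ω U) :=
  inferInstanceAs (Module (X.Osub U) (X.Ωsub U))

/-- The contraction of a 1-form with a vector field. -/
def pair {U : Opens X.pt} (α : X.Ω U) (ξ : X.T U) : X.O U :=
  ⟨fun x => α.1 x (ξ.1 x), α.2 U le_rfl ξ⟩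

def resΩ {V U : Opens X.pt} (h : V ≤ U) : X.Ω U →+ X.Ω V where
  toFun ξ := ⟨fun x => ξ.1 ⟨x, h x.2⟩, fun W hW g => ξ.2 W (hW.trans h) g⟩
  map_zero' := rfl
  map_add' _ _ := rfl

/-- The de Rham differential of a function. -/
def dO {U : Opens X.pt} : X.O U →+ X.Ω U where
  toFun f := ⟨fun x => dAt f x, fun V hV ξ => by
    convert (act ξ (resO hV f)).2 using 1
    ext x; rw [act_apply, dAt_res]⟩
  map_zero' := Subtype.ext (funext fun x => dAt_zero x)
  map_add' f g := Subtype.ext (funext fun x => dAt_add f g x)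

@[simp] theorem resΩ_apply {V U : Opens X.pt} (h : V ≤ U) (ξ : X.Ω U) (x : V) :
    (resΩ h ξ).1 x = ξ.1 ⟨x, h x.2⟩ := rfl
@[simp] theorem resΩ_resΩ {W V U : Opens X.pt} (h : W ≤ V) (h' : V ≤ U) (f : X.Ω U) :
    resΩ h (resΩ h' f) = resΩ (h.trans h') f := rfl
@[simp] theorem resΩ_self {U : Opens X.pt} (f : X.Ω U) : resΩ le_rfl f = f := rfl
theorem resΩ_smul {V U : Opens X.pt} (h : V ≤ U) (f : X.O U) (ξ : X.Ω U) :
    resΩ h (f • ξ) = resO h f • resΩ h ξ := rfl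
theorem res_pair {V U : Opens X.pt} (h : V ≤ U) (α : X.Ω U) (ξ : X.T U) :
    resO h (pair α ξ) = pair (resΩ h α) (resT h ξ) := rfl
theorem res_dO {V U : Opens X.pt} (h : V ≤ U) (f : X.O U) :
    resΩ h (dO f) = dO (resO h f) :=
  Subtype.ext (funext fun x => (dAt_res h f x).symm)

section pairlemmas
variable {U : Opens X.pt} (ξ η : X.T U) (f g : X.O U) (α β : X.Ω U)
theorem pair_dO : pair (dO f) ξ = act ξ f := rfl
theorem add_pair : pair (α + β) ξ = pair α ξ + pair β ξ := rfl
theorem sub_pair : pair (α - β) ξ = pair α ξ - pair β ξ := rfl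
theorem neg_pair : pair (-α) ξ = - pair α ξ := rfl
theorem zero_pair : pair (0 : X.Ω U) ξ = 0 := rfl
theorem smul_pair : pair (f • α) ξ = f * pair α ξ := rfl
theorem pair_add : pair α (ξ + η) = pair α ξ + pair α η := O_ext fun x => map_add (α.1 x) _ _
theorem pair_sub : pair α (ξ - η) = pair α ξ - pair α η := O_ext fun x => map_sub (α.1 x) _ _
theorem pair_neg : pair α (-ξ) = - pair α ξ := O_ext fun x => map_neg (α.1 x) _
theorem pair_zero : pair α (0 : X.T U) = 0 := O_ext fun x => map_zero (α.1 x)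
theorem pair_smul : pair α (f • ξ) = f * pair α ξ := O_ext fun x => map_smul (α.1 x) _ _
theorem sum_pair {ι : Type*} (s : Finset ι) (F : ι → X.Ω U) :
    pair (∑ i ∈ s, F i) ξ = ∑ i ∈ s, pair (F i) ξ :=
  map_sum (AddMonoidHom.mk' (fun α => pair α ξ) fun α β => add_pair ξ α β) F s
theorem pair_sum {ι : Type*} (s : Finset ι) (F : ι → X.T U) :
    pair α (∑ i ∈ s, F i) = ∑ i ∈ s, pair α (F i) :=
  map_sum (AddMonoidHom.mk' (pair α) fun ξ η => pair_add ξ η α) F s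
theorem dO_mul : dO (f * g) = f • dO g + g • dO f :=
  Subtype.ext (funext fun x => dAt_mul f g x)
theorem dO_one : dO (1 : X.O U) = 0 := Subtype.ext (funext fun x => dAt_one x)
end pairlemmas

/-- A frame of vector fields on `W` given by local coordinates. -/
structure Frame (W : Opens X.pt) where
  m : ℕ
  a : Fin m → X.O W
  D : Fin m → X.T W
  expand : ∀ (x : W) (v : X.V x), v = ∑ i, dAt (a i) x v • (D i).1 x
  comm : ∀ (i j : Fin m) (V : Opens X.pt) (h : V ≤ W) (f : X.O V),
    act (resT h (D i)) (act (resT h (D j)) f) = act (resT h (D j)) (act (resT h (D i)) f)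

def Frame.res {W V : Opens X.pt} (F : Frame W) (h : V ≤ W) : Frame V where
  m := F.m
  a i := resO h (F.a i)
  D i := resT h (F.D i)
  expand x v := by simpa [dAt_res] using F.expand ⟨x, h x.2⟩ v
  comm i j V' h' f := F.comm i j V' (h'.trans h) f

variable (X) in
theorem exists_frame (U : Opens X.pt) (x₀ : X.pt) (hx₀ : x₀ ∈ U) :
    ∃ W ≤ U, x₀ ∈ W ∧ Nonempty (Frame (X := X) W) := by
  obtain ⟨U', m, a, D, h0, H⟩ := X.frames x₀
  have key : ∀ (V : Opens X.pt) (h : V ≤ U') (f : X.O V) (i : Fin m) (x : V),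
      X.d (X.ext fun y : V => dAt f y (D i y)) x = X.d (fun y => X.d (X.ext f.1) y (D i y)) x :=
    fun V h f i x => X.d_congr (ext_eventuallyEq x.2 le_rfl fun y hy => rfl)
  have key2 : ∀ (V : Opens X.pt) (h : V ≤ U') (f : X.O V) (i : Fin m),
      (fun y : V => dAt f y (D i y)) ∈ X.Osub V := fun V h f i x =>
    X.reg_congr (ext_eventuallyEq x.2 le_rfl fun y hy => rfl).symm
      (((H x (h x.2)).2.2 _ (f.2 x)).1 i)
  refine ⟨U ⊓ U', inf_le_left, ⟨hx₀, h0⟩, ⟨⟨m, fun i => ⟨fun x => a i x, fun x => ?_⟩,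
    fun i => ⟨fun x => D i x, fun V hV f => key2 V (hV.trans inf_le_right) f i⟩, ?_, ?_⟩⟩⟩
  · exact X.reg_congr (ext_eventuallyEq x.2 le_rfl fun y hy => rfl).symm ((H x x.2.2).1 i)
  · intro x v
    conv_lhs => rw [(H x x.2.2).2.1 v]
    refine Finset.sum_congr rfl fun i _ => ?_
    congr 2
    exact X.d_congr (ext_eventuallyEq x.2 le_rfl fun y hy => rfl).symm
  · intro i j V h f
    refine O_ext fun x => ?_
    change X.d (X.ext fun y : V => dAt f y (D j y)) x (D i x) =
      X.d (X.ext fun y : V => dAt f y (D i y)) x (D j x)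
    rw [key _ (h.trans inf_le_right), key _ (h.trans inf_le_right)]
    exact ((H x (h x.2).2).2.2 _ (f.2 x)).2 i j

end DiffSpace


namespace DiffSpace
variable {𝕂 : Type w} [Field 𝕂] {X : DiffSpace.{u, v} 𝕂}

namespace Frame
variable {W : Opens X.pt} (F : Frame W)

theorem expand_T (ξ : X.T W) : ξ = ∑ i, act ξ (F.a i) • F.D i :=
  T_ext' fun x => by
    have h : ∀ s : Finset (Fin F.m), (∑ i ∈ s, act ξ (F.a i) • F.D i).1 x =
        ∑ i ∈ s, (act ξ (F.a i) • F.D i).1 x := fun s =>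
      map_sum (AddMonoidHom.mk' (fun η : X.T W => η.1 x) fun _ _ => rfl) _ s
    rw [h]
    exact F.expand x (ξ.1 x)

theorem act_eq (ξ : X.T W) (f : X.O W) : act ξ f = ∑ i, act ξ (F.a i) * act (F.D i) f := by
  conv_lhs => rw [F.expand_T ξ, sum_act]
  simp_rw [smul_act]

theorem pair_eq (α : X.Ω W) (ξ : X.T W) :
    pair α ξ = ∑ i, act ξ (F.a i) * pair α (F.D i) := by
  conv_lhs => rw [F.expand_T ξ, pair_sum]
  simp_rw [pair_smul]

end Frame

theorem T_ext {U : Opens X.pt} {ξ η : X.T U}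
    (H : ∀ (V : Opens X.pt) (h : V ≤ U) (f : X.O V), act (resT h ξ) f = act (resT h η) f) :
    ξ = η := T_ext' fun x => by
  obtain ⟨W, hW, hx, ⟨F⟩⟩ := X.exists_frame U x x.2
  have : resT hW ξ = resT hW η := by
    rw [F.expand_T (resT hW ξ), F.expand_T (resT hW η)]
    simp_rw [H W hW]
  exact congrArg (fun ζ : X.T W => ζ.1 ⟨x, hx⟩) this

theorem Ω_ext {U : Opens X.pt} {α β : X.Ω U}
    (H : ∀ (V : Opens X.pt) (h : V ≤ U) (ξ : X.T V), pair (resΩ h α) ξ = pair (resΩ h β) ξ) :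
    α = β := Subtype.ext <| funext fun x => LinearMap.ext fun v => by
  obtain ⟨W, hW, hx, ⟨F⟩⟩ := X.exists_frame U x x.2
  rw [F.expand ⟨x, hx⟩ v, map_sum, map_sum]
  refine Finset.sum_congr rfl fun i _ => ?_
  rw [map_smul, map_smul]
  congr 1
  exact congrArg (fun g : X.O W => g.1 ⟨x, hx⟩) (H W hW (F.D i))

theorem Ω_expand {W : Opens X.pt} (F : Frame W) (α : X.Ω W) :
    α = ∑ i, pair α (F.D i) • dO (F.a i) := Ω_ext fun V h ξ => by
  have := (F.res h).pair_eq (resΩ h α) ξ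
  rw [this, map_sum, sum_pair]
  refine Finset.sum_congr rfl fun i _ => ?_
  rw [resΩ_smul, smul_pair, res_dO, pair_dO, mul_comm]
  rfl

theorem T_of_local {U : Opens X.pt} (s : ∀ x : U, X.V x)
    (H : ∀ x ∈ U, ∃ (W : Opens X.pt) (hW : W ≤ U), x ∈ W ∧ ∃ ξ : X.T W, ∀ y : W,
      s ⟨y, hW y.2⟩ = ξ.1 y) : s ∈ X.Tsub U := fun V hV h => by
  refine O_of_local _ fun x hx => ?_
  obtain ⟨W, hW, hxW, ξ, hξ⟩ := H x (hV hx)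
  refine ⟨V ⊓ W, inf_le_left, ⟨hx, hxW⟩, act (resT inf_le_right ξ) (resO inf_le_left h), ?_⟩
  intro y
  rw [act_apply, dAt_res, resT_apply, ← hξ ⟨y, y.2.2⟩]

theorem Ω_of_local {U : Opens X.pt} (s : ∀ x : U, X.V x →ₗ[𝕂] 𝕂)
    (H : ∀ x ∈ U, ∃ (W : Opens X.pt) (hW : W ≤ U), x ∈ W ∧ ∃ α : X.Ω W, ∀ y : W,
      s ⟨y, hW y.2⟩ = α.1 y) : s ∈ X.Ωsub U := fun V hV ξ => by
  refine O_of_local _ fun x hx => ?_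
  obtain ⟨W, hW, hxW, α, hα⟩ := H x (hV hx)
  refine ⟨V ⊓ W, inf_le_left, ⟨hx, hxW⟩, pair (resΩ inf_le_right α) (resT inf_le_left ξ), ?_⟩
  intro y
  rw [hα ⟨y, y.2.2⟩]
  rfl

namespace Frame
variable {W : Opens X.pt} (F : Frame W)

/-- The Lie bracket of vector fields in coordinates. -/
def br (ξ η : X.T W) : X.T W := ∑ i, (act ξ (act η (F.a i)) - act η (act ξ (F.a i))) • F.D i

theorem act_act (ξ η : X.T W) (f : X.O W) :
    act ξ (act η f) = ∑ i, act ξ (act η (F.a i)) * act (F.D i) f +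
      ∑ i, ∑ j, act η (F.a i) * act ξ (F.a j) * act (F.D j) (act (F.D i) f) := by
  rw [F.act_eq η f, act_sum, ← Finset.sum_add_distrib]
  refine Finset.sum_congr rfl fun i _ => ?_
  rw [act_mul, F.act_eq ξ (act (F.D i) f), Finset.mul_sum, add_comm]
  congr 1
  · ring
  · exact Finset.sum_congr rfl fun j _ => by ring

theorem br_act (ξ η : X.T W) (f : X.O W) :
    act (F.br ξ η) f = act ξ (act η f) - act η (act ξ f) := by
  rw [F.act_act ξ η f, F.act_act η ξ f, br, sum_act]
  rw [Finset.sum_comm (f := fun i j => act ξ (F.a i) * act η (F.a j) * _)]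
  have h : ∀ i j, act (F.D i) (act (F.D j) f) = act (F.D j) (act (F.D i) f) :=
    fun i j => F.comm i j W le_rfl f
  simp_rw [smul_act, sub_mul, Finset.sum_sub_distrib]
  have : ∑ i, ∑ j, act η (F.a i) * act ξ (F.a j) * act (F.D j) (act (F.D i) f) =
      ∑ i, ∑ j, act ξ (F.a j) * act η (F.a i) * act (F.D i) (act (F.D j) f) :=
    Finset.sum_congr rfl fun i _ => Finset.sum_congr rfl fun j _ => by rw [h i j]; ring
  rw [this]; abel

theorem br_res {V : Opens X.pt} (h : V ≤ W) (ξ η : X.T W) :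
    resT h (F.br ξ η) = (F.res h).br (resT h ξ) (resT h η) := by
  simp only [br, map_sum, resT_smul, map_sub, res_act]
  rfl

theorem br_indep (F' : Frame W) (ξ η : X.T W) : F.br ξ η = F'.br ξ η :=
  T_ext fun V h f => by rw [br_res, br_res, br_act, br_act]

end Frame

theorem exists_br {U : Opens X.pt} (ξ η : X.T U) : ∃ ζ : X.T U,
    ∀ (V : Opens X.pt) (h : V ≤ U) (f : X.O V),
      act (resT h ζ) f = act (resT h ξ) (act (resT h η) f) - act (resT h η) (act (resT h ξ) f) := by
  choose W hW hx F using fun x : U => X.exists_frame U x x.2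
  have key : ∀ (V : Opens X.pt) (hV : V ≤ U) (G : Frame V) (y : V),
      (((F ⟨y, hV y.2⟩).some.br (resT (hW _) ξ) (resT (hW _) η)).1 ⟨y, hx _⟩ : X.V y) =
      (G.br (resT hV ξ) (resT hV η)).1 y := by
    intro V hV G y
    set y' : U := ⟨y, hV y.2⟩
    have h1 := (F y').some.br_res (inf_le_left : W y' ⊓ V ≤ _) (resT (hW _) ξ) (resT (hW _) η)
    have h2 := G.br_res (inf_le_right : W y' ⊓ V ≤ _) (resT hV ξ) (resT hV η)
    have h3 := h1.trans ((Frame.br_indep _ (G.res inf_le_right) _ _).trans h2.symm)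
    exact congrArg (fun ζ : X.T (W y' ⊓ V) => ζ.1 ⟨y, hx y', y.2⟩) h3
  refine ⟨⟨fun x => ((F x).some.br (resT (hW _) ξ) (resT (hW _) η)).1 ⟨x, hx _⟩, ?_⟩, ?_⟩
  · exact T_of_local _ fun x hx' => ⟨W ⟨x, hx'⟩, hW _, hx ⟨x, hx'⟩,
      _, fun y => key _ (hW _) (F ⟨x, hx'⟩).some y⟩
  · intro V h f
    refine O_ext fun x => ?_
    set x' : U := ⟨x, h x.2⟩
    have h1 := (((F x').some.res (inf_le_left : W x' ⊓ V ≤ _)).br_act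
      (resT (inf_le_left.trans (hW x')) ξ) (resT (inf_le_left.trans (hW x')) η)
      (resO inf_le_right f))
    have h2 := congrArg (fun g : X.O (W x' ⊓ V) => g.1 ⟨x, hx x', x.2⟩) h1
    have h3 := key _ (inf_le_left.trans (hW x')) ((F x').some.res (inf_le_left : W x' ⊓ V ≤ _))
      ⟨x, hx x', x.2⟩
    have e1 := congrArg (fun g : X.O (W x' ⊓ V) => g.1 ⟨x, hx x', x.2⟩)
      ((res_act (inf_le_right : W x' ⊓ V ≤ V) (resT h ξ) (act (resT h η) f)).trans
        (congrArg (act _) (res_act _ (resT h η) f)))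
    have e2 := congrArg (fun g : X.O (W x' ⊓ V) => g.1 ⟨x, hx x', x.2⟩)
      ((res_act (inf_le_right : W x' ⊓ V ≤ V) (resT h η) (act (resT h ξ) f)).trans
        (congrArg (act _) (res_act _ (resT h ξ) f)))
    change _ = (act _ (act _ f)).1 x - (act _ (act _ f)).1 x
    refine Eq.trans ?_ (h2.trans (congrArg₂ (· - ·) e1.symm e2.symm))
    change dAt f x _ = dAt _ _ _
    rw [dAt_res, ← h3]
    rfl

/-- The Lie bracket of vector fields: the commutator of the actions on functions, see
`lb_act_res`. -/
def lb {U : Opens X.pt} (ξ η : X.T U) : X.T U := (exists_br ξ η).choose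

theorem lb_act_res {U V : Opens X.pt} (h : V ≤ U) (ξ η : X.T U) (f : X.O V) :
    act (resT h (lb ξ η)) f =
      act (resT h ξ) (act (resT h η) f) - act (resT h η) (act (resT h ξ) f) :=
  (exists_br ξ η).choose_spec V h f

theorem lb_act {U : Opens X.pt} (ξ η : X.T U) (f : X.O U) :
    act (lb ξ η) f = act ξ (act η f) - act η (act ξ f) := lb_act_res le_rfl ξ η f

theorem res_lb {U V : Opens X.pt} (h : V ≤ U) (ξ η : X.T U) :
    resT h (lb ξ η) = lb (resT h ξ) (resT h η) := T_ext fun W hW f => by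
  rw [lb_act_res, resT_resT, lb_act_res]; rfl

section lb
variable {U : Opens X.pt} (ξ η ζ : X.T U) (f : X.O U)
theorem lb_add : lb ξ (η + ζ) = lb ξ η + lb ξ ζ := T_ext fun V h f => by
  simp only [map_add, lb_act_res, add_act, act_add]; ring
theorem add_lb : lb (ξ + η) ζ = lb ξ ζ + lb η ζ := T_ext fun V h f => by
  simp only [map_add, lb_act_res, add_act, act_add]; ring
theorem lb_self_add : lb ξ η + lb η ξ = 0 := T_ext fun V h f => by
  simp only [map_add, map_zero, zero_act, lb_act_res, add_act]; ring
theorem lb_smul : lb ξ (f • η) = f • lb ξ η + act ξ f • η := T_ext fun V h g => by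
  simp only [map_add, lb_act_res, add_act, resT_smul, smul_act, act_mul, res_act]; ring
theorem lb_lb : lb ξ (lb η ζ) = lb (lb ξ η) ζ + lb η (lb ξ ζ) := T_ext fun V h g => by
  simp only [map_add, lb_act_res, add_act, act_sub]; ring
theorem lb_zero : lb ξ 0 = 0 := T_ext fun V h g => by
  simp only [map_zero, lb_act_res, zero_act, act_zero]; ring
theorem zero_lb : lb 0 ξ = 0 := T_ext fun V h g => by
  simp only [map_zero, lb_act_res, zero_act, act_zero]; ring
end lb

/-- The Lie derivative in coordinates. -/
def Frame.lie {W : Opens X.pt} (F : Frame W) (ξ : X.T W) (β : X.Ω W) : X.Ω W :=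
  ∑ i, (act ξ (pair β (F.D i)) • dO (F.a i) + pair β (F.D i) • dO (act ξ (F.a i)))

theorem Frame.lie_pair {W : Opens X.pt} (F : Frame W) (ξ : X.T W) (β : X.Ω W) (η : X.T W) :
    pair (F.lie ξ β) η = act ξ (pair β η) - pair β (lb ξ η) := by
  rw [F.pair_eq β η, F.pair_eq β (lb ξ η), lie, sum_pair, act_sum, ← Finset.sum_sub_distrib]
  refine Finset.sum_congr rfl fun i _ => ?_
  rw [add_pair, smul_pair, smul_pair, pair_dO, pair_dO, act_mul, lb_act]
  ring

theorem Frame.lie_res {V W : Opens X.pt} (F : Frame W) (h : V ≤ W) (ξ : X.T W) (β : X.Ω W) :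
    resΩ h (F.lie ξ β) = (F.res h).lie (resT h ξ) (resΩ h β) := by
  simp only [lie, map_sum, map_add, resΩ_smul, res_dO, res_act, res_pair]
  rfl

theorem Frame.lie_indep {W : Opens X.pt} (F F' : Frame W) (ξ : X.T W) (β : X.Ω W) :
    F.lie ξ β = F'.lie ξ β :=
  Ω_ext fun V h f => by rw [lie_res, lie_res, lie_pair, lie_pair]

theorem exists_lie {U : Opens X.pt} (ξ : X.T U) (β : X.Ω U) : ∃ γ : X.Ω U,
    ∀ (V : Opens X.pt) (h : V ≤ U) (η : X.T V),
      pair (resΩ h γ) η = act (resT h ξ) (pair (resΩ h β) η) - pair (resΩ h β) (lb (resT h ξ) η) := by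
  choose W hW hx F using fun x : U => X.exists_frame U x x.2
  have key : ∀ (V : Opens X.pt) (hV : V ≤ U) (G : Frame V) (y : V),
      (((F ⟨y, hV y.2⟩).some.lie (resT (hW _) ξ) (resΩ (hW _) β)).1 ⟨y, hx _⟩ : X.V y →ₗ[𝕂] 𝕂) =
      (G.lie (resT hV ξ) (resΩ hV β)).1 y := by
    intro V hV G y
    set y' : U := ⟨y, hV y.2⟩
    have h1 := (F y').some.lie_res (inf_le_left : W y' ⊓ V ≤ _) (resT (hW _) ξ) (resΩ (hW _) β)
    have h2 := G.lie_res (inf_le_right : W y' ⊓ V ≤ _) (resT hV ξ) (resΩ hV β)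
    have h3 := h1.trans ((Frame.lie_indep _ (G.res inf_le_right) _ _).trans h2.symm)
    exact congrArg (fun ζ : X.Ω (W y' ⊓ V) => ζ.1 ⟨y, hx y', y.2⟩) h3
  refine ⟨⟨fun x => ((F x).some.lie (resT (hW _) ξ) (resΩ (hW _) β)).1 ⟨x, hx _⟩, ?_⟩, ?_⟩
  · exact Ω_of_local _ fun x hx' => ⟨W ⟨x, hx'⟩, hW _, hx ⟨x, hx'⟩,
      _, fun y => key _ (hW _) (F ⟨x, hx'⟩).some y⟩
  · intro V h η
    refine O_ext fun x => ?_
    set x' : U := ⟨x, h x.2⟩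
    have h1 := (((F x').some.res (inf_le_left : W x' ⊓ V ≤ _)).lie_pair
      (resT (inf_le_left.trans (hW x')) ξ) (resΩ (inf_le_left.trans (hW x')) β)
      (resT inf_le_right η))
    have h2 := congrArg (fun g : X.O (W x' ⊓ V) => g.1 ⟨x, hx x', x.2⟩) h1
    have h3 := key _ (inf_le_left.trans (hW x')) ((F x').some.res (inf_le_left : W x' ⊓ V ≤ _))
      ⟨x, hx x', x.2⟩
    have e1 := congrArg (fun g : X.O (W x' ⊓ V) => g.1 ⟨x, hx x', x.2⟩)
      (res_act (inf_le_right : W x' ⊓ V ≤ V) (resT h ξ) (pair (resΩ h β) η))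
    have e2 := congrArg (fun g : X.O (W x' ⊓ V) => g.1 ⟨x, hx x', x.2⟩)
      (res_pair (inf_le_right : W x' ⊓ V ≤ V) (resΩ h β) (lb (resT h ξ) η))
    rw [res_lb] at e2
    rw [res_pair] at e1
    change _ = (act _ _).1 x - (pair _ _).1 x
    refine Eq.trans ?_ (h2.trans (congrArg₂ (· - ·) e1.symm e2.symm))
    exact congrArg (fun L : X.V x →ₗ[𝕂] 𝕂 => L (η.1 x)) h3

/-- The Lie derivative of a 1-form: `(L_ξ β)(η) = ξ(β(η)) - β([ξ, η])`, see `lie_pair_res`. -/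
def lie {U : Opens X.pt} (ξ : X.T U) (β : X.Ω U) : X.Ω U := (exists_lie ξ β).choose

theorem lie_pair_res {U V : Opens X.pt} (h : V ≤ U) (ξ : X.T U) (β : X.Ω U) (η : X.T V) :
    pair (resΩ h (lie ξ β)) η =
      act (resT h ξ) (pair (resΩ h β) η) - pair (resΩ h β) (lb (resT h ξ) η) :=
  (exists_lie ξ β).choose_spec V h η

theorem lie_pair {U : Opens X.pt} (ξ : X.T U) (β : X.Ω U) (η : X.T U) :
    pair (lie ξ β) η = act ξ (pair β η) - pair β (lb ξ η) := lie_pair_res le_rfl ξ β η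

theorem res_lie {U V : Opens X.pt} (h : V ≤ U) (ξ : X.T U) (β : X.Ω U) :
    resΩ h (lie ξ β) = lie (resT h ξ) (resΩ h β) := Ω_ext fun W hW f => by
  rw [lie_pair_res, resΩ_resΩ, lie_pair_res]; rfl

section lie
variable {U : Opens X.pt} (ξ η ζ : X.T U) (f : X.O U) (α β : X.Ω U)
theorem lie_add : lie ξ (α + β) = lie ξ α + lie ξ β := Ω_ext fun V h f => by
  simp only [map_add, lie_pair_res, add_pair, act_add]; ring
theorem add_lie : lie (ξ + η) α = lie ξ α + lie η α := Ω_ext fun V h f => by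
  simp only [map_add, lie_pair_res, add_pair, add_act, add_lb, pair_add]; ring
theorem lie_smul : lie ξ (f • α) = f • lie ξ α + act ξ f • α := Ω_ext fun V h g => by
  simp only [map_add, lie_pair_res, add_pair, resΩ_smul, smul_pair, act_mul, res_act]; ring
theorem lie_dO : lie ξ (dO f) = dO (act ξ f) := Ω_ext fun V h g => by
  simp only [lie_pair_res, res_dO, pair_dO, lb_act, res_act]; ring
theorem lie_zero : lie ξ (0 : X.Ω U) = 0 := Ω_ext fun V h g => by
  simp only [lie_pair_res, map_zero, zero_pair, act_zero]; ring
theorem zero_lie : lie (0 : X.T U) α = 0 := Ω_ext fun V h g => by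
  simp only [lie_pair_res, map_zero, zero_pair, zero_act, zero_lb, pair_zero]; ring
theorem lie_lie : lie (lb ξ η) α = lie ξ (lie η α) - lie η (lie ξ α) := Ω_ext fun V h g => by
  simp only [map_sub, sub_pair, res_lie, lie_pair, act_sub, res_lb, lb_act]
  rw [lb_lb (resT h ξ), pair_add]; ring
theorem smul_lie : lie (f • ξ) α = f • lie ξ α + pair α ξ • dO f := Ω_ext fun V h g => by
  have : lb (resO h f • resT h ξ) g = resO h f • lb (resT h ξ) g - act g (resO h f) • resT h ξ := by
    rw [eq_neg_of_add_eq_zero_left (lb_self_add (resO h f • resT h ξ) g), lb_smul,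
      eq_neg_of_add_eq_zero_left (lb_self_add g (resT h ξ)), smul_neg, neg_add_rev, neg_neg]; abel
  simp only [map_add, lie_pair_res, add_pair, resT_smul, resΩ_smul, smul_pair, smul_act, res_pair,
    res_dO, pair_dO, this, pair_sub, pair_smul]; ring
end lie

end DiffSpace


namespace DiffSpace
variable {𝕂 : Type w} [Field 𝕂]

/-- A 3-form: alternating trilinear forms on the tangent spaces, taking vector fields to regular
functions. -/
structure Form3 (X : DiffSpace.{u, v} 𝕂) where
  val : ∀ x : X.pt, X.V x [⋀^Fin 3]→ₗ[𝕂] 𝕂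
  regular : ∀ (U : Opens X.pt) (ξ η ζ : X.T U),
    (fun x : U => val x ![ξ.1 x, η.1 x, ζ.1 x]) ∈ X.Osub U

variable {X : DiffSpace.{u, v} 𝕂}

namespace Form3
variable (H : Form3 X) {U : Opens X.pt}

/-- `H(ξ, η, ζ)` -/
def eval (ξ η ζ : X.T U) : X.O U := ⟨_, H.regular U ξ η ζ⟩

/-- `dH = 0`, with `dH` given by its invariant formula. -/
def IsClosed : Prop := ∀ (U : Opens X.pt) (ξ₀ ξ₁ ξ₂ ξ₃ : X.T U),
  act ξ₀ (H.eval ξ₁ ξ₂ ξ₃) - act ξ₁ (H.eval ξ₀ ξ₂ ξ₃) + act ξ₂ (H.eval ξ₀ ξ₁ ξ₃)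
    - act ξ₃ (H.eval ξ₀ ξ₁ ξ₂) - H.eval (lb ξ₀ ξ₁) ξ₂ ξ₃ + H.eval (lb ξ₀ ξ₂) ξ₁ ξ₃
    - H.eval (lb ξ₀ ξ₃) ξ₁ ξ₂ - H.eval (lb ξ₁ ξ₂) ξ₀ ξ₃ + H.eval (lb ξ₁ ξ₃) ξ₀ ξ₂
    - H.eval (lb ξ₂ ξ₃) ξ₀ ξ₁ = 0

theorem val_swap01 {x : X.pt} (a b c : X.V x) : H.val x ![b, a, c] = - H.val x ![a, b, c] := by
  have := (H.val x).map_swap ![a, b, c] (i := 0) (j := 1) (by decide)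
  rw [← this]; congr 1; ext i; fin_cases i <;> rfl

theorem val_swap12 {x : X.pt} (a b c : X.V x) : H.val x ![a, c, b] = - H.val x ![a, b, c] := by
  have := (H.val x).map_swap ![a, b, c] (i := 1) (j := 2) (by decide)
  rw [← this]; congr 1; ext i; fin_cases i <;> rfl

theorem val_self01 {x : X.pt} (a c : X.V x) : H.val x ![a, a, c] = 0 :=
  (H.val x).map_eq_zero_of_eq ![a, a, c] (i := 0) (j := 1) rfl (by decide)

theorem val_self12 {x : X.pt} (a c : X.V x) : H.val x ![a, c, c] = 0 :=
  (H.val x).map_eq_zero_of_eq ![a, c, c] (i := 1) (j := 2) rfl (by decide)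

theorem val_add {x : X.pt} (a b c d : X.V x) :
    H.val x ![a + b, c, d] = H.val x ![a, c, d] + H.val x ![b, c, d] :=
  (H.val x).toMultilinearMap.cons_add _ _ _

theorem val_smul {x : X.pt} (r : 𝕂) (b c d : X.V x) :
    H.val x ![r • b, c, d] = r * H.val x ![b, c, d] :=
  (H.val x).toMultilinearMap.cons_smul _ _ _

theorem val_rot {x : X.pt} (a b c : X.V x) : H.val x ![b, c, a] = H.val x ![a, b, c] := by
  rw [H.val_swap12 b a c, H.val_swap01 a b c, neg_neg]

/-- The 1-form `ι_η ι_ξ H = H(ξ, η, ·)`. -/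
def contract (ξ η : X.T U) : X.Ω U :=
  ⟨fun x =>
    { toFun := fun v => H.val x ![ξ.1 x, η.1 x, v]
      map_add' := fun a b => by
        rw [H.val_rot (a + b), H.val_rot a, H.val_rot b, H.val_add]
      map_smul' := fun a b => by
        rw [H.val_rot (a • b), H.val_rot b, H.val_smul]; rfl },
    fun V hV ζ => H.regular V (resT hV ξ) (resT hV η) ζ⟩

variable (ξ η ζ ξ' : X.T U) (f : X.O U)
theorem pair_contract : pair (H.contract ξ η) ζ = H.eval ξ η ζ := rfl
theorem res_eval {V : Opens X.pt} (h : V ≤ U) :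
    resO h (H.eval ξ η ζ) = H.eval (resT h ξ) (resT h η) (resT h ζ) := rfl
theorem res_contract {V : Opens X.pt} (h : V ≤ U) :
    resΩ h (H.contract ξ η) = H.contract (resT h ξ) (resT h η) := rfl
theorem eval_swap01 : H.eval η ξ ζ = - H.eval ξ η ζ := O_ext fun _ => H.val_swap01 _ _ _
theorem eval_swap12 : H.eval ξ ζ η = - H.eval ξ η ζ := O_ext fun _ => H.val_swap12 _ _ _
theorem eval_rot : H.eval η ζ ξ = H.eval ξ η ζ := O_ext fun _ => H.val_rot _ _ _
theorem eval_self12 : H.eval ξ η η = 0 := O_ext fun _ => H.val_self12 _ _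
theorem eval_add : H.eval (ξ + ξ') η ζ = H.eval ξ η ζ + H.eval ξ' η ζ :=
  O_ext fun _ => H.val_add _ _ _ _
theorem eval_smul : H.eval (f • ξ) η ζ = f * H.eval ξ η ζ :=
  O_ext fun _ => H.val_smul _ _ _ _
theorem contract_swap : H.contract η ξ = - H.contract ξ η :=
  Subtype.ext <| funext fun _ => LinearMap.ext fun _ => H.val_swap01 _ _ _
theorem contract_add : H.contract (ξ + ξ') η = H.contract ξ η + H.contract ξ' η :=
  Subtype.ext <| funext fun _ => LinearMap.ext fun _ => H.val_add _ _ _ _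
theorem contract_smul : H.contract (f • ξ) η = f • H.contract ξ η :=
  Subtype.ext <| funext fun _ => LinearMap.ext fun _ => H.val_smul _ _ _ _
theorem contract_add' : H.contract η (ξ + ξ') = H.contract η ξ + H.contract η ξ' := by
  rw [contract_swap, contract_add, neg_add, ← contract_swap, ← contract_swap]
theorem contract_smul' : H.contract η (f • ξ) = f • H.contract η ξ := by
  rw [contract_swap, contract_smul, ← smul_neg, ← contract_swap]
theorem contract_zero : H.contract (0 : X.T U) η = 0 := by
  have := H.contract_smul (0 : X.T U) η 0
  rwa [zero_smul, zero_smul] at this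
theorem contract_zero' : H.contract η (0 : X.T U) = 0 := by
  rw [contract_swap, contract_zero, neg_zero]

end Form3

/-- A sheaf of modules over the sheaf of regular functions. -/
structure ModSheaf (X : DiffSpace.{u, v} 𝕂) where
  sec : Opens X.pt → Type z
  [acg : ∀ U, AddCommGroup (sec U)]
  [mod : ∀ U, Module (X.O U) (sec U)]
  res : ∀ {V U : Opens X.pt}, V ≤ U → sec U →+ sec V
  res_self : ∀ {U} (s : sec U), res le_rfl s = s
  res_res : ∀ {W V U} (h : W ≤ V) (h' : V ≤ U) (s : sec U),
    res h (res h' s) = res (h.trans h') s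
  res_smul : ∀ {V U} (h : V ≤ U) (f : X.O U) (s : sec U), res h (f • s) = resO h f • res h s
  separated : ∀ {U} (s t : sec U),
    (∀ x ∈ U, ∃ (W : Opens X.pt) (h : W ≤ U), x ∈ W ∧ res h s = res h t) → s = t
  glue : ∀ {ι : Type u} (W : ι → Opens X.pt) (s : ∀ i, sec (W i)),
    (∀ i j, res inf_le_left (s i) = res (inf_le_right : W i ⊓ W j ≤ W j) (s j)) →
    ∃ t : sec (⨆ i, W i), ∀ i, res (le_iSup W i) t = s i

attribute [instance] ModSheaf.acg ModSheaf.mod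

/-- A sheaf of modules with an anchor `π`, a co-anchor `π†` and a symmetric pairing, such that
`π π† = 0` and `⟨q, π†(α)⟩ = α(π(q))`. -/
structure AnchoredSheaf (X : DiffSpace.{u, v} 𝕂) extends ModSheaf.{u, v, w, z} X where
  anchor : ∀ {U}, sec U →ₗ[X.O U] X.T U
  coanchor : ∀ {U}, X.Ω U →ₗ[X.O U] sec U
  pairing : ∀ {U}, sec U →ₗ[X.O U] sec U →ₗ[X.O U] X.O U
  anchor_res : ∀ {V U} (h : V ≤ U) (q : sec U), anchor (res h q) = resT h (anchor q)
  coanchor_res : ∀ {V U} (h : V ≤ U) (α : X.Ω U), coanchor (resΩ h α) = res h (coanchor α)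
  pairing_res : ∀ {V U} (h : V ≤ U) (q p : sec U),
    pairing (res h q) (res h p) = resO h (pairing q p)
  pairing_symm : ∀ {U} (q p : sec U), pairing q p = pairing p q
  anchor_coanchor : ∀ {U} (α : X.Ω U), anchor (coanchor α) = 0
  adjunction : ∀ {U} (q : sec U) (α : X.Ω U), pairing q (coanchor α) = pair α (anchor q)

/-- A Courant algebroid. The bracket is a morphism of sheaves which is bi-additive and satisfies
the Leibniz identity (its `𝕂`-bilinearity is then a consequence of `leibniz` and `symmetrizer`, see
`CourantAlgebroid.bracket_const_smul` and `CourantAlgebroid.const_smul_bracket`). -/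
structure CourantAlgebroid (X : DiffSpace.{u, v} 𝕂) extends AnchoredSheaf.{u, v, w, z} X where
  bracket : ∀ {U}, sec U →+ sec U →+ sec U
  bracket_res : ∀ {V U} (h : V ≤ U) (q p : sec U),
    bracket (res h q) (res h p) = res h (bracket q p)
  jacobi : ∀ {U} (q p r : sec U),
    bracket q (bracket p r) = bracket (bracket q p) r + bracket p (bracket q r)
  anchor_bracket : ∀ {U} (q p : sec U), anchor (bracket q p) = lb (anchor q) (anchor p)
  leibniz : ∀ {U} (q p : sec U) (f : X.O U),
    bracket q (f • p) = f • bracket q p + act (anchor q) f • p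
  invariance : ∀ {U} (q q₁ q₂ : sec U),
    pairing (bracket q q₁) q₂ + pairing q₁ (bracket q q₂) = act (anchor q) (pairing q₁ q₂)
  bracket_coanchor : ∀ {U} (q : sec U) (α : X.Ω U),
    bracket q (coanchor α) = coanchor (lie (anchor q) α)
  symmetrizer : ∀ {U} (q p : sec U),
    bracket q p + bracket p q = coanchor (dO (pairing q p))

theorem act_algebraMap {U : Opens X.pt} (ξ : X.T U) (c : 𝕂) :
    act ξ (algebraMap 𝕂 (X.O U) c) = 0 :=
  O_ext fun _ => by rw [act_apply, dAt_algebraMap]; rfl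

namespace CourantAlgebroid
variable (Q : CourantAlgebroid.{u, v, w, z} X) {U : Opens X.pt}

theorem bracket_const_smul (c : 𝕂) (q p : Q.sec U) :
    Q.bracket q (algebraMap 𝕂 (X.O U) c • p) = algebraMap 𝕂 (X.O U) c • Q.bracket q p := by
  rw [Q.leibniz, act_algebraMap, zero_smul, add_zero]

theorem bracket_symm (q p : Q.sec U) :
    Q.bracket q p = Q.coanchor (dO (Q.pairing q p)) - Q.bracket p q := by
  rw [← Q.symmetrizer, add_sub_cancel_right]

theorem const_smul_bracket (c : 𝕂) (q p : Q.sec U) :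
    Q.bracket (algebraMap 𝕂 (X.O U) c • q) p = algebraMap 𝕂 (X.O U) c • Q.bracket q p := by
  have hd : dO (algebraMap 𝕂 (X.O U) c) = 0 :=
    Subtype.ext (funext fun x => dAt_algebraMap c x)
  rw [bracket_symm, bracket_const_smul, bracket_symm Q q p, map_smul, LinearMap.smul_apply,
    smul_eq_mul, dO_mul, hd, smul_zero, add_zero, map_smul, smul_sub]

theorem coanchor_bracket (α : X.Ω U) (q : Q.sec U) :
    Q.bracket (Q.coanchor α) q =
      Q.coanchor (dO (pair α (Q.anchor q))) - Q.coanchor (lie (Q.anchor q) α) := by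
  rw [bracket_symm, Q.pairing_symm, Q.adjunction, Q.bracket_coanchor]

theorem coanchor_coanchor (α β : X.Ω U) : Q.bracket (Q.coanchor α) (Q.coanchor β) = 0 := by
  rw [Q.bracket_coanchor, Q.anchor_coanchor, zero_lie, map_zero]

/-- The `H`-twist: the same module, anchor, co-anchor and pairing, and the bracket
`[q, p] + π†(ι_{π(p)} ι_{π(q)} H)`. -/
def twist (H : Form3 X) (hH : H.IsClosed) : CourantAlgebroid.{u, v, w, z} X where
  toAnchoredSheaf := Q.toAnchoredSheaf
  bracket {U} := AddMonoidHom.mk' (fun q => AddMonoidHom.mk' (fun p =>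
      Q.bracket q p + Q.coanchor (H.contract (Q.anchor q) (Q.anchor p)))
      fun p p' => by simp only [map_add, H.contract_add']; abel)
    fun q q' => AddMonoidHom.ext fun p => by
      simp only [map_add, H.contract_add, AddMonoidHom.mk'_apply, AddMonoidHom.add_apply]; abel
  bracket_res h q p := by
    simp only [AddMonoidHom.mk'_apply, map_add, Q.bracket_res, Q.anchor_res, ← Q.coanchor_res,
      H.res_contract]
  jacobi {U} q p r := by
    simp only [AddMonoidHom.mk'_apply, map_add, Q.anchor_bracket, Q.anchor_coanchor, add_zero,
      H.contract_zero, H.contract_zero', map_zero, Q.bracket_coanchor, AddMonoidHom.add_apply, coanchor_bracket]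
    rw [Q.jacobi]
    have key : lie (Q.anchor q) (H.contract (Q.anchor p) (Q.anchor r)) +
          H.contract (Q.anchor q) (lb (Q.anchor p) (Q.anchor r)) =
        dO (pair (H.contract (Q.anchor q) (Q.anchor p)) (Q.anchor r)) -
          lie (Q.anchor r) (H.contract (Q.anchor q) (Q.anchor p)) +
        H.contract (lb (Q.anchor q) (Q.anchor p)) (Q.anchor r) +
        lie (Q.anchor p) (H.contract (Q.anchor q) (Q.anchor r)) +
        H.contract (Q.anchor p) (lb (Q.anchor q) (Q.anchor r)) := by
      refine Ω_ext fun V h ζ => ?_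
      have := hH V (resT h (Q.anchor q)) (resT h (Q.anchor p)) (resT h (Q.anchor r)) ζ
      simp only [map_add, map_sub, add_pair, sub_pair, lie_pair_res, H.res_contract,
        H.pair_contract, res_dO, pair_dO, res_lb, H.res_eval]
      set a := resT h (Q.anchor q)
      set b := resT h (Q.anchor p)
      set c := resT h (Q.anchor r)
      rw [H.eval_rot (lb a ζ) b c, H.eval_rot (lb c ζ) a b, H.eval_rot (lb b ζ) a c,
        H.eval_swap01 (lb b c) a ζ, H.eval_swap01 (lb a c) b ζ]
      linear_combination this
    have := congrArg Q.coanchor key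
    simp only [map_add, map_sub] at this
    rw [← sub_eq_zero] at this ⊢
    rw [← this]; abel
  anchor_bracket q p := by
    simp [Q.anchor_bracket, Q.anchor_coanchor]
  leibniz q p f := by
    simp only [AddMonoidHom.mk'_apply, map_smul, Q.leibniz, H.contract_smul', smul_add]; abel
  invariance q p r := by
    simp only [AddMonoidHom.mk'_apply, map_add, LinearMap.add_apply, Q.adjunction]
    rw [← Q.invariance, Q.pairing_symm (Q.coanchor _), Q.adjunction, H.pair_contract,
      H.pair_contract, H.eval_swap12 (Q.anchor q) (Q.anchor r) (Q.anchor p)]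
    abel
  bracket_coanchor q α := by
    simp only [AddMonoidHom.mk'_apply, Q.bracket_coanchor, Q.anchor_coanchor, H.contract_zero',
      map_zero, add_zero]
  symmetrizer q p := by
    simp only [AddMonoidHom.mk'_apply]
    rw [← Q.symmetrizer, H.contract_swap (Q.anchor q) (Q.anchor p), map_neg]; abel

end CourantAlgebroid
end DiffSpace


namespace DiffSpace
variable {𝕂 : Type w} [Field 𝕂]

/-- A map of spaces with its tangent maps. -/
structure Hom (Y : DiffSpace.{u', v'} 𝕂) (X : DiffSpace.{u, v} 𝕂) where
  toFun : Y.pt → X.pt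
  continuous : Continuous toFun
  tan : ∀ y, Y.V y →ₗ[𝕂] X.V (toFun y)
  reg : ∀ (g : X.pt → 𝕂) (y : Y.pt), X.Reg g (toFun y) → Y.Reg (g ∘ toFun) y
  d_comp : ∀ (g : X.pt → 𝕂) (y : Y.pt), X.Reg g (toFun y) →
    Y.d (g ∘ toFun) y = (X.d g (toFun y)).comp (tan y)

variable {Y : DiffSpace.{u', v'} 𝕂} {X : DiffSpace.{u, v} 𝕂}

namespace Hom
variable (f : Hom Y X)

/-- The preimage of an open set. -/
def pre (U : Opens X.pt) : Opens Y.pt := ⟨f.toFun ⁻¹' U, U.isOpen.preimage f.continuous⟩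

theorem pre_mono {U U' : Opens X.pt} (h : U ≤ U') : f.pre U ≤ f.pre U' := fun _ hy => h hy

variable {f} {U : Opens X.pt} {V : Opens Y.pt} (h : V ≤ f.pre U)

/-- The image point in `U`. -/
@[reducible] def im (y : V) : U := ⟨f.toFun y, h y.2⟩

theorem ext_comp (g : X.O U) (y : V) :
    X.ext g.1 ∘ f.toFun =ᶠ[𝓝 (y : Y.pt)] Y.ext (fun y : V => g.1 (im h y)) :=
  (ext_eventuallyEq y.2 le_rfl fun z hz =>
    (ext_apply g.1 (im h ⟨z, hz⟩)).symm).symm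

/-- Pull-back of functions. -/
def pullO : X.O U →+* Y.O V where
  toFun g := ⟨fun y => g.1 (im h y), fun y =>
    Y.reg_congr (ext_comp h g y) (f.reg _ _ (g.2 (im h y)))⟩
  map_one' := rfl
  map_mul' _ _ := rfl
  map_zero' := rfl
  map_add' _ _ := rfl

theorem pullO_apply (g : X.O U) (y : V) : (pullO h g).1 y = g.1 (im h y) := rfl

theorem dAt_pullO (g : X.O U) (y : V) : dAt (pullO h g) y = (dAt g (im h y)).comp (f.tan y) :=
  (Y.d_congr (ext_comp h g y)).symm.trans (f.d_comp _ _ (g.2 (im h y)))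

theorem tan_expand (F : Frame U) (ξ : Y.T V) (y : V) :
    f.tan y (ξ.1 y) = ∑ i, (act ξ (pullO h (F.a i))).1 y • (F.D i).1 (im h y) := by
  refine (F.expand (im h y) (f.tan y (ξ.1 y))).trans (Finset.sum_congr rfl fun i _ => ?_)
  rw [act_apply, dAt_pullO]; rfl

theorem O_sum_apply {V : Opens Y.pt} {ι : Type*} (s : Finset ι) (F : ι → Y.O V) (y : V) :
    (∑ i ∈ s, F i).1 y = ∑ i ∈ s, (F i).1 y :=
  map_sum (AddMonoidHom.mk' (fun g : Y.O V => g.1 y) fun _ _ => rfl) F s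

theorem exists_frame_pre (x : V) (h : V ≤ f.pre U) : ∃ (U' : Opens X.pt) (_ : U' ≤ U)
    (V' : Opens Y.pt) (_ : V' ≤ V) (_ : V' ≤ f.pre U'), (x : Y.pt) ∈ V' ∧ Nonempty (Frame U') := by
  obtain ⟨U', hU', hx, F⟩ := X.exists_frame U (f.toFun x) (h x.2)
  exact ⟨U', hU', V ⊓ f.pre U', inf_le_left, inf_le_right, ⟨x.2, hx⟩, F⟩

/-- Pull-back of 1-forms. -/
def pullΩ : X.Ω U →+ Y.Ω V where
  toFun α := ⟨fun y => (α.1 (im h y)).comp (f.tan y), fun V' hV ξ => by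
    refine O_of_local _ fun y hy => ?_
    obtain ⟨U₁, hU₁, V₁, hV₁, h₁, hy₁, ⟨F⟩⟩ := exists_frame_pre ⟨y, hy⟩ (hV.trans h)
    refine ⟨V₁, hV₁, hy₁, ∑ i, act (resT hV₁ ξ) (pullO h₁ (F.a i)) *
      pullO h₁ (pair (resΩ hU₁ α) (F.D i)), fun z => ?_⟩
    refine Eq.trans ?_ (O_sum_apply _ _ _).symm
    refine (congrArg (α.1 (im h ⟨z, hV (hV₁ z.2)⟩)) (tan_expand h₁ F (resT hV₁ ξ) z)).trans ?_
    refine (map_sum (α.1 (im h ⟨z, hV (hV₁ z.2)⟩)) _ _).trans ?_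
    exact Finset.sum_congr rfl fun i _ => map_smul _ _ _⟩
  map_zero' := rfl
  map_add' _ _ := rfl

theorem pullΩ_smul (g : X.O U) (α : X.Ω U) : pullΩ h (g • α) = pullO h g • pullΩ h α := rfl
theorem pullΩ_dO (g : X.O U) : pullΩ h (dO g) = dO (pullO h g) :=
  Subtype.ext <| funext fun y => (dAt_pullO h g y).symm

theorem res_pullO {V' : Opens Y.pt} {U' : Opens X.pt} (h' : V' ≤ f.pre U') (hV : V' ≤ V)
    (hU : U' ≤ U) (g : X.O U) : resO hV (pullO h g) = pullO h' (resO hU g) := rfl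
theorem res_pullΩ {V' : Opens Y.pt} {U' : Opens X.pt} (h' : V' ≤ f.pre U') (hV : V' ≤ V)
    (hU : U' ≤ U) (α : X.Ω U) : resΩ hV (pullΩ h α) = pullΩ h' (resΩ hU α) := rfl

end Hom

variable (f : Hom Y X)
open Hom

theorem Form3.val_sum1 (H : Form3 X) {x : X.pt} {ι : Type*} (s : Finset ι) (r : ι → 𝕂)
    (a : ι → X.V x) (b c : X.V x) :
    H.val x ![∑ i ∈ s, r i • a i, b, c] = ∑ i ∈ s, r i * H.val x ![a i, b, c] := by
  have := map_sum (AddMonoidHom.mk' (fun v => H.val x ![v, b, c]) fun _ _ => H.val_add _ _ _ _)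
    (fun i => r i • a i) s
  exact this.trans (Finset.sum_congr rfl fun i _ => H.val_smul _ _ _ _)

theorem Form3.val_sum3 (H : Form3 X) {x : X.pt} {ι : Type*} (s : Finset ι) (r r' r'' : ι → 𝕂)
    (a : ι → X.V x) :
    H.val x ![∑ i ∈ s, r i • a i, ∑ i ∈ s, r' i • a i, ∑ i ∈ s, r'' i • a i] =
      ∑ i ∈ s, ∑ j ∈ s, ∑ k ∈ s, r i * r' j * r'' k * H.val x ![a i, a j, a k] := by
  rw [H.val_sum1]
  refine Finset.sum_congr rfl fun i _ => ?_
  rw [H.val_rot (∑ i ∈ s, r'' i • a i) (a i), H.val_rot (∑ i ∈ s, r' i • a i), H.val_sum1,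
    Finset.mul_sum]
  refine Finset.sum_congr rfl fun j _ => ?_
  rw [← H.val_rot, H.val_sum1, Finset.mul_sum, Finset.mul_sum]
  refine Finset.sum_congr rfl fun k _ => ?_
  rw [← H.val_rot (a k) (a i) (a j)]
  ring

/-- `f^* H` in coordinates -/
theorem pull_expand (H : Form3 X) {U : Opens X.pt} {V : Opens Y.pt} (h : V ≤ f.pre U) (F : Frame U)
    (ξ η ζ : Y.T V) (y : V) :
    H.val _ ![f.tan y (ξ.1 y), f.tan y (η.1 y), f.tan y (ζ.1 y)] =
    (∑ i, ∑ j, ∑ k, act ξ (pullO h (F.a i)) * act η (pullO h (F.a j)) * act ζ (pullO h (F.a k)) *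
      pullO h (H.eval (F.D i) (F.D j) (F.D k))).1 y := by
  rw [tan_expand h F ξ, tan_expand h F η, tan_expand h F ζ]
  refine (H.val_sum3 _ _ _ _ _).trans ?_
  refine Eq.trans ?_ (O_sum_apply _ _ _).symm
  refine Finset.sum_congr rfl fun i _ => Eq.trans ?_ (O_sum_apply _ _ _).symm
  refine Finset.sum_congr rfl fun j _ => Eq.trans ?_ (O_sum_apply _ _ _).symm
  exact Finset.sum_congr rfl fun k _ => rfl

/-- Pull-back of 3-forms. -/
def Form3.pull (H : Form3 X) : Form3 Y where
  val y := (H.val (f.toFun y)).compLinearMap (f.tan y)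
  regular V ξ η ζ := by
    refine O_of_local _ fun y hy => ?_
    obtain ⟨U₁, hU₁, V₁, hV₁, h₁, hy₁, ⟨F⟩⟩ :=
      exists_frame_pre (f := f) (V := V) (U := ⊤) ⟨y, hy⟩ (fun _ _ => trivial)
    refine ⟨V₁, hV₁, hy₁, _, fun z => Eq.trans ?_
      (pull_expand f H h₁ F (resT hV₁ ξ) (resT hV₁ η) (resT hV₁ ζ) z)⟩
    change H.val _ _ = _
    congr 1; ext i; fin_cases i <;> rfl

theorem Form3.pull_val (H : Form3 X) (y : Y.pt) (a b c : Y.V y) :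
    (H.pull f).val y ![a, b, c] = H.val _ ![f.tan y a, f.tan y b, f.tan y c] := by
  change H.val _ _ = _
  congr 1; ext i; fin_cases i <;> rfl

theorem Form3.pull_eval (H : Form3 X) {U : Opens X.pt} {V : Opens Y.pt} (h : V ≤ f.pre U)
    (F : Frame U) (ξ η ζ : Y.T V) : (H.pull f).eval ξ η ζ =
    ∑ i, ∑ j, ∑ k, act ξ (pullO h (F.a i)) * act η (pullO h (F.a j)) * act ζ (pullO h (F.a k)) *
      pullO h (H.eval (F.D i) (F.D j) (F.D k)) :=
  O_ext fun y => (H.pull_val f y _ _ _).trans (pull_expand f H h F ξ η ζ y)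

theorem act_pullO {U : Opens X.pt} {V : Opens Y.pt} (h : V ≤ f.pre U) (F : Frame U) (ξ : Y.T V)
    (g : X.O U) : act ξ (pullO h g) = ∑ i, act ξ (pullO h (F.a i)) * pullO h (act (F.D i) g) :=
  O_ext fun y => by
    refine (LinearMap.congr_fun (dAt_pullO h g y) (ξ.1 y)).trans ?_
    refine (congrArg (dAt g (im h y)) (tan_expand h F ξ y)).trans ?_
    refine ((map_sum (dAt g (im h y)) _ _).trans ?_).trans (O_sum_apply _ _ _).symm
    exact Finset.sum_congr rfl fun i _ => map_smul _ _ _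

theorem O_eq_of_local {U : Opens X.pt} {g g' : X.O U}
    (H : ∀ x ∈ U, ∃ (W : Opens X.pt) (h : W ≤ U), x ∈ W ∧ resO h g = resO h g') : g = g' :=
  O_ext fun x => by
    obtain ⟨W, h, hx, e⟩ := H x x.2
    exact congrArg (fun k : X.O W => k.1 ⟨x, hx⟩) e

namespace ClosedAux
variable {U : Opens X.pt} {V : Opens Y.pt} (h : V ≤ f.pre U) (F : Frame U) (H : Form3 X)

def S (A B C : Fin F.m → Y.O V) : Y.O V :=
  ∑ q : Fin F.m × Fin F.m × Fin F.m, A q.1 * B q.2.1 * C q.2.2 *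
    pullO h (H.eval (F.D q.1) (F.D q.2.1) (F.D q.2.2))

def R (A B C D : Fin F.m → Y.O V) : Y.O V :=
  ∑ q : Fin F.m × Fin F.m × Fin F.m × Fin F.m, A q.1 * B q.2.1 * C q.2.2.1 * D q.2.2.2 *
    pullO h (act (F.D q.1) (H.eval (F.D q.2.1) (F.D q.2.2.1) (F.D q.2.2.2)))

def co (ξ : Y.T V) (i : Fin F.m) : Y.O V := act ξ (pullO h (F.a i))

theorem pull_eval' (ξ η ζ : Y.T V) :
    (H.pull f).eval ξ η ζ = S f h F H (co f h F ξ) (co f h F η) (co f h F ζ) := by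
  rw [H.pull_eval f h F, S, Fintype.sum_prod_type]
  refine Finset.sum_congr rfl fun i _ => ?_
  rw [Fintype.sum_prod_type]; rfl

theorem S_rot (A B C : Fin F.m → Y.O V) : S f h F H B C A = S f h F H A B C := by
  refine Fintype.sum_equiv ⟨fun q => (q.2.2, q.1, q.2.1), fun q => (q.2.1, q.2.2, q.1),
    fun _ => rfl, fun _ => rfl⟩ _ _ fun q => ?_
  simp only [Equiv.coe_fn_mk]
  rw [H.eval_rot (F.D q.2.2) (F.D q.1) (F.D q.2.1)]; ring

theorem S_swap (A B C : Fin F.m → Y.O V) : S f h F H B A C = - S f h F H A B C := by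
  rw [S, S, ← Finset.sum_neg_distrib]
  refine Fintype.sum_equiv ⟨fun q => (q.2.1, q.1, q.2.2), fun q => (q.2.1, q.1, q.2.2),
    fun _ => rfl, fun _ => rfl⟩ _ _ fun q => ?_
  simp only [Equiv.coe_fn_mk]
  rw [H.eval_swap01 (F.D q.2.1) (F.D q.1), map_neg]; ring

theorem S_sub (A A' B C : Fin F.m → Y.O V) :
    S f h F H (fun i => A i - A' i) B C = S f h F H A B C - S f h F H A' B C := by
  rw [S, S, S, ← Finset.sum_sub_distrib]
  exact Finset.sum_congr rfl fun i _ => by ring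

theorem act_S (ξ : Y.T V) (A B C : Fin F.m → Y.O V) : act ξ (S f h F H A B C) =
    S f h F H (fun i => act ξ (A i)) B C + S f h F H A (fun i => act ξ (B i)) C +
      S f h F H A B (fun i => act ξ (C i)) + R f h F H (co f h F ξ) A B C := by
  have hR : R f h F H (co f h F ξ) A B C = ∑ q : Fin F.m × Fin F.m × Fin F.m, ∑ i,
      co f h F ξ i * A q.1 * B q.2.1 * C q.2.2 *
        pullO h (act (F.D i) (H.eval (F.D q.1) (F.D q.2.1) (F.D q.2.2))) := by
    rw [R, Fintype.sum_prod_type, Finset.sum_comm]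
  rw [hR, S, S, S, S, act_sum, ← Finset.sum_add_distrib, ← Finset.sum_add_distrib,
    ← Finset.sum_add_distrib]
  refine Finset.sum_congr rfl fun q _ => ?_
  rw [act_mul, act_mul, act_mul, act_pullO f h F ξ, Finset.mul_sum]
  have : ∀ i, A q.1 * B q.2.1 * C q.2.2 * (act ξ (pullO h (F.a i)) *
      pullO h (act (F.D i) (H.eval (F.D q.1) (F.D q.2.1) (F.D q.2.2)))) =
      co f h F ξ i * A q.1 * B q.2.1 * C q.2.2 *
      pullO h (act (F.D i) (H.eval (F.D q.1) (F.D q.2.1) (F.D q.2.2))) := fun i => by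
    rw [co]; ring
  simp_rw [this]
  ring

theorem R_swap01 (A B C D : Fin F.m → Y.O V) : R f h F H B A C D =
    ∑ q : Fin F.m × Fin F.m × Fin F.m × Fin F.m, A q.1 * B q.2.1 * C q.2.2.1 * D q.2.2.2 *
      pullO h (act (F.D q.2.1) (H.eval (F.D q.1) (F.D q.2.2.1) (F.D q.2.2.2))) :=
  Fintype.sum_equiv ⟨fun q => (q.2.1, q.1, q.2.2), fun q => (q.2.1, q.1, q.2.2),
    fun _ => rfl, fun _ => rfl⟩ _ _ fun q => by simp only [Equiv.coe_fn_mk]; ring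

theorem R_2 (A B C D : Fin F.m → Y.O V) : R f h F H C A B D =
    ∑ q : Fin F.m × Fin F.m × Fin F.m × Fin F.m, A q.1 * B q.2.1 * C q.2.2.1 * D q.2.2.2 *
      pullO h (act (F.D q.2.2.1) (H.eval (F.D q.1) (F.D q.2.1) (F.D q.2.2.2))) :=
  Fintype.sum_equiv ⟨fun q => (q.2.1, q.2.2.1, q.1, q.2.2.2),
    fun q => (q.2.2.1, q.1, q.2.1, q.2.2.2),
    fun _ => rfl, fun _ => rfl⟩ _ _ fun q => by simp only [Equiv.coe_fn_mk]; ring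

theorem R_3 (A B C D : Fin F.m → Y.O V) : R f h F H D A B C =
    ∑ q : Fin F.m × Fin F.m × Fin F.m × Fin F.m, A q.1 * B q.2.1 * C q.2.2.1 * D q.2.2.2 *
      pullO h (act (F.D q.2.2.2) (H.eval (F.D q.1) (F.D q.2.1) (F.D q.2.2.1))) :=
  Fintype.sum_equiv ⟨fun q => (q.2.1, q.2.2.1, q.2.2.2, q.1),
    fun q => (q.2.2.2, q.1, q.2.1, q.2.2.1),
    fun _ => rfl, fun _ => rfl⟩ _ _ fun q => by simp only [Equiv.coe_fn_mk]; ring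

theorem lb_D (i j : Fin F.m) : lb (F.D i) (F.D j) = 0 := T_ext fun V h g => by
  rw [lb_act_res, F.comm, map_zero, zero_act, sub_self]

theorem R_alt (hH : H.IsClosed) (A B C D : Fin F.m → Y.O V) : R f h F H A B C D -
    R f h F H B A C D + R f h F H C A B D - R f h F H D A B C = 0 := by
  rw [R_swap01 f h F H A B C D, R_2 f h F H A B C D, R_3 f h F H A B C D, R,
    ← Finset.sum_sub_distrib, ← Finset.sum_add_distrib, ← Finset.sum_sub_distrib]
  refine Finset.sum_eq_zero fun q _ => ?_
  have e0 : ∀ a b : X.T U, H.eval 0 a b = 0 := fun a b => by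
    have := H.eval_smul (0 : X.T U) a b 0
    rwa [zero_smul, zero_mul] at this
  have := hH U (F.D q.1) (F.D q.2.1) (F.D q.2.2.1) (F.D q.2.2.2)
  simp only [lb_D, e0, sub_zero, add_zero] at this
  have := congrArg (pullO h) this
  simp only [map_sub, map_add, map_zero] at this
  linear_combination (A q.1 * B q.2.1 * C q.2.2.1 * D q.2.2.2) * this

theorem co_lb (ξ η : Y.T V) : co f h F (lb ξ η) =
    fun i => act ξ (co f h F η i) - act η (co f h F ξ i) := funext fun _ => lb_act _ _ _

end ClosedAux

section
open ClosedAux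
/-- The pull-back of a closed form is closed. -/
theorem Form3.IsClosed.pull {H : Form3 X} (hH : H.IsClosed) : (H.pull f).IsClosed := by
  intro V ξ₀ ξ₁ ξ₂ ξ₃
  refine O_eq_of_local fun y hy => ?_
  obtain ⟨U₁, hU₁, V₁, hV₁, h, hy₁, ⟨F⟩⟩ :=
    exists_frame_pre (f := f) (V := V) (U := ⊤) ⟨y, hy⟩ (fun _ _ => trivial)
  refine ⟨V₁, hV₁, hy₁, ?_⟩
  simp only [map_sub, map_add, map_zero, res_act, res_eval, res_lb]
  generalize resT hV₁ ξ₀ = a, resT hV₁ ξ₁ = b, resT hV₁ ξ₂ = c, resT hV₁ ξ₃ = d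
  simp only [pull_eval' f h F H, co_lb, act_S, S_sub]
  have := R_alt f h F H hH (co f h F a) (co f h F b) (co f h F c) (co f h F d)
  generalize co f h F a = A, co f h F b = B, co f h F c = C, co f h F d = D at *
  rw [S_swap _ _ _ _ B (fun i => act a (C i)), ← S_rot _ _ _ _ (fun i => act a (D i)),
    S_swap _ _ _ _ A (fun i => act b (C i)), S_swap _ _ _ _ A (fun i => act c (B i)),
    ← S_rot _ _ _ _ (fun i => act b (D i)), S_swap _ _ _ _ A (fun i => act d (B i)),
    ← S_rot _ _ _ _ (fun i => act c (D i)), ← S_rot _ _ _ _ (fun i => act d (C i))]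
  linear_combination this

end

end DiffSpace


namespace DiffSpace
open Hom
variable {𝕂 : Type w} [Field 𝕂] {Y : DiffSpace.{u', v'} 𝕂} {X : DiffSpace.{u, v} 𝕂}

namespace Pull
variable {f : Hom Y X} {U : Opens X.pt} {V : Opens Y.pt}

section anchored
variable (Q : AnchoredSheaf.{u, v, w, z} X) (h : V ≤ f.pre U)

variable (V U) in
/-- Formal sums of terms `g ⊗ q`, with `g` a function on `V` and `q` a section on `U`. -/
abbrev Ten := Y.O V ⊗[ℤ] Q.sec U

/-- `g ⊗ q ↦ g · f^*(π(q))`, a field of tangent vectors of `X` along `f`. -/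
def rho : Ten U V Q →ₗ[ℤ] (∀ y : V, X.V (f.toFun y)) :=
  TensorProduct.lift <| LinearMap.mk₂ ℤ (fun g q y => g.1 y • (Q.anchor q).1 (im h y))
    (fun _ _ _ => funext fun _ => add_smul _ _ _)
    (fun c g q => funext fun y => by
      simp only [Pi.smul_apply]
      rw [← smul_assoc]; rfl)
    (fun g q q' => funext fun y => by rw [map_add]; exact smul_add _ _ _)
    (fun c g q => funext fun y => by
      rw [map_zsmul, Pi.smul_apply]
      exact smul_comm (g.1 y) c ((Q.anchor q).1 (im h y)))

@[simp] theorem rho_tmul (g : Y.O V) (q : Q.sec U) (y : V) :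
    rho Q h (g ⊗ₜ q) y = g.1 y • (Q.anchor q).1 (im h y) := rfl

theorem rho_smul (c : Y.O V) (t : Ten U V Q) (y : V) : rho Q h (c • t) y = c.1 y • rho Q h t y := by
  induction t using TensorProduct.induction_on with
  | zero => simp
  | tmul g q => exact mul_smul _ _ _
  | add a b ha hb => rw [smul_add, map_add, map_add, Pi.add_apply, Pi.add_apply, ha, hb, smul_add]

variable (V U) in
/-- Triples `(α, t, ξ)` -/
abbrev M := Y.Ω V × Ten U V Q × Y.T V

/-- The triples with `df(ξ) = f^*(π)(t)`. -/
def N : Submodule (Y.O V) (M U V Q) where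
  carrier := {n | ∀ y : V, f.tan y (n.2.2.1 y) = rho Q h n.2.1 y}
  add_mem' {a b} ha hb y := by
    change f.tan y (a.2.2.1 y + b.2.2.1 y) = rho Q h (a.2.1 + b.2.1) y
    rw [map_add, map_add, ha, hb]; rfl
  zero_mem' y := by
    change f.tan y 0 = rho Q h 0 y
    rw [map_zero, map_zero]; rfl
  smul_mem' c a ha y := by
    change f.tan y (c.1 y • a.2.2.1 y) = rho Q h (c • a.2.1) y
    rw [map_smul, rho_smul, ha]

/-- The relations `g ⊗ q = 1 ⊗ g q` -/
def z1 (g : X.O U) (q : Q.sec U) : M U V Q :=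
  (0, pullO h g ⊗ₜ q - (1 : Y.O V) ⊗ₜ (g • q), 0)
/-- The relations `1 ⊗ π†(γ) = f^* γ` -/
def z2 (γ : X.Ω U) : M U V Q := (pullΩ h γ, -((1 : Y.O V) ⊗ₜ Q.coanchor γ), 0)

/-- The submodule of relations. -/
def Z : Submodule (Y.O V) (M U V Q) :=
  Submodule.span _ ((Set.range fun p : X.O U × Q.sec U => z1 Q h p.1 p.2) ∪ Set.range (z2 Q h))

section bilinear
variable {Q}
variable (B : Q.sec U →ₗ[ℤ] Q.sec U →ₗ[ℤ] Y.O V)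

/-- `(g ⊗ q, k ⊗ p) ↦ g k B(q, p)` -/
def tB : Ten U V Q →ₗ[ℤ] Ten U V Q →ₗ[ℤ] Y.O V :=
  (TensorProduct.map₂ (LinearMap.mul ℤ (Y.O V)) B).compr₂ (LinearMap.mul' ℤ (Y.O V))

@[simp] theorem tB_tmul (g k : Y.O V) (q p : Q.sec U) :
    tB B (g ⊗ₜ q) (k ⊗ₜ p) = g * k * B q p := rfl

/-- `(g ⊗ q, k ⊗ p) ↦ B(q, p) k dg` -/
def oB : Ten U V Q →ₗ[ℤ] Ten U V Q →ₗ[ℤ] Y.Ω V :=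
  (TensorProduct.map₂ (LinearMap.mk₂ ℤ (fun (g k : Y.O V) => k • dO g) (by simp)
    (fun c g k => by rw [map_zsmul, smul_comm]) (fun _ _ _ => add_smul _ _ _)
    (fun c g k => by rw [smul_assoc])) B).compr₂
      (TensorProduct.lift (LinearMap.mk₂ ℤ (fun (α : Y.Ω V) (g : Y.O V) => g • α)
        (by simp) (fun c g k => by rw [smul_comm]) (fun _ _ _ => add_smul _ _ _)
        (fun c g k => by rw [smul_assoc])))

@[simp] theorem oB_tmul (g k : Y.O V) (q p : Q.sec U) :
    oB B (g ⊗ₜ q) (k ⊗ₜ p) = B q p • k • dO g := rfl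
end bilinear

/-- The pull-back of the pairing. -/
def pb : Q.sec U →ₗ[ℤ] Q.sec U →ₗ[ℤ] Y.O V :=
  LinearMap.mk₂ ℤ (fun q p => pullO h (Q.pairing q p)) (by simp) (by simp) (by simp) (by simp)

@[simp] theorem pb_apply (q p : Q.sec U) : pb Q h q p = pullO h (Q.pairing q p) := rfl

/-- The pairing of formal sums: `⟨g ⊗ q, k ⊗ p⟩ = g k f^*⟨q, p⟩`. -/
abbrev tp : Ten U V Q →ₗ[ℤ] Ten U V Q →ₗ[ℤ] Y.O V := tB (pb Q h)

/-- `(g ⊗ q, k ⊗ p) ↦ k f^*⟨q, p⟩ dg` -/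
abbrev om : Ten U V Q →ₗ[ℤ] Ten U V Q →ₗ[ℤ] Y.Ω V := oB (pb Q h)

/-- A vector field acting on formal sums by `g ⊗ q ↦ ξ(g) ⊗ q`. -/
def da (ξ : Y.T V) : Ten U V Q →ₗ[ℤ] Ten U V Q :=
  LinearMap.rTensor _ (AddMonoidHom.mk' (act ξ) (act_add ξ)).toIntLinearMap
@[simp] theorem da_tmul (ξ : Y.T V) (g : Y.O V) (q : Q.sec U) :
    da Q ξ (g ⊗ₜ q) = act ξ g ⊗ₜ q := rfl

end anchored
end Pull
end DiffSpace


namespace DiffSpace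
open Hom
variable {𝕂 : Type w} [Field 𝕂] {Y : DiffSpace.{u', v'} 𝕂} {X : DiffSpace.{u, v} 𝕂}
namespace Pull
variable {f : Hom Y X} {U : Opens X.pt} {V : Opens Y.pt}

section anchored
variable (Q : AnchoredSheaf.{u, v, w, z} X) (h : V ≤ f.pre U)

/-- `g ⊗ q ↦ g f^*(π(q) a)` -/
def r1 (a : X.O U) : Ten U V Q →ₗ[ℤ] Y.O V :=
  TensorProduct.lift <| LinearMap.mk₂ ℤ (fun g q => g * pullO h (act (Q.anchor q) a))
    (by simp [add_mul]) (fun c g q => by rw [smul_mul_assoc]) (by simp [add_act, mul_add]) (fun c g q => by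
      rw [map_zsmul, ← mul_smul_comm]
      congr 1
      exact map_zsmul ((pullO h).toAddMonoidHom.comp
        (AddMonoidHom.mk' (fun ξ => act ξ a) fun ξ η => add_act ξ η a)) c (Q.anchor q))

@[simp] theorem r1_tmul (a : X.O U) (g : Y.O V) (q : Q.sec U) :
    r1 Q h a (g ⊗ₜ q) = g * pullO h (act (Q.anchor q) a) := rfl

/-- `g ⊗ q ↦ g f^*(γ(π(q)))` -/
def r2 (γ : X.Ω U) : Ten U V Q →ₗ[ℤ] Y.O V :=
  TensorProduct.lift <| LinearMap.mk₂ ℤ (fun g q => g * pullO h (pair γ (Q.anchor q)))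
    (by simp [add_mul]) (fun c g q => by rw [smul_mul_assoc]) (by simp [pair_add, mul_add]) (fun c g q => by
      rw [map_zsmul, ← mul_smul_comm]
      congr 1
      exact map_zsmul ((pullO h).toAddMonoidHom.comp
        (AddMonoidHom.mk' (pair γ) fun ξ η => pair_add ξ η γ)) c (Q.anchor q))

@[simp] theorem r2_tmul (γ : X.Ω U) (g : Y.O V) (q : Q.sec U) :
    r2 Q h γ (g ⊗ₜ q) = g * pullO h (pair γ (Q.anchor q)) := rfl

/-- `g ⊗ q ↦ g f^*(L_{π(q)} γ)` -/
def r3 (γ : X.Ω U) : Ten U V Q →ₗ[ℤ] Y.Ω V :=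
  TensorProduct.lift <| LinearMap.mk₂ ℤ (fun g q => g • pullΩ h (lie (Q.anchor q) γ))
    (fun _ _ _ => add_smul _ _ _) (fun c g k => by rw [smul_assoc])
    (by simp [add_lie]) (fun c g q => by
      rw [map_zsmul, smul_comm c g]
      congr 1
      exact map_zsmul ((pullΩ h).comp
        (AddMonoidHom.mk' (fun ξ => lie ξ γ) fun ξ η => add_lie ξ η γ)) c (Q.anchor q))

@[simp] theorem r3_tmul (γ : X.Ω U) (g : Y.O V) (q : Q.sec U) :
    r3 Q h γ (g ⊗ₜ q) = g • pullΩ h (lie (Q.anchor q) γ) := rfl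

/-- `g ⊗ q ↦ f^*(γ(π(q))) dg` -/
def r4 (γ : X.Ω U) : Ten U V Q →ₗ[ℤ] Y.Ω V :=
  TensorProduct.lift <| LinearMap.mk₂ ℤ (fun g q => pullO h (pair γ (Q.anchor q)) • dO g)
    (by simp) (fun c g k => by rw [map_zsmul, smul_comm])
    (fun g q p => by rw [map_add, pair_add, map_add, add_smul]) (fun c g q => by
      rw [map_zsmul, ← smul_assoc]
      congr 1
      exact map_zsmul ((pullO h).toAddMonoidHom.comp
        (AddMonoidHom.mk' (pair γ) fun ξ η => pair_add ξ η γ)) c (Q.anchor q))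

@[simp] theorem r4_tmul (γ : X.Ω U) (g : Y.O V) (q : Q.sec U) :
    r4 Q h γ (g ⊗ₜ q) = pullO h (pair γ (Q.anchor q)) • dO g := rfl

variable {Q}

theorem rho_dAt (t : Ten U V Q) (a : X.O U) (y : V) :
    dAt a (im h y) (rho Q h t y) = (r1 Q h a t).1 y := by
  induction t using TensorProduct.induction_on with
  | zero => simp [O_zero]
  | tmul g q => exact map_smul _ _ _
  | add a b ha hb => rw [map_add, map_add, O_add, ← ha, ← hb]; exact map_add _ _ _

theorem rho_form (t : Ten U V Q) (γ : X.Ω U) (y : V) :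
    γ.1 (im h y) (rho Q h t y) = (r2 Q h γ t).1 y := by
  induction t using TensorProduct.induction_on with
  | zero => simp [O_zero]
  | tmul g q => exact map_smul _ _ _
  | add a b ha hb => rw [map_add, map_add, O_add, ← ha, ← hb]; exact map_add _ _ _

/-- Restriction of formal sums. -/
def resTen {U' : Opens X.pt} {V' : Opens Y.pt} (hU : U' ≤ U) (hV : V' ≤ V) :
    Ten U V Q →ₗ[ℤ] Ten U' V' Q :=
  TensorProduct.map (resO hV).toRingHom.toAddMonoidHom.toIntLinearMap (Q.res hU).toIntLinearMap

@[simp] theorem resTen_tmul {U' : Opens X.pt} {V' : Opens Y.pt} (hU : U' ≤ U) (hV : V' ≤ V)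
    (g : Y.O V) (q : Q.sec U) : resTen hU hV (g ⊗ₜ q) = resO hV g ⊗ₜ[ℤ] Q.res hU q := rfl

/-- Restriction of triples. -/
def resM {U' : Opens X.pt} {V' : Opens Y.pt} (hU : U' ≤ U) (hV : V' ≤ V) :
    M U V Q →+ M U' V' Q :=
  (resΩ hV).prodMap ((resTen hU hV).toAddMonoidHom.prodMap (resT hV))

variable {U' : Opens X.pt} {V' : Opens Y.pt} (h' : V' ≤ f.pre U') (hU : U' ≤ U) (hV : V' ≤ V)

theorem rho_res (t : Ten U V Q) (y : V') :
    rho Q h' (resTen hU hV t) y = rho Q h t ⟨y, hV y.2⟩ := by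
  induction t using TensorProduct.induction_on with
  | zero => simp
  | tmul g q =>
    rw [resTen_tmul, rho_tmul, rho_tmul, Q.anchor_res]
    rfl
  | add a b ha hb => rw [map_add, map_add, map_add, Pi.add_apply, Pi.add_apply, ha, hb]

theorem resM_N {n : M U V Q} (hn : n ∈ N Q h) : resM hU hV n ∈ N Q h' := fun y => by
  change f.tan y (n.2.2.1 ⟨y, hV y.2⟩) = rho Q h' (resTen hU hV n.2.1) y
  rw [rho_res h h' hU hV]
  exact hn ⟨y, hV y.2⟩

theorem r34_res (t : Ten U V Q) (γ : X.Ω U) :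
    resΩ hV (r3 Q h γ t + r4 Q h γ t) =
      r3 Q h' (resΩ hU γ) (resTen hU hV t) + r4 Q h' (resΩ hU γ) (resTen hU hV t) := by
  induction t using TensorProduct.induction_on with
  | zero => simp
  | tmul g q =>
    simp only [r3_tmul, r4_tmul, map_add, resΩ_smul, resTen_tmul, Q.anchor_res, ← res_lie, res_dO,
      ← res_pair]
    rfl
  | add a b ha hb => 
    simp only [map_add] at *
    rw [add_add_add_comm, ha, hb]
    abel

section consequences
variable {n : M U V Q}

theorem act_of_N (hn : n ∈ N Q h) (a : X.O U) : act n.2.2 (pullO h a) = r1 Q h a n.2.1 := O_ext fun y => by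
  refine Eq.trans ?_ (rho_dAt h n.2.1 a y)
  exact (LinearMap.congr_fun (dAt_pullO h a y) _).trans (congrArg (dAt a (im h y)) (hn y))

theorem pair_of_N (hn : n ∈ N Q h) (γ : X.Ω U) : pair (pullΩ h γ) n.2.2 = r2 Q h γ n.2.1 := O_ext fun y => by
  refine Eq.trans ?_ (rho_form h n.2.1 γ y)
  exact congrArg (γ.1 (im h y)) (hn y)

theorem lie_of_N_smul_dO (hn : n ∈ N Q h) (c a : X.O U) : lie n.2.2 (pullΩ h (c • dO a)) =
    r3 Q h (c • dO a) n.2.1 + r4 Q h (c • dO a) n.2.1 := by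
  rw [pullΩ_smul, pullΩ_dO, lie_smul, lie_dO, act_of_N h hn, act_of_N h hn]
  generalize n.2.1 = t
  induction t using TensorProduct.induction_on with
  | zero => simp
  | tmul g q =>
    simp only [r1_tmul, r3_tmul, r4_tmul, lie_smul, lie_dO, map_add, pullΩ_smul, pullΩ_dO, dO_mul,
      smul_pair, pair_dO, map_mul]
    module
  | add a b ha hb =>
    simp only [map_add, smul_add, add_smul] at *
    rw [add_add_add_comm, ha, hb]
    abel

theorem r3_sum {ι : Type*} (s : Finset ι) (γ : ι → X.Ω U) (t : Ten U V Q) :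
    r3 Q h (∑ i ∈ s, γ i) t + r4 Q h (∑ i ∈ s, γ i) t =
      ∑ i ∈ s, (r3 Q h (γ i) t + r4 Q h (γ i) t) := by
  have e : ∀ γ γ', r3 Q h (γ + γ') t + r4 Q h (γ + γ') t =
      (r3 Q h γ t + r4 Q h γ t) + (r3 Q h γ' t + r4 Q h γ' t) := fun γ γ' => by
    induction t using TensorProduct.induction_on with
    | zero => simp
    | tmul g q =>
      simp only [r3_tmul, r4_tmul, lie_add, map_add, smul_add, add_pair, add_smul]; abel
    | add a b ha hb =>
      simp only [map_add] at *
      rw [add_add_add_comm, ha, hb]; abel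
  exact map_sum (AddMonoidHom.mk' (fun γ => r3 Q h γ t + r4 Q h γ t) e) γ s

theorem Ω_eq_of_local {W : Opens Y.pt} {α β : Y.Ω W}
    (H : ∀ x ∈ W, ∃ (W' : Opens Y.pt) (h : W' ≤ W), x ∈ W' ∧ resΩ h α = resΩ h β) : α = β :=
  Subtype.ext <| funext fun x => by
    obtain ⟨W', h, hx, e⟩ := H x x.2
    exact congrArg (fun k : Y.Ω W' => k.1 ⟨x, hx⟩) e

theorem lie_of_N (hn : n ∈ N Q h) (γ : X.Ω U) : lie n.2.2 (pullΩ h γ) = r3 Q h γ n.2.1 + r4 Q h γ n.2.1 := by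
  refine Ω_eq_of_local fun y hy => ?_
  obtain ⟨U₁, hU₁, V₁, hV₁, h₁, hy₁, ⟨F⟩⟩ := exists_frame_pre ⟨y, hy⟩ h
  refine ⟨V₁, hV₁, hy₁, ?_⟩
  rw [res_lie, r34_res h h₁ hU₁ hV₁, res_pullΩ h h₁ hV₁ hU₁, Ω_expand F (resΩ hU₁ γ)]
  have hn' := resM_N h h₁ hU₁ hV₁ hn
  change lie (resM hU₁ hV₁ n).2.2 _ = r3 Q h₁ _ (resM hU₁ hV₁ n).2.1 + r4 Q h₁ _ (resM hU₁ hV₁ n).2.1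
  rw [r3_sum h₁, map_sum]
  exact (map_sum (AddMonoidHom.mk' (lie _) (lie_add _)) _ _).trans
    (Finset.sum_congr rfl fun i _ => lie_of_N_smul_dO h₁ hn' _ _)

end consequences
end anchored
end Pull
end DiffSpace


namespace DiffSpace
open Hom
variable {𝕂 : Type w} [Field 𝕂] {Y : DiffSpace.{u', v'} 𝕂} {X : DiffSpace.{u, v} 𝕂}
namespace Pull
variable {f : Hom Y X} {U : Opens X.pt} {V : Opens Y.pt}

section anchored
variable (Q : AnchoredSheaf.{u, v, w, z} X) (h : V ≤ f.pre U)
variable {Q}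

@[elab_as_elim]
theorem ten_ind {p : Ten U V Q → Prop} (t : Ten U V Q) (h0 : p 0)
    (h1 : ∀ g q, p (g ⊗ₜ q)) (h2 : ∀ a b, p a → p b → p (a + b)) : p t :=
  TensorProduct.induction_on t h0 h1 h2

theorem smul_tmul'' (b g : Y.O V) (q : Q.sec U) :
    b • (g ⊗ₜ[ℤ] q : Ten U V Q) = (b * g) ⊗ₜ q := rfl

theorem tB_smul_left (B : Q.sec U →ₗ[ℤ] Q.sec U →ₗ[ℤ] Y.O V) (b : Y.O V) (t s : Ten U V Q) :
    tB B (b • t) s = b * tB B t s := by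
  induction t using ten_ind with
  | h0 => simp
  | h1 g q =>
    induction s using ten_ind with
    | h0 => simp
    | h1 k p => rw [smul_tmul'', tB_tmul, tB_tmul]; ring
    | h2 a b ha hb => rw [map_add, map_add, ha, hb, mul_add]
  | h2 a b ha hb =>
    rw [smul_add, map_add, map_add, LinearMap.add_apply, LinearMap.add_apply, ha, hb, mul_add]

theorem tB_smul_right (B : Q.sec U →ₗ[ℤ] Q.sec U →ₗ[ℤ] Y.O V) (b : Y.O V) (t s : Ten U V Q) :
    tB B t (b • s) = b * tB B t s := by
  induction t using ten_ind with
  | h0 => simp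
  | h1 g q =>
    induction s using ten_ind with
    | h0 => simp
    | h1 k p => rw [smul_tmul'', tB_tmul, tB_tmul]; ring
    | h2 a b ha hb => rw [smul_add, map_add, map_add, ha, hb, mul_add]
  | h2 a b ha hb =>
    rw [map_add, LinearMap.add_apply, LinearMap.add_apply, ha, hb, mul_add]

theorem oB_smul_right (B : Q.sec U →ₗ[ℤ] Q.sec U →ₗ[ℤ] Y.O V) (b : Y.O V) (t s : Ten U V Q) :
    oB B t (b • s) = b • oB B t s := by
  induction t using ten_ind with
  | h0 => simp
  | h1 g q =>
    induction s using ten_ind with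
    | h0 => simp
    | h1 k p => rw [smul_tmul'', oB_tmul, oB_tmul]; module
    | h2 a b ha hb => rw [smul_add, map_add, map_add, ha, hb, smul_add]
  | h2 a b ha hb =>
    rw [map_add, LinearMap.add_apply, LinearMap.add_apply, ha, hb, smul_add]

theorem tp_symm (t s : Ten U V Q) : tp Q h t s = tp Q h s t := by
  induction t using ten_ind with
  | h0 => simp
  | h1 g q =>
    induction s using ten_ind with
    | h0 => simp
    | h1 k p => rw [tB_tmul, tB_tmul, pb_apply, pb_apply, Q.pairing_symm, mul_comm k]
    | h2 a b ha hb => rw [map_add, map_add, LinearMap.add_apply, ha, hb]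
  | h2 a b ha hb =>
    rw [map_add, map_add, LinearMap.add_apply, ha, hb]

theorem da_add_left (ξ η : Y.T V) (t : Ten U V Q) : da Q (ξ + η) t = da Q ξ t + da Q η t := by
  induction t using ten_ind with
  | h0 => simp
  | h1 g q => rw [da_tmul, da_tmul, da_tmul, add_act, TensorProduct.add_tmul]
  | h2 a b ha hb => rw [map_add, map_add, map_add, ha, hb]; abel

theorem da_smul_left (b : Y.O V) (ξ : Y.T V) (t : Ten U V Q) : da Q (b • ξ) t = b • da Q ξ t := by
  induction t using ten_ind with
  | h0 => simp
  | h1 g q => rw [da_tmul, da_tmul, smul_act]; rfl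
  | h2 a b ha hb => rw [map_add, map_add, ha, hb, smul_add]

theorem da_smul_right (b : Y.O V) (ξ : Y.T V) (t : Ten U V Q) :
    da Q ξ (b • t) = b • da Q ξ t + act ξ b • t := by
  induction t using ten_ind with
  | h0 => simp
  | h1 g q =>
    rw [smul_tmul'', da_tmul, da_tmul, act_mul, smul_tmul'', smul_tmul'', TensorProduct.add_tmul,
      mul_comm g]
  | h2 a b ha hb => rw [smul_add, map_add, map_add, ha, hb]; module

theorem da_zero_left (t : Ten U V Q) : da Q (0 : Y.T V) t = 0 := by
  have := da_smul_left (0 : Y.O V) 0 t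
  rwa [zero_smul, zero_smul] at this

theorem da_lb (ξ η : Y.T V) (t : Ten U V Q) :
    da Q (lb ξ η) t = da Q ξ (da Q η t) - da Q η (da Q ξ t) := by
  induction t using ten_ind with
  | h0 => simp
  | h1 g q => simp only [da_tmul, lb_act, TensorProduct.sub_tmul]
  | h2 a b ha hb => simp only [map_add, ha, hb]; abel

theorem da_one (ξ : Y.T V) (q : Q.sec U) : da Q ξ ((1 : Y.O V) ⊗ₜ q) = 0 := by
  rw [da_tmul, act_one, TensorProduct.zero_tmul]

theorem pair_om (t s : Ten U V Q) (ζ : Y.T V) : pair (om Q h t s) ζ = tp Q h (da Q ζ t) s := by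
  induction t using ten_ind with
  | h0 => simp [zero_pair]
  | h1 g q =>
    induction s using ten_ind with
    | h0 => simp [zero_pair]
    | h1 k p => rw [oB_tmul, da_tmul, tB_tmul, smul_pair, smul_pair, pair_dO]; ring
    | h2 a b ha hb => rw [map_add, map_add, add_pair, ha, hb]
  | h2 a b ha hb =>
    rw [map_add, map_add, map_add, LinearMap.add_apply, LinearMap.add_apply, add_pair, ha, hb]

/-- The pairing on triples: `⟨(α, t, ξ), (β, s, η)⟩ = α(η) + β(ξ) + ⟨t, s⟩`. -/
def bp : M U V Q →ₗ[Y.O V] M U V Q →ₗ[Y.O V] Y.O V :=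
  LinearMap.mk₂ _ (fun x y => pair x.1 y.2.2 + pair y.1 x.2.2 + tp Q h x.2.1 y.2.1)
    (fun x y z => by
      simp only [Prod.fst_add, Prod.snd_add, add_pair, pair_add, map_add, LinearMap.add_apply]
      ring)
    (fun b x y => by
      simp only [Prod.smul_fst, Prod.smul_snd, smul_pair, pair_smul, tB_smul_left, smul_eq_mul]
      ring)
    (fun x y z => by
      simp only [Prod.fst_add, Prod.snd_add, add_pair, pair_add, map_add]
      ring)
    (fun b x y => by
      simp only [Prod.smul_fst, Prod.smul_snd, smul_pair, pair_smul, tB_smul_right, smul_eq_mul]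
      ring)

theorem bp_apply (x y : M U V Q) :
    bp h x y = pair x.1 y.2.2 + pair y.1 x.2.2 + tp Q h x.2.1 y.2.1 := rfl

theorem bp_symm (x y : M U V Q) : bp h x y = bp h y x := by
  rw [bp_apply, bp_apply, tp_symm]; ring

theorem z1_mem (g : X.O U) (q : Q.sec U) : z1 Q h g q ∈ Z Q h :=
  Submodule.subset_span (Or.inl ⟨(g, q), rfl⟩)
theorem z2_mem (γ : X.Ω U) : z2 Q h γ ∈ Z Q h :=
  Submodule.subset_span (Or.inr ⟨γ, rfl⟩)

@[elab_as_elim]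
theorem Z_ind {p : ∀ m : M U V Q, m ∈ Z Q h → Prop} {m : M U V Q} (hm : m ∈ Z Q h)
    (h1 : ∀ g q, p (z1 Q h g q) (z1_mem h g q)) (h2 : ∀ γ, p (z2 Q h γ) (z2_mem h γ))
    (h0 : p 0 (zero_mem _))
    (h3 : ∀ a b ha hb, p a ha → p b hb → p (a + b) (add_mem ha hb))
    (h4 : ∀ (c : Y.O V) a ha, p a ha → p (c • a) (Submodule.smul_mem _ c ha)) : p m hm := by
  induction hm using Submodule.span_induction with
  | mem x hx =>
    rcases hx with ⟨⟨g, q⟩, rfl⟩ | ⟨γ, rfl⟩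
    exacts [h1 g q, h2 γ]
  | zero => exact h0
  | add a b ha hb h h' => exact h3 a b ha hb h h'
  | smul c a ha h => exact h4 c a ha h

theorem Z_le_N : Z Q h ≤ N Q h := fun z hz => by
  induction hz using Z_ind with
  | h0 => exact zero_mem _
  | h1 g q =>
    intro y
    rw [z1]
    simp only [map_sub, Pi.sub_apply, rho_tmul, map_smul]
    refine (map_zero (f.tan y)).trans ?_
    refine (sub_eq_zero.2 ?_).symm
    exact (one_smul 𝕂 _).symm
  | h2 γ =>
    intro y
    rw [z2]
    simp only [map_neg, Pi.neg_apply, rho_tmul, Q.anchor_coanchor]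
    refine (map_zero (f.tan y)).trans ?_
    refine (neg_eq_zero.2 ?_).symm
    exact smul_zero _
  | h3 a b _ _ ha hb => exact add_mem ha hb
  | h4 c a _ ha => exact Submodule.smul_mem _ c ha

theorem bp_Z {n m : M U V Q} (hn : n ∈ N Q h) (hm : m ∈ Z Q h) : bp h n m = 0 := by
  induction hm using Z_ind with
  | h0 => simp
  | h1 g q =>
    rw [bp_apply, z1]
    simp only [zero_pair, pair_zero, zero_add]
    generalize n.2.1 = t
    induction t using ten_ind with
    | h0 => simp
    | h1 k p => simp only [map_sub, tB_tmul, pb_apply, map_smul, smul_eq_mul, map_mul]; ring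
    | h2 a b ha hb => rw [map_add, LinearMap.add_apply, ha, hb, add_zero]
  | h2 γ =>
    rw [bp_apply, z2]
    simp only [pair_zero, zero_add]
    rw [pair_of_N h hn]
    generalize n.2.1 = t
    induction t using ten_ind with
    | h0 => simp
    | h1 k p => simp only [map_neg, tB_tmul, pb_apply, r2_tmul, Q.adjunction]; ring
    | h2 a b ha hb =>
      rw [map_add, map_add, LinearMap.add_apply, add_add_add_comm, ha, hb, add_zero]
  | h3 a b _ _ ha hb => rw [map_add, ha, hb, add_zero]
  | h4 c a _ ha => rw [map_smul, ha, smul_zero]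

variable {U' : Opens X.pt} {V' : Opens Y.pt} (h' : V' ≤ f.pre U') (hU : U' ≤ U) (hV : V' ≤ V)

theorem resTen_smul (b : Y.O V) (t : Ten U V Q) :
    resTen hU hV (b • t) = resO hV b • resTen hU hV t := by
  induction t using ten_ind with
  | h0 => simp
  | h1 k p => rw [smul_tmul'', resTen_tmul, resTen_tmul, smul_tmul'', map_mul]
  | h2 a b ha hb => rw [smul_add, map_add, map_add, smul_add, ha, hb]

theorem resM_smul (b : Y.O V) (m : M U V Q) :
    resM hU hV (b • m) = resO hV b • resM hU hV m :=
  Prod.ext rfl (Prod.ext (resTen_smul hU hV b m.2.1) rfl)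

theorem resM_Z {m : M U V Q} (hm : m ∈ Z Q h) : resM hU hV m ∈ Z Q h' := by
  induction hm using Z_ind with
  | h0 => rw [map_zero]; exact zero_mem _
  | h1 g q =>
    convert z1_mem h' (resO hU g) (Q.res hU q) using 1
    refine Prod.ext (map_zero (resΩ hV)) (Prod.ext ?_ rfl)
    change resTen hU hV (pullO h g ⊗ₜ[ℤ] q - (1 : Y.O V) ⊗ₜ[ℤ] (g • q)) = _
    rw [map_sub, resTen_tmul, resTen_tmul, Q.res_smul, map_one]; rfl
  | h2 γ =>
    convert z2_mem h' (resΩ hU γ) using 1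
    refine Prod.ext rfl (Prod.ext ?_ rfl)
    change resTen hU hV (-((1 : Y.O V) ⊗ₜ[ℤ] Q.coanchor γ)) = -((1 : Y.O V') ⊗ₜ[ℤ] _)
    rw [map_neg, resTen_tmul, Q.coanchor_res, map_one]
  | h3 a b _ _ ha hb => rw [map_add]; exact add_mem ha hb
  | h4 c a _ ha => rw [resM_smul]; exact Submodule.smul_mem _ _ ha

theorem res_tp (t s : Ten U V Q) :
    tp Q h' (resTen hU hV t) (resTen hU hV s) = resO hV (tp Q h t s) := by
  induction t using ten_ind with
  | h0 => simp
  | h1 g q =>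
    induction s using ten_ind with
    | h0 => simp
    | h1 k p =>
      rw [resTen_tmul, resTen_tmul, tB_tmul, tB_tmul, pb_apply, pb_apply, Q.pairing_res, map_mul,
        map_mul]; rfl
    | h2 a b ha hb => rw [map_add, map_add, map_add, map_add, ha, hb]
  | h2 a b ha hb =>
    rw [map_add, map_add, map_add, LinearMap.add_apply, LinearMap.add_apply, map_add, ha, hb]

theorem res_om (t s : Ten U V Q) :
    om Q h' (resTen hU hV t) (resTen hU hV s) = resΩ hV (om Q h t s) := by
  induction t using ten_ind with
  | h0 => simp
  | h1 g q =>
    induction s using ten_ind with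
    | h0 => simp
    | h1 k p =>
      rw [resTen_tmul, resTen_tmul, oB_tmul, oB_tmul, pb_apply, pb_apply, Q.pairing_res, resΩ_smul,
        resΩ_smul, res_dO]; rfl
    | h2 a b ha hb => rw [map_add, map_add, map_add, map_add, ha, hb]
  | h2 a b ha hb =>
    rw [map_add, map_add, map_add, LinearMap.add_apply, LinearMap.add_apply, map_add, ha, hb]

theorem res_da (ξ : Y.T V) (t : Ten U V Q) :
    da Q (resT hV ξ) (resTen hU hV t) = resTen hU hV (da Q ξ t) := by
  induction t using ten_ind with
  | h0 => simp
  | h1 g q => rw [resTen_tmul, da_tmul, da_tmul, resTen_tmul, res_act]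
  | h2 a b ha hb => rw [map_add, map_add, map_add, map_add, ha, hb]

theorem res_bp (x y : M U V Q) :
    bp h' (resM hU hV x) (resM hU hV y) = resO hV (bp h x y) := by
  rw [bp_apply, bp_apply, map_add, map_add, ← res_tp h h' hU hV, res_pair, res_pair]
  rfl

end anchored

section courant
variable (Q : CourantAlgebroid.{u, v, w, z} X) (h : V ≤ f.pre U)

/-- The bracket of formal sums: `[g ⊗ q, k ⊗ p] = g k ⊗ [q, p]`. -/
def tt : Ten U V Q.toAnchoredSheaf →ₗ[ℤ] Ten U V Q.toAnchoredSheaf →ₗ[ℤ]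
    Ten U V Q.toAnchoredSheaf :=
  TensorProduct.map₂ (LinearMap.mul ℤ (Y.O V))
    (LinearMap.mk₂ ℤ (fun q p => Q.bracket q p) (by simp) (by simp) (by simp) (by simp))

variable {Q}

@[simp] theorem tt_tmul (g k : Y.O V) (q p : Q.sec U) :
    tt Q (g ⊗ₜ q) (k ⊗ₜ p) = (g * k) ⊗ₜ[ℤ] (Q.bracket q p) := rfl

theorem tt_smul_right (b : Y.O V) (t s : Ten U V Q.toAnchoredSheaf) :
    tt Q t (b • s) = b • tt Q t s := by
  induction t using ten_ind with
  | h0 => simp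
  | h1 g q =>
    induction s using ten_ind with
    | h0 => simp
    | h1 k p =>
      rw [smul_tmul'', tt_tmul, tt_tmul, smul_tmul'']
      congr 1; ring
    | h2 a b ha hb => rw [smul_add, map_add, map_add, ha, hb, smul_add]
  | h2 a b ha hb =>
    rw [map_add, LinearMap.add_apply, LinearMap.add_apply, ha, hb, smul_add]

/-- The bracket of triples: `[(α, g ⊗ q, ξ), (β, k ⊗ p, η)]` is
`(L_ξ β - ι_η dα + k ⟨q, p⟩ dg, g k ⊗ [q, p] - η(g) ⊗ q + ξ(k) ⊗ p, [ξ, η])`, where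
`ι_η dα = L_η α - d(α(η))`. -/
def br (x y : M U V Q.toAnchoredSheaf) : M U V Q.toAnchoredSheaf :=
  (lie x.2.2 y.1 - lie y.2.2 x.1 + dO (pair x.1 y.2.2) + om Q.toAnchoredSheaf h x.2.1 y.2.1,
    tt Q x.2.1 y.2.1 + da Q.toAnchoredSheaf x.2.2 y.2.1 - da Q.toAnchoredSheaf y.2.2 x.2.1,
    lb x.2.2 y.2.2)

theorem br_add (x y z : M U V Q.toAnchoredSheaf) : br h x (y + z) = br h x y + br h x z := by
  refine Prod.ext ?_ (Prod.ext ?_ ?_)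
  · simp only [br, Prod.fst_add, Prod.snd_add, lie_add, add_lie, pair_add, map_add]; abel
  · simp only [br, Prod.fst_add, Prod.snd_add, da_add_left, map_add]; abel
  · exact lb_add _ _ _

theorem add_br (x y z : M U V Q.toAnchoredSheaf) : br h (x + y) z = br h x z + br h y z := by
  refine Prod.ext ?_ (Prod.ext ?_ ?_)
  · simp only [br, Prod.fst_add, Prod.snd_add, lie_add, add_lie, add_pair, map_add,
      LinearMap.add_apply]; abel
  · simp only [br, Prod.fst_add, Prod.snd_add, da_add_left, map_add, LinearMap.add_apply]; abel
  · exact add_lb _ _ _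

theorem br_smul (b : Y.O V) (x y : M U V Q.toAnchoredSheaf) :
    br h x (b • y) = b • br h x y + act x.2.2 b • y := by
  refine Prod.ext ?_ (Prod.ext ?_ ?_)
  · simp only [br, Prod.fst_add, Prod.smul_fst, Prod.smul_snd, lie_smul, smul_lie, pair_smul,
      dO_mul, oB_smul_right]
    module
  · simp only [br, Prod.fst_add, Prod.snd_add, Prod.smul_fst, Prod.smul_snd, da_smul_left,
      da_smul_right, tt_smul_right]
    module
  · exact lb_smul _ _ _

theorem symm_aux (t s : Ten U V Q.toAnchoredSheaf) :
    ((om Q.toAnchoredSheaf h t s + om Q.toAnchoredSheaf h s t - dO (tp Q.toAnchoredSheaf h t s),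
      tt Q t s + tt Q s t, 0) : M U V Q.toAnchoredSheaf) ∈ Z Q.toAnchoredSheaf h := by
  induction t using ten_ind with
  | h0 => simp only [map_zero, LinearMap.zero_apply, add_zero, sub_zero, TensorProduct.zero_tmul]; exact zero_mem _
  | h1 g q =>
    induction s using ten_ind with
    | h0 => simp only [map_zero, LinearMap.zero_apply, add_zero, sub_zero, TensorProduct.zero_tmul]; exact zero_mem _
    | h1 k p =>
      convert Submodule.smul_mem _ (-(g * k)) (z2_mem h (dO (Q.pairing q p))) using 1
      refine Prod.ext ?_ (Prod.ext ?_ (smul_zero _).symm)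
      · change _ = -(g * k) • pullΩ h (dO (Q.pairing q p))
        simp only [oB_tmul, tB_tmul, pb_apply, dO_mul, pullΩ_dO, Q.pairing_symm p q]
        module
      · change _ = -(g * k) • -((1 : Y.O V) ⊗ₜ[ℤ] Q.coanchor (dO (Q.pairing q p)))
        rw [tt_tmul, tt_tmul, neg_smul, smul_neg, neg_neg, smul_tmul'', mul_one, ← Q.symmetrizer,
          TensorProduct.tmul_add, mul_comm k g]
    | h2 a b ha hb =>
      convert add_mem ha hb using 1
      refine Prod.ext ?_ (Prod.ext ?_ (add_zero _).symm)
      · simp only [map_add, LinearMap.add_apply, Prod.mk_add_mk]; abel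
      · simp only [map_add, LinearMap.add_apply, Prod.mk_add_mk]; abel
  | h2 a b ha hb =>
    convert add_mem ha hb using 1
    refine Prod.ext ?_ (Prod.ext ?_ (add_zero _).symm)
    · simp only [map_add, LinearMap.add_apply, Prod.mk_add_mk]; abel
    · simp only [map_add, LinearMap.add_apply, Prod.mk_add_mk]; abel

theorem br_symm (x y : M U V Q.toAnchoredSheaf) :
    br h x y + br h y x - (dO (bp h x y), 0, 0) ∈ Z Q.toAnchoredSheaf h := by
  convert symm_aux h x.2.1 y.2.1 using 1
  refine Prod.ext ?_ (Prod.ext ?_ ?_)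
  · simp only [br, bp_apply, Prod.fst_add, Prod.fst_sub, map_add]; abel
  · simp only [br, bp_apply, Prod.fst_add, Prod.fst_sub, Prod.snd_add, Prod.snd_sub]; abel
  · simp only [br, Prod.snd_add, Prod.snd_sub, lb_self_add, sub_zero]

theorem tt_z1 (g : X.O U) (q : Q.sec U) (t : Ten U V Q.toAnchoredSheaf) :
    ((0, tt Q t (pullO h g ⊗ₜ q - (1 : Y.O V) ⊗ₜ (g • q)) + r1 Q.toAnchoredSheaf h g t ⊗ₜ q, 0) :
      M U V Q.toAnchoredSheaf) ∈ Z Q.toAnchoredSheaf h := by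
  induction t using ten_ind with
  | h0 => simp only [map_zero, LinearMap.zero_apply, add_zero, sub_zero, TensorProduct.zero_tmul]; exact zero_mem _
  | h1 k p =>
    convert add_mem (Submodule.smul_mem _ k (z1_mem h g (Q.bracket p q)))
      (Submodule.smul_mem _ k (z1_mem h (act (Q.anchor p) g) q)) using 1
    refine Prod.ext ?_ (Prod.ext ?_ ?_)
    · change (0 : Y.Ω V) = k • 0 + k • 0
      rw [smul_zero, add_zero]
    · change _ = k • (_ - _) + k • (_ - _)
      rw [map_sub, tt_tmul, tt_tmul, r1_tmul, smul_sub, smul_sub, Q.leibniz,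
        TensorProduct.tmul_add]
      simp only [smul_tmul'', mul_one]
      abel
    · change (0 : Y.T V) = k • 0 + k • 0
      rw [smul_zero, add_zero]
  | h2 a b ha hb =>
    convert add_mem ha hb using 1
    refine Prod.ext (add_zero _).symm (Prod.ext ?_ (add_zero _).symm)
    rw [map_add, map_add, LinearMap.add_apply, TensorProduct.add_tmul]
    exact add_add_add_comm _ _ _ _

theorem om_z1 (g : X.O U) (q : Q.sec U) (t : Ten U V Q.toAnchoredSheaf) :
    om Q.toAnchoredSheaf h t (pullO h g ⊗ₜ q - (1 : Y.O V) ⊗ₜ (g • q)) = 0 := by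
  induction t using ten_ind with
  | h0 => simp
  | h1 k p =>
    rw [map_sub, oB_tmul, oB_tmul, pb_apply, pb_apply, map_smul, smul_eq_mul, map_mul]; module
  | h2 a b ha hb => rw [map_add, LinearMap.add_apply, ha, hb, add_zero]

theorem tt_z2 (γ : X.Ω U) (t : Ten U V Q.toAnchoredSheaf) :
    ((r3 Q.toAnchoredSheaf h γ t, tt Q t (-((1 : Y.O V) ⊗ₜ Q.coanchor γ)), 0) :
      M U V Q.toAnchoredSheaf) ∈ Z Q.toAnchoredSheaf h := by
  induction t using ten_ind with
  | h0 => simp only [map_zero, LinearMap.zero_apply, add_zero, sub_zero, TensorProduct.zero_tmul]; exact zero_mem _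
  | h1 k p =>
    convert Submodule.smul_mem _ k (z2_mem h (lie (Q.anchor p) γ)) using 1
    refine Prod.ext rfl (Prod.ext ?_ (smul_zero _).symm)
    change _ = k • -((1 : Y.O V) ⊗ₜ[ℤ] Q.coanchor (lie (Q.anchor p) γ))
    rw [map_neg, tt_tmul, Q.bracket_coanchor, smul_neg, smul_tmul'']
  | h2 a b ha hb =>
    convert add_mem ha hb using 1
    refine Prod.ext ?_ (Prod.ext ?_ (add_zero _).symm)
    · simp only [map_add, Prod.mk_add_mk]
    · simp only [map_add, LinearMap.add_apply, Prod.mk_add_mk]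

theorem om_z2 (γ : X.Ω U) (t : Ten U V Q.toAnchoredSheaf) :
    om Q.toAnchoredSheaf h t (-((1 : Y.O V) ⊗ₜ Q.coanchor γ)) = - r4 Q.toAnchoredSheaf h γ t := by
  induction t using ten_ind with
  | h0 => simp
  | h1 k p => rw [map_neg, oB_tmul, r4_tmul, pb_apply, Q.adjunction, one_smul]
  | h2 a b ha hb => rw [map_add, LinearMap.add_apply, ha, hb, map_add, neg_add]

theorem br_Z {n m : M U V Q.toAnchoredSheaf} (hn : n ∈ N Q.toAnchoredSheaf h)
    (hm : m ∈ Z Q.toAnchoredSheaf h) : br h n m ∈ Z Q.toAnchoredSheaf h := by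
  induction hm using Z_ind with
  | h0 =>
    have := br_smul h (0 : Y.O V) n 0
    rw [zero_smul, zero_smul, smul_zero, add_zero] at this
    rw [this]; exact zero_mem _
  | h1 g q =>
    convert tt_z1 h g q n.2.1 using 1
    refine Prod.ext ?_ (Prod.ext ?_ (lb_zero _))
    · simp only [br, z1, lie_zero, zero_lie, pair_zero, map_zero, om_z1]; abel
    · simp only [br, z1]
      rw [da_zero_left, map_sub (da _ _), da_one, da_tmul, act_of_N h hn, sub_zero, sub_zero]
  | h2 γ =>
    convert tt_z2 h γ n.2.1 using 1
    refine Prod.ext ?_ (Prod.ext ?_ (lb_zero _))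
    · simp only [br, z2, zero_lie, pair_zero, map_zero, om_z2, lie_of_N h hn]; abel
    · simp only [br, z2]
      rw [da_zero_left, map_neg (da _ _), da_one, neg_zero, sub_zero, add_zero]
  | h3 a b _ _ ha hb => rw [br_add]; exact add_mem ha hb
  | h4 c a ha' ha =>
    rw [br_smul]; exact add_mem (Submodule.smul_mem _ _ ha) (Submodule.smul_mem _ _ ha')

theorem Z_br {n m : M U V Q.toAnchoredSheaf} (hn : n ∈ N Q.toAnchoredSheaf h)
    (hm : m ∈ Z Q.toAnchoredSheaf h) : br h m n ∈ Z Q.toAnchoredSheaf h := by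
  have := br_symm h n m
  rw [bp_Z h hn hm, map_zero] at this
  have e := sub_mem this (br_Z h hn hm)
  convert e using 1
  change _ = br h n m + br h m n - 0 - br h n m
  abel

end courant
end Pull
end DiffSpace


namespace DiffSpace
open Hom
variable {𝕂 : Type w} [Field 𝕂] {Y : DiffSpace.{u', v'} 𝕂} {X : DiffSpace.{u, v} 𝕂}
namespace Pull
variable {f : Hom Y X} {U : Opens X.pt} {V : Opens Y.pt}

section anchored
variable (Q : AnchoredSheaf.{u, v, w, z} X) (h : V ≤ f.pre U)

variable {Q} in
theorem r1_add (a b : X.O U) (t : Ten U V Q) : r1 Q h (a + b) t = r1 Q h a t + r1 Q h b t := by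
  induction t using ten_ind with
  | h0 => simp
  | h1 g q => rw [r1_tmul, r1_tmul, r1_tmul, act_add, map_add, mul_add]
  | h2 a b ha hb => simp only [map_add, ha, hb]; ring

/-- `(p, r) ↦ Σ g f^*(π(q)⟨p, r⟩)` for `t = Σ g ⊗ q` -/
def eb (t : Ten U V Q) : Q.sec U →ₗ[ℤ] Q.sec U →ₗ[ℤ] Y.O V :=
  have e (n : ℤ) (a : X.O U) : r1 Q h (n • a) t = n • r1 Q h a t :=
    map_zsmul (AddMonoidHom.mk' (fun a => r1 Q h a t) fun a b => r1_add h a b t) n a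
  LinearMap.mk₂ ℤ (fun p r => r1 Q h (Q.pairing p r) t)
    (fun _ _ _ => by rw [map_add, LinearMap.add_apply, r1_add])
    (fun _ _ _ => by rw [map_zsmul, LinearMap.smul_apply, e])
    (fun _ _ _ => by rw [map_add, r1_add])
    (fun _ _ _ => by rw [map_zsmul, e])

@[simp] theorem eb_apply (t : Ten U V Q) (p r : Q.sec U) :
    eb Q h t p r = r1 Q h (Q.pairing p r) t := rfl

/-- `(p, q) ↦ f^*(π(q) π(p) a)` -/
def wb (a : X.O U) : Q.sec U →ₗ[ℤ] Q.sec U →ₗ[ℤ] Y.O V :=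
  let e (q : Q.sec U) : X.O U →+ X.O U := AddMonoidHom.mk' (act (Q.anchor q)) (act_add _)
  let e' (a : X.O U) : Q.sec U →+ X.O U :=
    AddMonoidHom.mk' (fun q => act (Q.anchor q) a) fun q p => by rw [map_add, add_act]
  LinearMap.mk₂ ℤ (fun p q => pullO h (act (Q.anchor q) (act (Q.anchor p) a)))
    (fun p p' q => by rw [map_add, add_act, act_add, map_add])
    (fun n p q => map_zsmul ((pullO h).toAddMonoidHom.comp ((e q).comp (e' a))) n p)
    (fun p q q' => by rw [map_add, add_act, map_add])
    (fun n p q => map_zsmul ((pullO h).toAddMonoidHom.comp (e' (act (Q.anchor p) a))) n q)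

@[simp] theorem wb_apply (a : X.O U) (p q : Q.sec U) :
    wb Q h a p q = pullO h (act (Q.anchor q) (act (Q.anchor p) a)) := rfl

variable {Q}

theorem act_r1 {n : M U V Q} (hn : n ∈ N Q h) (a : X.O U) (s : Ten U V Q) :
    act n.2.2 (r1 Q h a s) = r1 Q h a (da Q n.2.2 s) + tB (wb Q h a) s n.2.1 := by
  induction s using ten_ind with
  | h0 => simp [act_zero]
  | h1 k p =>
    rw [da_tmul, r1_tmul, r1_tmul, act_mul, act_of_N h hn, add_comm, mul_comm (pullO h _)]
    congr 1
    generalize n.2.1 = t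
    induction t using ten_ind with
    | h0 => simp
    | h1 g q => rw [r1_tmul, tB_tmul, wb_apply, mul_assoc]
    | h2 a b ha hb => rw [map_add, map_add, mul_add, ha, hb]
  | h2 a b ha hb =>
    simp only [map_add, LinearMap.add_apply, act_add, ha, hb]; ring

theorem lie_om {n : M U V Q} (hn : n ∈ N Q h) (s u : Ten U V Q) :
    lie n.2.2 (om Q h s u) = om Q h (da Q n.2.2 s) u + om Q h s (da Q n.2.2 u) +
      oB (eb Q h n.2.1) s u := by
  induction s using ten_ind with
  | h0 => simp [lie_zero]
  | h1 k p =>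
    induction u using ten_ind with
    | h0 => simp [lie_zero]
    | h1 l r =>
      rw [da_tmul, da_tmul, oB_tmul, oB_tmul, oB_tmul, oB_tmul, lie_smul, lie_smul, lie_dO,
        pb_apply, act_of_N h hn, eb_apply]
      module
    | h2 a b ha hb => simp only [map_add, LinearMap.add_apply, lie_add, ha, hb]; abel
  | h2 a b ha hb => simp only [map_add, LinearMap.add_apply, lie_add, ha, hb]; abel

theorem N_of_r1 (n : M U V Q) (H : ∀ (U' : Opens X.pt) (V' : Opens Y.pt) (h' : V' ≤ f.pre U')
    (hU : U' ≤ U) (hV : V' ≤ V) (a : X.O U'),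
      act (resT hV n.2.2) (pullO h' a) = r1 Q h' a (resTen hU hV n.2.1)) : n ∈ N Q h := fun y => by
  obtain ⟨U₁, hU₁, V₁, hV₁, h₁, hy₁, ⟨F⟩⟩ := exists_frame_pre y h
  rw [F.expand (im h₁ ⟨y, hy₁⟩) (rho Q h n.2.1 y)]
  refine (tan_expand h₁ F (resT hV₁ n.2.2) ⟨y, hy₁⟩).trans (Finset.sum_congr rfl fun i _ => ?_)
  congr 1
  rw [H U₁ V₁ h₁ hU₁ hV₁ (F.a i)]
  refine (rho_dAt h₁ (resTen hU₁ hV₁ n.2.1) (F.a i) ⟨y, hy₁⟩).symm.trans ?_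
  rw [rho_res h h₁ hU₁ hV₁]

end anchored

section courant
variable {Q : CourantAlgebroid.{u, v, w, z} X} (h : V ≤ f.pre U)

section res
variable {U' : Opens X.pt} {V' : Opens Y.pt} (h' : V' ≤ f.pre U') (hU : U' ≤ U) (hV : V' ≤ V)

theorem res_tt (t s : Ten U V Q.toAnchoredSheaf) :
    tt Q (resTen hU hV t) (resTen hU hV s) = resTen hU hV (tt Q t s) := by
  induction t using ten_ind with
  | h0 => simp
  | h1 g q =>
    induction s using ten_ind with
    | h0 => simp
    | h1 k p => rw [resTen_tmul, resTen_tmul, tt_tmul, tt_tmul, resTen_tmul, Q.bracket_res, map_mul]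
    | h2 a b ha hb => rw [map_add, map_add, map_add, map_add, ha, hb]
  | h2 a b ha hb =>
    rw [map_add, map_add, map_add, LinearMap.add_apply, LinearMap.add_apply, map_add, ha, hb]

theorem res_br (x y : M U V Q.toAnchoredSheaf) :
    br h' (resM hU hV x) (resM hU hV y) = resM hU hV (br h x y) := by
  refine Prod.ext ?_ (Prod.ext ?_ (res_lb hV _ _).symm)
  · change _ = resΩ hV (lie x.2.2 y.1 - lie y.2.2 x.1 + dO (pair x.1 y.2.2) + om _ h x.2.1 y.2.1)
    rw [map_add, map_add, map_sub, res_lie, res_lie, res_dO, res_pair, ← res_om h h' hU hV]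
    rfl
  · change _ = resTen hU hV (tt Q x.2.1 y.2.1 + da _ x.2.2 y.2.1 - da _ y.2.2 x.2.1)
    rw [map_sub, map_add, ← res_tt, ← res_da, ← res_da]
    rfl

end res

theorem r1_tt (a : X.O U) (t s : Ten U V Q.toAnchoredSheaf) :
    r1 Q.toAnchoredSheaf h a (tt Q t s) =
      tB (wb Q.toAnchoredSheaf h a) s t - tB (wb Q.toAnchoredSheaf h a) t s := by
  induction t using ten_ind with
  | h0 => simp
  | h1 g q =>
    induction s using ten_ind with
    | h0 => simp
    | h1 k p =>
      rw [tt_tmul, r1_tmul, tB_tmul, tB_tmul, wb_apply, wb_apply, Q.anchor_bracket, lb_act, map_sub]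
      ring
    | h2 a b ha hb => simp only [map_add, LinearMap.add_apply, ha, hb]; abel
  | h2 a b ha hb => simp only [map_add, LinearMap.add_apply, ha, hb]; abel

theorem r1_br {x y : M U V Q.toAnchoredSheaf} (hx : x ∈ N Q.toAnchoredSheaf h)
    (hy : y ∈ N Q.toAnchoredSheaf h) (a : X.O U) :
    act (br h x y).2.2 (pullO h a) = r1 Q.toAnchoredSheaf h a (br h x y).2.1 := by
  simp only [br, map_add, map_sub, lb_act, r1_tt]
  rw [act_of_N h hx, act_of_N h hy, act_r1 h hx, act_r1 h hy]
  ring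

theorem br_N {x y : M U V Q.toAnchoredSheaf} (hx : x ∈ N Q.toAnchoredSheaf h)
    (hy : y ∈ N Q.toAnchoredSheaf h) : br h x y ∈ N Q.toAnchoredSheaf h :=
  N_of_r1 h _ fun U' V' h' hU hV a => by
    have := r1_br h' (resM_N h h' hU hV hx) (resM_N h h' hU hV hy) a
    rw [res_br h h' hU hV] at this
    exact this

theorem invar_aux {x : M U V Q.toAnchoredSheaf} (hx : x ∈ N Q.toAnchoredSheaf h)
    (s u : Ten U V Q.toAnchoredSheaf) :
    tp Q.toAnchoredSheaf h (tt Q x.2.1 s) u + tp Q.toAnchoredSheaf h s (tt Q x.2.1 u) +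
      tp Q.toAnchoredSheaf h (da _ x.2.2 s) u + tp Q.toAnchoredSheaf h s (da _ x.2.2 u) =
      act x.2.2 (tp Q.toAnchoredSheaf h s u) := by
  induction s using ten_ind with
  | h0 => simp [act_zero]
  | h1 k p =>
    induction u using ten_ind with
    | h0 => simp [act_zero]
    | h1 l r =>
      rw [da_tmul, da_tmul, tB_tmul, tB_tmul, tB_tmul, act_mul, act_mul, pb_apply, act_of_N h hx]
      generalize x.2.1 = t
      have : tp Q.toAnchoredSheaf h (tt Q t (k ⊗ₜ p)) (l ⊗ₜ r) +
          tp Q.toAnchoredSheaf h (k ⊗ₜ p) (tt Q t (l ⊗ₜ r)) =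
          k * l * r1 Q.toAnchoredSheaf h (Q.pairing p r) t := by
        induction t using ten_ind with
        | h0 => simp
        | h1 g q =>
          rw [tt_tmul, tt_tmul, tB_tmul, tB_tmul, r1_tmul, ← Q.invariance, pb_apply, pb_apply,
            map_add]
          ring
        | h2 a b ha hb =>
          simp only [map_add, LinearMap.add_apply] at *
          rw [add_add_add_comm, ha, hb]; ring
      rw [this]; ring
    | h2 a b ha hb =>
      simp only [map_add, LinearMap.add_apply, act_add] at *
      rw [← ha, ← hb]; ring
  | h2 a b ha hb =>
    simp only [map_add, LinearMap.add_apply, act_add] at *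
    rw [← ha, ← hb]; ring

theorem invar {x : M U V Q.toAnchoredSheaf} (hx : x ∈ N Q.toAnchoredSheaf h)
    (y z : M U V Q.toAnchoredSheaf) :
    bp h (br h x y) z + bp h y (br h x z) = act x.2.2 (bp h y z) := by
  have := invar_aux h hx y.2.1 z.2.1
  simp only [bp_apply, br, act_add, add_pair, sub_pair, pair_dO, lie_pair, map_add, map_sub,
    LinearMap.add_apply, LinearMap.sub_apply, pair_om, ← this]
  have e := lb_self_add y.2.2 z.2.2
  have e' : lb z.2.2 y.2.2 = - lb y.2.2 z.2.2 := (neg_eq_of_add_eq_zero_right e).symm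
  rw [e', pair_neg, tp_symm h y.2.1 (da _ z.2.2 x.2.1), tp_symm h y.2.1 (da _ x.2.2 z.2.1)]
  ring

theorem adj (x : M U V Q.toAnchoredSheaf) (β : Y.Ω V) : bp h x (β, 0, 0) = pair β x.2.2 := by
  simp [bp_apply, pair_zero]

theorem br_co (x : M U V Q.toAnchoredSheaf) (β : Y.Ω V) :
    br h x (β, 0, 0) = (lie x.2.2 β, 0, 0) := by
  refine Prod.ext ?_ (Prod.ext ?_ (lb_zero _))
  · simp [br, zero_lie, pair_zero]
  · simp [br, da_zero_left]

theorem da_tt (ξ : Y.T V) (t s : Ten U V Q.toAnchoredSheaf) :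
    da _ ξ (tt Q t s) = tt Q (da _ ξ t) s + tt Q t (da _ ξ s) := by
  induction t using ten_ind with
  | h0 => simp
  | h1 g q =>
    induction s using ten_ind with
    | h0 => simp
    | h1 k p =>
      rw [da_tmul, da_tmul, tt_tmul, tt_tmul, tt_tmul, da_tmul, act_mul, TensorProduct.add_tmul,
        mul_comm k, add_comm]
    | h2 a b ha hb => simp only [map_add, LinearMap.add_apply, ha, hb]; abel
  | h2 a b ha hb => simp only [map_add, LinearMap.add_apply, ha, hb]; abel

theorem tt_tt (t s u : Ten U V Q.toAnchoredSheaf) :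
    tt Q t (tt Q s u) = tt Q (tt Q t s) u + tt Q s (tt Q t u) := by
  induction t using ten_ind with
  | h0 => simp
  | h1 g q =>
    induction s using ten_ind with
    | h0 => simp
    | h1 k p =>
      induction u using ten_ind with
      | h0 => simp
      | h1 l r =>
        simp only [tt_tmul]
        rw [Q.jacobi, TensorProduct.tmul_add, mul_assoc, mul_left_comm g k l]
      | h2 a b ha hb => simp only [map_add, LinearMap.add_apply, ha, hb]; abel
    | h2 a b ha hb => simp only [map_add, LinearMap.add_apply, ha, hb]; abel
  | h2 a b ha hb => simp only [map_add, LinearMap.add_apply, ha, hb]; abel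

theorem eb_add (t t' : Ten U V Q.toAnchoredSheaf) :
    eb Q.toAnchoredSheaf h (t + t') = eb Q.toAnchoredSheaf h t + eb Q.toAnchoredSheaf h t' :=
  LinearMap.ext₂ fun p r => (r1 Q.toAnchoredSheaf h (Q.pairing p r)).map_add t t'

theorem oB_add (B B' : Q.sec U →ₗ[ℤ] Q.sec U →ₗ[ℤ] Y.O V) (t s : Ten U V Q.toAnchoredSheaf) :
    oB (Q := Q.toAnchoredSheaf) (B + B') t s = oB B t s + oB B' t s := by
  induction t using ten_ind with
  | h0 => simp
  | h1 g q =>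
    induction s using ten_ind with
    | h0 => simp
    | h1 k p => rw [oB_tmul, oB_tmul, oB_tmul, LinearMap.add_apply, LinearMap.add_apply, add_smul]
    | h2 a b ha hb => simp only [map_add, ha, hb]; abel
  | h2 a b ha hb => simp only [map_add, LinearMap.add_apply, ha, hb]; abel

theorem eb_zero : eb Q.toAnchoredSheaf h (0 : Ten U V Q.toAnchoredSheaf) = 0 :=
  LinearMap.ext₂ fun p r => (r1 Q.toAnchoredSheaf h (Q.pairing p r)).map_zero

theorem oB_zero (t s : Ten U V Q.toAnchoredSheaf) :
    oB (Q := Q.toAnchoredSheaf) (0 : Q.sec U →ₗ[ℤ] Q.sec U →ₗ[ℤ] Y.O V) t s = 0 := by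
  have := oB_add (Q := Q) (0 : Q.sec U →ₗ[ℤ] Q.sec U →ₗ[ℤ] Y.O V) 0 t s
  rwa [add_zero, left_eq_add] at this

theorem om_tt (t s u : Ten U V Q.toAnchoredSheaf) :
    oB (eb Q.toAnchoredSheaf h t) s u - oB (eb Q.toAnchoredSheaf h s) t u +
      oB (eb Q.toAnchoredSheaf h u) t s + om Q.toAnchoredSheaf h t (tt Q s u) -
      om Q.toAnchoredSheaf h (tt Q t s) u - om Q.toAnchoredSheaf h s (tt Q t u) = 0 := by
  induction t using ten_ind with
  | h0 => simp [eb_zero, oB_zero]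
  | h1 g q =>
    induction s using ten_ind with
    | h0 => simp [eb_zero, oB_zero]
    | h1 k p =>
      induction u using ten_ind with
      | h0 => simp only [eb_zero, oB_zero, map_zero]; abel
      | h1 l r =>
        simp only [tt_tmul, oB_tmul, eb_apply, r1_tmul, pb_apply, dO_mul]
        have e1 := congrArg (pullO h) (Q.invariance q p r)
        have e2 := congrArg (pullO h) (Q.invariance p q r)
        have e3 := congrArg (fun x => pullO h (Q.pairing x r)) (Q.symmetrizer q p)
        simp only [map_add, LinearMap.add_apply, Q.pairing_symm (Q.coanchor _) r, Q.adjunction,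
          pair_dO] at e1 e2 e3
        rw [← e1, ← e2, ← e3]
        module
      | h2 a b ha hb =>
        have := congrArg₂ (· + ·) ha hb
        simp only [map_add, LinearMap.add_apply, eb_add, oB_add, add_zero] at *
        rw [← this]; abel
    | h2 a b ha hb =>
      have := congrArg₂ (· + ·) ha hb
      simp only [map_add, LinearMap.add_apply, eb_add, oB_add, add_zero] at *
      rw [← this]; abel
  | h2 a b ha hb =>
    have := congrArg₂ (· + ·) ha hb
    simp only [map_add, LinearMap.add_apply, eb_add, oB_add, add_zero] at *
    rw [← this]; abel

theorem lie_sub (ξ : Y.T V) (α β : Y.Ω V) : lie ξ (α - β) = lie ξ α - lie ξ β :=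
  map_sub (AddMonoidHom.mk' (lie ξ) (lie_add ξ)) α β

theorem br_br {x y z : M U V Q.toAnchoredSheaf} (hx : x ∈ N Q.toAnchoredSheaf h)
    (hy : y ∈ N Q.toAnchoredSheaf h) (hz : z ∈ N Q.toAnchoredSheaf h) :
    br h x (br h y z) - (br h (br h x y) z + br h y (br h x z)) ∈ Z Q.toAnchoredSheaf h := by
  convert symm_aux h (da _ z.2.2 x.2.1) y.2.1 using 1
  refine Prod.ext ?_ (Prod.ext ?_ ?_)
  · change (br h x (br h y z)).1 - ((br h (br h x y) z).1 + (br h y (br h x z)).1) = _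
    have := om_tt h x.2.1 y.2.1 z.2.1
    simp only [br, map_add, map_sub, lie_add, lie_sub, lie_dO, pair_om, LinearMap.add_apply,
      LinearMap.sub_apply, lie_om h hx, lie_om h hy, lie_om h hz, add_pair, sub_pair, pair_dO,
      lie_lie, lie_pair, act_sub]
    rw [← sub_eq_zero, ← this]
    abel
  · change (br h x (br h y z)).2.1 - ((br h (br h x y) z).2.1 + (br h y (br h x z)).2.1) = _
    simp only [br, map_add, map_sub, LinearMap.add_apply, LinearMap.sub_apply, da_lb, da_tt]
    rw [tt_tt x.2.1 y.2.1]
    abel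
  · change lb _ (lb _ _) - (lb (lb _ _) _ + lb _ (lb _ _)) = 0
    rw [lb_lb, sub_self]

end courant
end Pull
end DiffSpace


namespace DiffSpace
variable {𝕂 : Type w} [Field 𝕂]

/-- Modules with anchor, co-anchor and pairing over the members of a system of open sets, with
restriction maps (`i ≤ j` means that `j` is smaller than `i`). The sections of the sheaf it
generates are constructed below. -/
structure AncPre (Y : DiffSpace.{u, v} 𝕂) where
  I : Type t
  [pre : Preorder I]
  op : I → Opens Y.pt
  op_mono : ∀ {i j}, i ≤ j → op j ≤ op i
  dir : ∀ (y : Y.pt) (i j : I), y ∈ op i → y ∈ op j → ∃ k, i ≤ k ∧ j ≤ k ∧ y ∈ op k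
  cut : I → Opens Y.pt → I
  le_cut : ∀ i W, i ≤ cut i W
  op_cut : ∀ i W, op (cut i W) = op i ⊓ W
  top : I
  op_top : op top = ⊤
  P : I → Type z
  [acg : ∀ i, AddCommGroup (P i)]
  [mod : ∀ i, Module (Y.O (op i)) (P i)]
  res : ∀ {i j}, i ≤ j → P i →+ P j
  res_self : ∀ {i} (p : P i), res le_rfl p = p
  res_res : ∀ {i j k} (h : i ≤ j) (h' : j ≤ k) (p : P i), res h' (res h p) = res (h.trans h') p
  res_smul : ∀ {i j} (h : i ≤ j) (f : Y.O (op i)) (p : P i),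
    res h (f • p) = resO (op_mono h) f • res h p
  anchor : ∀ {i}, P i →ₗ[Y.O (op i)] Y.T (op i)
  coanchor : ∀ {i}, Y.Ω (op i) →ₗ[Y.O (op i)] P i
  pairing : ∀ {i}, P i →ₗ[Y.O (op i)] P i →ₗ[Y.O (op i)] Y.O (op i)
  anchor_res : ∀ {i j} (h : i ≤ j) (q : P i), anchor (res h q) = resT (op_mono h) (anchor q)
  coanchor_res : ∀ {i j} (h : i ≤ j) (α : Y.Ω (op i)),
    coanchor (resΩ (op_mono h) α) = res h (coanchor α)
  pairing_res : ∀ {i j} (h : i ≤ j) (q p : P i),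
    pairing (res h q) (res h p) = resO (op_mono h) (pairing q p)
  pairing_symm : ∀ {i} (q p : P i), pairing q p = pairing p q
  anchor_coanchor : ∀ {i} (α : Y.Ω (op i)), anchor (coanchor α) = 0
  adjunction : ∀ {i} (q : P i) (α : Y.Ω (op i)), pairing q (coanchor α) = pair α (anchor q)

attribute [instance] AncPre.pre AncPre.acg AncPre.mod

namespace AncPre
variable {Y : DiffSpace.{u, v} 𝕂} (A : AncPre.{u, v, w, z, t} Y)

/-- The indices whose open set contains `y`. -/
abbrev At (y : Y.pt) : Type t := {i : A.I // y ∈ A.op i}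

instance (y : Y.pt) : Nonempty (A.At y) := ⟨⟨A.top, by rw [A.op_top]; trivial⟩⟩
instance (y : Y.pt) : IsDirectedOrder (A.At y) where
  directed i j := by
    obtain ⟨k, h, h', hy⟩ := A.dir y i.1 j.1 i.2 j.2
    exact ⟨⟨k, hy⟩, h, h'⟩
instance (y : Y.pt) : DirectedSystem (fun i : A.At y => A.P i.1)
    (fun i j (h : i ≤ j) => A.res (show i.1 ≤ j.1 from h)) where
  map_self _ x := A.res_self x
  map_map _ _ _ h h' x := A.res_res _ _ x

/-- The stalk at `y`. -/
abbrev Stalk (y : Y.pt) : Type _ :=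
  DirectLimit (fun i : A.At y => A.P i.1) (fun i j (h : i ≤ j) => A.res (show i.1 ≤ j.1 from h))

variable {A}

/-- The germ at `y` of an element. -/
def germ {i : A.I} (p : A.P i) (y : A.op i) : A.Stalk y := ⟦⟨⟨i, y.2⟩, p⟩⟧

theorem germ_res {i j : A.I} (h : i ≤ j) (p : A.P i) (y : A.op j) :
    germ (A.res h p) y = germ p ⟨y, A.op_mono h y.2⟩ :=
  Quotient.sound ⟨⟨j, y.2⟩, le_rfl, h, A.res_self _⟩

theorem exists_germ {y : Y.pt} (s : A.Stalk y) : ∃ (i : A.I) (hy : y ∈ A.op i) (p : A.P i),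
    s = germ p ⟨y, hy⟩ := by
  obtain ⟨i, p, rfl⟩ := DirectLimit.exists_eq_mk _ s
  exact ⟨i.1, i.2, p, rfl⟩

theorem exists_germ₂ {y : Y.pt} (s s' : A.Stalk y) : ∃ (i : A.I) (hy : y ∈ A.op i) (p p' : A.P i),
    s = germ p ⟨y, hy⟩ ∧ s' = germ p' ⟨y, hy⟩ := by
  obtain ⟨i, p, p', rfl, rfl⟩ := DirectLimit.exists_eq_mk₂ _ s s'
  exact ⟨i.1, i.2, p, p', rfl, rfl⟩

theorem germ_add {i : A.I} (p q : A.P i) (y : A.op i) : germ (p + q) y = germ p y + germ q y :=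
  (DirectLimit.add_def (G := fun i : A.At y => A.P i.1)
    (f := fun (i j : A.At y) (h : i ≤ j) => A.res (show i.1 ≤ j.1 from h))
    ⟨i, y.2⟩ p q).symm

theorem cut_le (i : A.I) (W : Opens Y.pt) : A.op (A.cut i W) ≤ W := by
  rw [A.op_cut]; exact inf_le_right

theorem mem_cut {i : A.I} {W : Opens Y.pt} {y : Y.pt} (hy : y ∈ A.op i) (hy' : y ∈ W) :
    y ∈ A.op (A.cut i W) := by
  rw [A.op_cut]; exact ⟨hy, hy'⟩

theorem exists_cut {i : A.I} {W : Opens Y.pt} {y : Y.pt} (hy : y ∈ A.op i) (hy' : y ∈ W) :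
    ∃ (j : A.I), i ≤ j ∧ A.op j ≤ W ∧ y ∈ A.op j :=
  ⟨A.cut i W, A.le_cut i W, cut_le i W, mem_cut hy hy'⟩

/-- Multiplication of germs by a function. -/
def smulS {W : Opens Y.pt} (f : Y.O W) (y : W) (s : A.Stalk y) : A.Stalk y :=
  DirectLimit.lift _ (fun i p => germ (resO (cut_le i.1 W) f • A.res (A.le_cut i.1 W) p)
    ⟨y.1, mem_cut i.2 y.2⟩) (fun i j h p => by
      obtain ⟨k, h₁, h₂, hy⟩ := A.dir y.1 (A.cut i.1 W) (A.cut j.1 W)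
        (mem_cut i.2 y.2) (mem_cut j.2 y.2)
      refine (germ_res h₁ _ ⟨y.1, hy⟩).symm.trans (Eq.trans ?_ (germ_res h₂ _ ⟨y.1, hy⟩))
      rw [A.res_smul, A.res_smul, A.res_res, A.res_res, A.res_res]
      rfl) s

theorem smulS_germ {W : Opens Y.pt} (f : Y.O W) {i : A.I} (h : A.op i ≤ W) (p : A.P i)
    (y : A.op i) : smulS f ⟨y.1, h y.2⟩ (germ p y) = germ (resO h f • p) y := by
  refine Eq.trans ?_ (germ_res (A.le_cut i W) _ ⟨y.1, mem_cut y.2 (h y.2)⟩)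
  rw [A.res_smul]
  rfl

/-- The anchor on germs. -/
def anchorS {y : Y.pt} (s : A.Stalk y) : Y.V y :=
  DirectLimit.lift _ (fun i p => (A.anchor p).1 ⟨y, i.2⟩) (fun i j h p => by
    rw [A.anchor_res]; rfl) s

theorem anchorS_germ {i : A.I} (p : A.P i) (y : A.op i) :
    anchorS (germ p y) = (A.anchor p).1 y := rfl

/-- The pairing on germs. -/
def pairingS {y : Y.pt} (s s' : A.Stalk y) : 𝕂 :=
  DirectLimit.lift₂ _ _ (fun i p p' => (A.pairing p p').1 ⟨y, i.2⟩) (fun i j h p p' => by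
    rw [A.pairing_res]; rfl) s s'

theorem pairingS_germ {i : A.I} (p p' : A.P i) (y : A.op i) :
    pairingS (germ p y) (germ p' y) = (A.pairing p p').1 y :=
  DirectLimit.lift₂_def ..

/-- The co-anchor with values in germs. -/
def coanchorS {W : Opens Y.pt} (α : Y.Ω W) (y : W) : A.Stalk y :=
  germ (A.coanchor (resΩ (cut_le A.top W) α))
    ⟨y.1, mem_cut (by rw [A.op_top]; trivial) y.2⟩

theorem coanchorS_eq {W : Opens Y.pt} (α : Y.Ω W) {i : A.I} (h : A.op i ≤ W) (y : A.op i) :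
    coanchorS (A := A) α ⟨y.1, h y.2⟩ = germ (A.coanchor (resΩ h α)) y := by
  obtain ⟨k, h₁, h₂, hy⟩ := A.dir y.1 (A.cut A.top W) i
    (mem_cut (by rw [A.op_top]; trivial) (h y.2)) y.2
  refine (germ_res h₁ _ ⟨y.1, hy⟩).symm.trans (Eq.trans ?_ (germ_res h₂ _ ⟨y.1, hy⟩))
  rw [← A.coanchor_res, ← A.coanchor_res]
  rfl

variable (A)

/-- The sections over `W`: families of germs that are locally germs of an element. -/
def secSub (W : Opens Y.pt) : AddSubgroup (∀ y : W, A.Stalk y) where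
  carrier := {s | ∀ y : W, ∃ (i : A.I) (_ : y.1 ∈ A.op i) (h : A.op i ≤ W) (p : A.P i),
    ∀ x : A.op i, s ⟨x, h x.2⟩ = germ p x}
  add_mem' {a b} ha hb y := by
    obtain ⟨i, hy, h, p, e⟩ := ha y
    obtain ⟨j, hy', h', q, e'⟩ := hb y
    obtain ⟨k, h₁, h₂, hk⟩ := A.dir y.1 i j hy hy'
    refine ⟨k, hk, (A.op_mono h₁).trans h, A.res h₁ p + A.res h₂ q, fun x => ?_⟩
    rw [germ_add, germ_res, germ_res, ← e, ← e']; rfl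
  zero_mem' y := by
    obtain ⟨i, -, h, hy⟩ := exists_cut (A := A) (i := A.top) (W := W) (y := y.1)
      (by rw [A.op_top]; trivial) y.2
    refine ⟨i, hy, h, 0, fun x => ?_⟩
    have := germ_add (A := A) (i := i) 0 0 x
    rw [add_zero, left_eq_add] at this
    exact this.symm
  neg_mem' {a} ha y := by
    obtain ⟨i, hy, h, p, e⟩ := ha y
    refine ⟨i, hy, h, -p, fun x => ?_⟩
    have := congrArg (- ·) (e x)
    refine this.trans ?_
    have h0 := germ_add (A := A) (i := i) 0 0 x
    rw [add_zero, left_eq_add] at h0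
    refine neg_eq_of_add_eq_zero_right ?_
    rw [← germ_add, add_neg_cancel, h0]

/-- The sections over `W`. -/
def Sec (W : Opens Y.pt) : Type _ := A.secSub W

instance (W : Opens Y.pt) : AddCommGroup (A.Sec W) := inferInstanceAs (AddCommGroup (A.secSub W))

variable {A}

theorem sec_ext {W : Opens Y.pt} {s s' : A.Sec W} (h : ∀ y : W, s.1 y = s'.1 y) : s = s' :=
  Subtype.ext (funext h)

/-- Restriction of sections. -/
def resS {W' W : Opens Y.pt} (h : W' ≤ W) : A.Sec W →+ A.Sec W' where
  toFun s := ⟨fun y => s.1 ⟨y, h y.2⟩, fun y => by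
    obtain ⟨i, hy, hi, p, e⟩ := s.2 ⟨y, h y.2⟩
    obtain ⟨j, hj, hjW, hyj⟩ := exists_cut hy y.2
    refine ⟨j, hyj, hjW, A.res hj p, fun x => ?_⟩
    rw [germ_res, ← e]⟩
  map_zero' := rfl
  map_add' _ _ := rfl

/-- The section defined by an element. -/
def toSec {i : A.I} (p : A.P i) : A.Sec (A.op i) :=
  ⟨germ p, fun y => ⟨i, y.2, le_rfl, p, fun _ => rfl⟩⟩

theorem resS_toSec {i j : A.I} (h : i ≤ j) (p : A.P i) :
    resS (A.op_mono h) (toSec p) = toSec (A.res h p) :=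
  sec_ext fun y => (germ_res h p y).symm

theorem local₁ {W : Opens Y.pt} (s : A.Sec W) {y : Y.pt} (hy : y ∈ W) :
    ∃ (i : A.I) (_ : y ∈ A.op i) (h : A.op i ≤ W) (p : A.P i), resS h s = toSec p := by
  obtain ⟨i, hy, h, p, e⟩ := s.2 ⟨y, hy⟩
  exact ⟨i, hy, h, p, sec_ext e⟩

theorem local₂ {W : Opens Y.pt} (s s' : A.Sec W) {y : Y.pt} (hy : y ∈ W) :
    ∃ (i : A.I) (_ : y ∈ A.op i) (h : A.op i ≤ W) (p p' : A.P i),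
      resS h s = toSec p ∧ resS h s' = toSec p' := by
  obtain ⟨i, hi, h, p, e⟩ := local₁ s hy
  obtain ⟨i', hi', h', p', e'⟩ := local₁ s' hy
  obtain ⟨k, h₁, h₂, hk⟩ := A.dir y i i' hi hi'
  refine ⟨k, hk, (A.op_mono h₁).trans h, A.res h₁ p, A.res h₂ p', ?_, ?_⟩
  · rw [← resS_toSec, ← e]; rfl
  · rw [← resS_toSec, ← e']; rfl

theorem local₃ {W : Opens Y.pt} (s s' s'' : A.Sec W) {y : Y.pt} (hy : y ∈ W) :
    ∃ (i : A.I) (_ : y ∈ A.op i) (h : A.op i ≤ W) (p p' p'' : A.P i),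
      resS h s = toSec p ∧ resS h s' = toSec p' ∧ resS h s'' = toSec p'' := by
  obtain ⟨i, hi, h, p, p', e, e'⟩ := local₂ s s' hy
  obtain ⟨i', hi', h', p'', e''⟩ := local₁ s'' hy
  obtain ⟨k, h₁, h₂, hk⟩ := A.dir y i i' hi hi'
  refine ⟨k, hk, (A.op_mono h₁).trans h, A.res h₁ p, A.res h₁ p', A.res h₂ p'', ?_, ?_, ?_⟩
  · rw [← resS_toSec, ← e]; rfl
  · rw [← resS_toSec, ← e']; rfl
  · rw [← resS_toSec, ← e'']; rfl

theorem sec_eq {W : Opens Y.pt} {s s' : A.Sec W} (H : ∀ y ∈ W, ∃ (W' : Opens Y.pt) (h : W' ≤ W),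
    y ∈ W' ∧ resS h s = resS h s') : s = s' := sec_ext fun y => by
  obtain ⟨W', h, hy, e⟩ := H y y.2
  exact congrArg (fun a : A.Sec W' => a.1 ⟨y, hy⟩) e

instance (W : Opens Y.pt) : SMul (Y.O W) (A.Sec W) where
  smul f s := ⟨fun y => smulS f y (s.1 y), fun y => by
    obtain ⟨i, hy, hi, p, e⟩ := s.2 y
    refine ⟨i, hy, hi, resO hi f • p, fun x => ?_⟩
    exact (congrArg (smulS f _) (e x)).trans (smulS_germ f hi p x)⟩

theorem resS_smul {W' W : Opens Y.pt} (h : W' ≤ W) (f : Y.O W) (s : A.Sec W) :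
    resS h (f • s) = resO h f • resS h s := sec_ext fun y => by
  obtain ⟨i, hy, hi, p, e⟩ := s.2 ⟨y, h y.2⟩
  obtain ⟨j, hj, hjW, hyj⟩ := exists_cut hy y.2
  change smulS f ⟨y, h y.2⟩ (s.1 ⟨y, h y.2⟩) = smulS (resO h f) y (s.1 ⟨y, h y.2⟩)
  have e' : s.1 ⟨y, h y.2⟩ = germ (A.res hj p) ⟨y, hyj⟩ := by rw [germ_res, ← e]
  rw [e']
  exact (smulS_germ f (hjW.trans h) _ ⟨y.1, hyj⟩).trans (smulS_germ (resO h f) hjW _ ⟨y.1, hyj⟩).symm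

theorem smul_toSec {i : A.I} (f : Y.O (A.op i)) (p : A.P i) : f • toSec p = toSec (f • p) :=
  sec_ext fun y => smulS_germ f le_rfl p y

theorem toSec_add {i : A.I} (p q : A.P i) : toSec (p + q) = toSec p + toSec q :=
  sec_ext fun y => germ_add p q y

theorem toSec_zero {i : A.I} : toSec (0 : A.P i) = 0 := by
  have := toSec_add (0 : A.P i) 0
  rwa [add_zero, left_eq_add] at this

instance (W : Opens Y.pt) : Module (Y.O W) (A.Sec W) where
  one_smul s := sec_eq fun y hy => by
    obtain ⟨i, hi, h, p, e⟩ := local₁ s hy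
    exact ⟨_, h, hi, by rw [resS_smul, e, smul_toSec, map_one, one_smul]⟩
  mul_smul f g s := sec_eq fun y hy => by
    obtain ⟨i, hi, h, p, e⟩ := local₁ s hy
    exact ⟨_, h, hi, by
      rw [resS_smul, resS_smul, resS_smul, e, smul_toSec, smul_toSec, smul_toSec, map_mul, mul_smul]⟩
  smul_zero f := sec_eq fun y hy => by
    obtain ⟨i, hi, h, p, e⟩ := local₁ (0 : A.Sec W) hy
    exact ⟨_, h, hi, by
      rw [resS_smul, map_zero, ← toSec_zero, smul_toSec, smul_zero]⟩
  smul_add f s s' := sec_eq fun y hy => by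
    obtain ⟨i, hi, h, p, p', e, e'⟩ := local₂ s s' hy
    exact ⟨_, h, hi, by
      rw [resS_smul, map_add, map_add, resS_smul, resS_smul, e, e', ← toSec_add, smul_toSec,
        smul_toSec, smul_toSec, ← toSec_add, smul_add]⟩
  add_smul f g s := sec_eq fun y hy => by
    obtain ⟨i, hi, h, p, e⟩ := local₁ s hy
    exact ⟨_, h, hi, by
      rw [resS_smul, map_add (resS h), resS_smul, resS_smul, e, smul_toSec, smul_toSec, smul_toSec,
        ← toSec_add, map_add, add_smul]⟩
  zero_smul s := sec_eq fun y hy => by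
    obtain ⟨i, hi, h, p, e⟩ := local₁ s hy
    exact ⟨_, h, hi, by rw [resS_smul, e, smul_toSec, map_zero, zero_smul, toSec_zero, map_zero]⟩

/-- The anchor of a section. -/
def anchorF {W : Opens Y.pt} (s : A.Sec W) : Y.T W :=
  ⟨fun y => anchorS (s.1 y), T_of_local _ fun y hy => by
    obtain ⟨i, hy, hi, p, e⟩ := s.2 ⟨y, hy⟩
    exact ⟨_, hi, hy, A.anchor p, fun x => by rw [e, anchorS_germ]⟩⟩

theorem resT_anchorF {W' W : Opens Y.pt} (h : W' ≤ W) (s : A.Sec W) :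
    anchorF (resS h s) = resT h (anchorF s) := rfl
theorem anchorF_toSec {i : A.I} (p : A.P i) : anchorF (toSec p) = A.anchor p := rfl

/-- The pairing of sections. -/
def pairingF {W : Opens Y.pt} (s s' : A.Sec W) : Y.O W :=
  ⟨fun y => pairingS (s.1 y) (s'.1 y), O_of_local _ fun y hy => by
    obtain ⟨i, hi, h, p, p', e, e'⟩ := local₂ s s' hy
    refine ⟨_, h, hi, A.pairing p p', fun x => ?_⟩
    refine Eq.trans ?_ (pairingS_germ p p' x)
    exact congrArg₂ (fun a b : A.Sec (A.op i) => pairingS (a.1 x) (b.1 x)) e e'⟩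

theorem resO_pairingF {W' W : Opens Y.pt} (h : W' ≤ W) (s s' : A.Sec W) :
    pairingF (resS h s) (resS h s') = resO h (pairingF s s') := rfl
theorem pairingF_toSec {i : A.I} (p p' : A.P i) :
    pairingF (toSec p) (toSec p') = A.pairing p p' := O_ext fun y => pairingS_germ p p' y

/-- The co-anchor. -/
def coanchorF {W : Opens Y.pt} (α : Y.Ω W) : A.Sec W :=
  ⟨fun y => coanchorS α y, fun y => by
    obtain ⟨i, -, h, hy⟩ := exists_cut (A := A) (i := A.top) (W := W) (y := y.1)
      (by rw [A.op_top]; trivial) y.2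
    exact ⟨i, hy, h, A.coanchor (resΩ h α), fun x => coanchorS_eq α h x⟩⟩

theorem coanchorF_toSec {W : Opens Y.pt} (α : Y.Ω W) {i : A.I} (h : A.op i ≤ W) :
    resS h (coanchorF α) = toSec (A.coanchor (resΩ h α)) :=
  sec_ext fun y => coanchorS_eq α h y

theorem coanchorF_toSec' {i : A.I} (α : Y.Ω (A.op i)) :
    coanchorF α = toSec (A.coanchor α) := coanchorF_toSec α le_rfl

theorem exists_idx {W : Opens Y.pt} {y : Y.pt} (hy : y ∈ W) :
    ∃ (i : A.I), A.op i ≤ W ∧ y ∈ A.op i := by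
  obtain ⟨i, -, h⟩ := exists_cut (A := A) (i := A.top) (W := W) (y := y)
    (by rw [A.op_top]; trivial) hy
  exact ⟨i, h⟩

theorem resS_coanchorF {W' W : Opens Y.pt} (h : W' ≤ W) (α : Y.Ω W) :
    resS h (coanchorF (A := A) α) = coanchorF (resΩ h α) := sec_eq fun y hy => by
  obtain ⟨i, hi, hy⟩ := exists_idx (A := A) hy
  refine ⟨_, hi, hy, ?_⟩
  rw [coanchorF_toSec, ← coanchorF_toSec' , resΩ_resΩ, coanchorF_toSec', ← coanchorF_toSec α (hi.trans h)]
  rfl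

theorem T_eq_of_local {W : Opens Y.pt} {ξ η : Y.T W}
    (H : ∀ x ∈ W, ∃ (W' : Opens Y.pt) (h : W' ≤ W), x ∈ W' ∧ resT h ξ = resT h η) : ξ = η :=
  T_ext' fun x => by
    obtain ⟨W', h, hx, e⟩ := H x x.2
    exact congrArg (fun k : Y.T W' => k.1 ⟨x, hx⟩) e

theorem O_eq_local {W : Opens Y.pt} {ξ η : Y.O W}
    (H : ∀ x ∈ W, ∃ (W' : Opens Y.pt) (h : W' ≤ W), x ∈ W' ∧ resO h ξ = resO h η) : ξ = η :=
  O_ext fun x => by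
    obtain ⟨W', h, hx, e⟩ := H x x.2
    exact congrArg (fun k : Y.O W' => k.1 ⟨x, hx⟩) e

theorem pairingF_symm {W : Opens Y.pt} (s s' : A.Sec W) : pairingF s s' = pairingF s' s :=
  O_eq_local fun y hy => by
    obtain ⟨i, hi, h, p, p', e, e'⟩ := local₂ s s' hy
    exact ⟨_, h, hi, by
      rw [← resO_pairingF, ← resO_pairingF, e, e', pairingF_toSec, pairingF_toSec, A.pairing_symm]⟩

theorem pairingF_add {W : Opens Y.pt} (s s' s'' : A.Sec W) :
    pairingF s (s' + s'') = pairingF s s' + pairingF s s'' :=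
  O_eq_local fun y hy => by
    obtain ⟨i, hi, h, p, p', p'', e, e', e''⟩ := local₃ s s' s'' hy
    exact ⟨_, h, hi, by
      rw [map_add, ← resO_pairingF, ← resO_pairingF, ← resO_pairingF, map_add, e, e', e'',
        ← toSec_add, pairingF_toSec, pairingF_toSec, pairingF_toSec, map_add]⟩

theorem pairingF_smul {W : Opens Y.pt} (f : Y.O W) (s s' : A.Sec W) :
    pairingF s (f • s') = f * pairingF s s' :=
  O_eq_local fun y hy => by
    obtain ⟨i, hi, h, p, p', e, e'⟩ := local₂ s s' hy
    exact ⟨_, h, hi, by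
      rw [map_mul, ← resO_pairingF, ← resO_pairingF, resS_smul, e, e',
        smul_toSec, pairingF_toSec, pairingF_toSec, map_smul, smul_eq_mul]⟩

theorem anchorF_add {U : Opens Y.pt} (s s' : A.Sec U) :
    anchorF (s + s') = anchorF s + anchorF s' := T_eq_of_local fun y hy => by
  obtain ⟨i, hi, h, p, p', e, e'⟩ := local₂ s s' hy
  exact ⟨_, h, hi, by
    rw [map_add, ← resT_anchorF, ← resT_anchorF, ← resT_anchorF, map_add, e, e', ← toSec_add,
      anchorF_toSec, anchorF_toSec, anchorF_toSec, map_add]⟩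

theorem anchorF_smul {U : Opens Y.pt} (f : Y.O U) (s : A.Sec U) :
    anchorF (f • s) = f • anchorF s := T_eq_of_local fun y hy => by
  obtain ⟨i, hi, h, p, e⟩ := local₁ s hy
  exact ⟨_, h, hi, by
    rw [resT_smul, ← resT_anchorF, ← resT_anchorF, resS_smul, e, smul_toSec, anchorF_toSec,
      anchorF_toSec, map_smul]⟩

theorem coanchorF_add {U : Opens Y.pt} (α α' : Y.Ω U) :
    coanchorF (A := A) (α + α') = coanchorF α + coanchorF α' := sec_eq fun y hy => by
  obtain ⟨i, hi, hy⟩ := exists_idx (A := A) hy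
  exact ⟨_, hi, hy, by
    rw [map_add (resS hi), coanchorF_toSec, coanchorF_toSec, coanchorF_toSec, map_add, map_add,
      toSec_add]⟩

theorem coanchorF_smul {U : Opens Y.pt} (f : Y.O U) (α : Y.Ω U) :
    coanchorF (A := A) (f • α) = f • coanchorF α := sec_eq fun y hy => by
  obtain ⟨i, hi, hy⟩ := exists_idx (A := A) hy
  exact ⟨_, hi, hy, by
    rw [resS_smul, coanchorF_toSec, coanchorF_toSec, smul_toSec, resΩ_smul, map_smul]⟩

theorem anchorF_coanchorF {U : Opens Y.pt} (α : Y.Ω U) : anchorF (coanchorF (A := A) α) = 0 :=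
  T_eq_of_local fun y hy => by
    obtain ⟨i, hi, hy⟩ := exists_idx (A := A) hy
    refine ⟨_, hi, hy, ?_⟩
    rw [← resT_anchorF, coanchorF_toSec, anchorF_toSec, A.anchor_coanchor, map_zero]

theorem pairingF_coanchorF {U : Opens Y.pt} (s : A.Sec U) (α : Y.Ω U) :
    pairingF s (coanchorF α) = pair α (anchorF s) := O_eq_local fun y hy => by
  obtain ⟨i, hi, h, p, e⟩ := local₁ s hy
  refine ⟨_, h, hi, ?_⟩
  rw [← resO_pairingF, e, coanchorF_toSec, pairingF_toSec, A.adjunction, res_pair,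
    ← resT_anchorF, e, anchorF_toSec]

theorem add_pairingF {W : Opens Y.pt} (s s' s'' : A.Sec W) :
    pairingF (s + s') s'' = pairingF s s'' + pairingF s' s'' := by
  rw [pairingF_symm, pairingF_add, pairingF_symm s'', pairingF_symm s'']

theorem smul_pairingF {W : Opens Y.pt} (f : Y.O W) (s s' : A.Sec W) :
    pairingF (f • s) s' = f * pairingF s s' := by
  rw [pairingF_symm, pairingF_smul, pairingF_symm s']

variable (A)

/-- The underlying sheaf of modules of the generated sheaf. -/
def modSheaf : ModSheaf Y where
  sec := A.Sec
  res := resS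
  res_self _ := rfl
  res_res _ _ _ := rfl
  res_smul := resS_smul
  separated _ _ H := sec_eq H
  glue {ι} W s H := by
    have key : ∀ (i j : ι) (y : Y.pt) (hi : y ∈ W i) (hj : y ∈ W j),
        (s i).1 ⟨y, hi⟩ = (s j).1 ⟨y, hj⟩ := fun i j y hi hj =>
      congrArg (fun a : A.Sec (W i ⊓ W j) => a.1 ⟨y, hi, hj⟩) (H i j)
    have hex : ∀ y : (⨆ i, W i : Opens Y.pt), ∃ i, y.1 ∈ W i := fun y => Opens.mem_iSup.1 y.2
    choose c hc using hex
    refine ⟨⟨fun y => (s (c y)).1 ⟨y, hc y⟩, fun y => ?_⟩, fun i => sec_ext fun y => key _ _ _ _ _⟩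
    obtain ⟨k, hy, hk, p, e⟩ := (s (c y)).2 ⟨y, hc y⟩
    refine ⟨k, hy, hk.trans (le_iSup W (c y)), p, fun x => ?_⟩
    rw [← e]
    exact key _ _ _ _ _

/-- The generated sheaf. -/
def sheaf : AnchoredSheaf Y where
  toModSheaf := A.modSheaf
  anchor {U} := (⟨⟨anchorF, anchorF_add⟩, anchorF_smul⟩ : A.Sec U →ₗ[Y.O U] Y.T U)
  coanchor {U} := (⟨⟨coanchorF, coanchorF_add⟩, coanchorF_smul⟩ : Y.Ω U →ₗ[Y.O U] A.Sec U)
  pairing {U} := (LinearMap.mk₂ (Y.O U) pairingF add_pairingF smul_pairingF pairingF_add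
    pairingF_smul : A.Sec U →ₗ[Y.O U] A.Sec U →ₗ[Y.O U] Y.O U)
  anchor_res _ _ := rfl
  coanchor_res h α := (resS_coanchorF h α).symm
  pairing_res _ _ _ := rfl
  pairing_symm := pairingF_symm
  anchor_coanchor := anchorF_coanchorF
  adjunction := pairingF_coanchorF

end AncPre

/-- A bracket on such a system. -/
structure CouPre (Y : DiffSpace.{u, v} 𝕂) extends AncPre.{u, v, w, z, t} Y where
  br : ∀ {i}, P i → P i → P i
  br_add : ∀ {i} (q p p' : P i), br q (p + p') = br q p + br q p'
  add_br : ∀ {i} (q q' p : P i), br (q + q') p = br q p + br q' p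
  br_res : ∀ {i j} (h : i ≤ j) (q p : P i), br (res h q) (res h p) = res h (br q p)
  jacobi : ∀ {i} (q p r : P i), br q (br p r) = br (br q p) r + br p (br q r)
  anchor_br : ∀ {i} (q p : P i), anchor (br q p) = lb (anchor q) (anchor p)
  leibniz : ∀ {i} (q p : P i) (f : Y.O (op i)), br q (f • p) = f • br q p + act (anchor q) f • p
  invariance : ∀ {i} (q q₁ q₂ : P i),
    pairing (br q q₁) q₂ + pairing q₁ (br q q₂) = act (anchor q) (pairing q₁ q₂)
  br_coanchor : ∀ {i} (q : P i) (α : Y.Ω (op i)), br q (coanchor α) = coanchor (lie (anchor q) α)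
  symmetrizer : ∀ {i} (q p : P i), br q p + br p q = coanchor (dO (pairing q p))

namespace CouPre
open AncPre
variable {Y : DiffSpace.{u, v} 𝕂} (A : CouPre.{u, v, w, z, t} Y)

variable {A} in
/-- The bracket of germs. -/
def brS {y : Y.pt} (s s' : A.Stalk y) : A.Stalk y :=
  DirectLimit.map₂ _ _ _ (fun i p p' => A.br p p') (fun i j h p p' => (A.br_res _ p p').symm) s s'

variable {A} in
theorem brS_germ {i : A.I} (p p' : A.P i) (y : A.op i) :
    brS (germ p y) (germ p' y) = germ (A.br p p') y :=
  DirectLimit.map₂_def ..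

variable {A} in
/-- The bracket of sections. -/
def brF {W : Opens Y.pt} (s s' : A.Sec W) : A.Sec W :=
  ⟨fun y => brS (s.1 y) (s'.1 y), fun y => by
    obtain ⟨i, hi, h, p, p', e, e'⟩ := local₂ s s' y.2
    refine ⟨i, hi, h, A.br p p', fun x => ?_⟩
    refine Eq.trans ?_ (brS_germ p p' x)
    exact congrArg₂ (fun a b : A.Sec (A.op i) => brS (a.1 x) (b.1 x)) e e'⟩

variable {A} in
theorem resS_brF {W' W : Opens Y.pt} (h : W' ≤ W) (s s' : A.Sec W) :
    brF (resS h s) (resS h s') = resS h (brF s s') := rfl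
variable {A} in
theorem brF_toSec {i : A.I} (p p' : A.P i) :
    brF (toSec p) (toSec p') = toSec (A.br p p') := sec_ext fun y => brS_germ p p' y

variable {A}

theorem brF_add {U : Opens Y.pt} (s s' s'' : A.Sec U) : brF s (s' + s'') = brF s s' + brF s s'' :=
  sec_eq fun y hy => by
    obtain ⟨i, hi, h, p, p', p'', e, e', e''⟩ := local₃ s s' s'' hy
    exact ⟨_, h, hi, by
      rw [map_add, ← resS_brF, ← resS_brF, ← resS_brF, map_add, e, e', e'', ← toSec_add,
        brF_toSec, brF_toSec, brF_toSec, A.br_add, toSec_add]⟩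

theorem add_brF {U : Opens Y.pt} (s s' s'' : A.Sec U) : brF (s + s') s'' = brF s s'' + brF s' s'' :=
  sec_eq fun y hy => by
    obtain ⟨i, hi, h, p, p', p'', e, e', e''⟩ := local₃ s s' s'' hy
    exact ⟨_, h, hi, by
      rw [map_add, ← resS_brF, ← resS_brF, ← resS_brF, map_add, e, e', e'', ← toSec_add,
        brF_toSec, brF_toSec, brF_toSec, A.add_br, toSec_add]⟩

theorem brF_brF {U : Opens Y.pt} (s s' s'' : A.Sec U) :
    brF s (brF s' s'') = brF (brF s s') s'' + brF s' (brF s s'') :=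
  sec_eq fun y hy => by
    obtain ⟨i, hi, h, p, p', p'', e, e', e''⟩ := local₃ s s' s'' hy
    refine ⟨_, h, hi, ?_⟩
    simp only [map_add, ← resS_brF, e, e', e'', brF_toSec]
    rw [A.jacobi, toSec_add]

theorem anchorF_brF {U : Opens Y.pt} (s s' : A.Sec U) :
    anchorF (brF s s') = lb (anchorF s) (anchorF s') := T_eq_of_local fun y hy => by
  obtain ⟨i, hi, h, p, p', e, e'⟩ := local₂ s s' hy
  refine ⟨_, h, hi, ?_⟩
  rw [res_lb, ← resT_anchorF, ← resT_anchorF, ← resT_anchorF, ← resS_brF, e, e', brF_toSec,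
    anchorF_toSec, anchorF_toSec, anchorF_toSec, A.anchor_br]

theorem brF_smul {U : Opens Y.pt} (s s' : A.Sec U) (f : Y.O U) :
    brF s (f • s') = f • brF s s' + act (anchorF s) f • s' := sec_eq fun y hy => by
  obtain ⟨i, hi, h, p, p', e, e'⟩ := local₂ s s' hy
  refine ⟨_, h, hi, ?_⟩
  rw [map_add, resS_smul, resS_smul, ← resS_brF, ← resS_brF, resS_smul, res_act, ← resT_anchorF,
    e, e', smul_toSec, brF_toSec, brF_toSec, anchorF_toSec, A.leibniz, toSec_add, smul_toSec,
    smul_toSec]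

theorem brF_invariance {U : Opens Y.pt} (s s' s'' : A.Sec U) :
    pairingF (brF s s') s'' + pairingF s' (brF s s'') = act (anchorF s) (pairingF s' s'') :=
  O_eq_local fun y hy => by
    obtain ⟨i, hi, h, p, p', p'', e, e', e''⟩ := local₃ s s' s'' hy
    refine ⟨_, h, hi, ?_⟩
    rw [map_add, ← resO_pairingF, ← resO_pairingF, res_act, ← resO_pairingF, ← resT_anchorF,
      ← resS_brF, ← resS_brF, e, e', e'', brF_toSec, brF_toSec, pairingF_toSec, pairingF_toSec,
      pairingF_toSec, A.invariance, anchorF_toSec]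

theorem brF_coanchorF {U : Opens Y.pt} (s : A.Sec U) (α : Y.Ω U) :
    brF s (coanchorF α) = coanchorF (lie (anchorF s) α) := sec_eq fun y hy => by
  obtain ⟨i, hi, h, p, e⟩ := local₁ s hy
  refine ⟨_, h, hi, ?_⟩
  rw [← resS_brF, coanchorF_toSec, coanchorF_toSec, e, res_lie, ← resT_anchorF, e, brF_toSec,
    A.br_coanchor, anchorF_toSec]

theorem brF_symmetrizer {U : Opens Y.pt} (s s' : A.Sec U) :
    brF s s' + brF s' s = coanchorF (dO (pairingF s s')) := sec_eq fun y hy => by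
  obtain ⟨i, hi, h, p, p', e, e'⟩ := local₂ s s' hy
  refine ⟨_, h, hi, ?_⟩
  rw [map_add, coanchorF_toSec, res_dO, ← resO_pairingF, ← resS_brF, ← resS_brF, e, e',
    brF_toSec, brF_toSec, pairingF_toSec, ← A.symmetrizer, toSec_add]

variable (A)

/-- The generated sheaf with its bracket. -/
def sheafC : CourantAlgebroid Y where
  toAnchoredSheaf := A.sheaf
  bracket {U} := (AddMonoidHom.mk' (fun s => AddMonoidHom.mk' (fun s' => brF s s') (brF_add s))
    (fun s s' => AddMonoidHom.ext (add_brF s s')) : A.Sec U →+ A.Sec U →+ A.Sec U)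
  bracket_res _ _ _ := rfl
  jacobi := brF_brF
  anchor_bracket := anchorF_brF
  leibniz := brF_smul
  invariance := brF_invariance
  bracket_coanchor := brF_coanchorF
  symmetrizer := brF_symmetrizer

end CouPre
end DiffSpace


namespace DiffSpace
open Hom
variable {𝕂 : Type w} [Field 𝕂] {Y : DiffSpace.{u', v'} 𝕂} {X : DiffSpace.{u, v} 𝕂}
namespace Pull
variable {f : Hom Y X} {U : Opens X.pt} {V : Opens Y.pt}

section anchored
variable (Q : AnchoredSheaf.{u, v, w, z} X) (h : V ≤ f.pre U)

/-- The relations, as a submodule of the fibre product. -/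
abbrev ZN : Submodule (Y.O V) (N Q h) := (Z Q h).comap (N Q h).subtype

/-- The quotient of the fibre product by the relations. -/
abbrev P : Type _ := N Q h ⧸ ZN Q h

variable {Q}

theorem Z_snd {m : M U V Q} (hm : m ∈ Z Q h) : m.2.2 = 0 := by
  induction hm using Z_ind with
  | h0 => rfl
  | h1 g q => rfl
  | h2 γ => rfl
  | h3 a b _ _ ha hb =>
    change a.2.2 + b.2.2 = 0
    rw [ha, hb, add_zero]
  | h4 c a _ ha =>
    change c • a.2.2 = 0
    rw [ha, smul_zero]

section res
variable {U' : Opens X.pt} {V' : Opens Y.pt} (h' : V' ≤ f.pre U') (hU : U' ≤ U) (hV : V' ≤ V)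

/-- Restriction. -/
def resN : N Q h →ₛₗ[(resO hV : Y.O V →ₐ[𝕂] Y.O V').toRingHom] N Q h' where
  toFun n := ⟨resM hU hV n.1, resM_N h h' hU hV n.2⟩
  map_add' a b := Subtype.ext (map_add _ _ _)
  map_smul' c a := Subtype.ext (resM_smul hU hV c a.1)

/-- Restriction. -/
def resP : P Q h →ₛₗ[(resO hV : Y.O V →ₐ[𝕂] Y.O V').toRingHom] P Q h' :=
  Submodule.mapQ _ _ (resN h h' hU hV) fun _ hz => resM_Z h h' hU hV hz

end res

/-- The anchor `(α, t, ξ) ↦ ξ`. -/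
def anchorP : P Q h →ₗ[Y.O V] Y.T V :=
  Submodule.liftQ _ ((LinearMap.snd _ _ _ ∘ₗ LinearMap.snd _ _ _) ∘ₗ (N Q h).subtype)
    fun _ hz => Z_snd h hz

theorem co_mem (α : Y.Ω V) : ((α, 0, 0) : M U V Q) ∈ N Q h := fun y => by
  change f.tan y 0 = rho Q h 0 y
  rw [map_zero, map_zero]; rfl

/-- The co-anchor `α ↦ (α, 0, 0)`. -/
def coanchorP : Y.Ω V →ₗ[Y.O V] P Q h :=
  Submodule.mkQ _ ∘ₗ (LinearMap.inl _ _ _).codRestrict (N Q h) (co_mem h)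

/-- The pairing. -/
def pairingP : P Q h →ₗ[Y.O V] P Q h →ₗ[Y.O V] Y.O V :=
  Submodule.liftQ _
    { toFun := fun n => Submodule.liftQ _ (bp h n.1 ∘ₗ (N Q h).subtype) fun m hm => bp_Z h n.2 hm
      map_add' := fun n n' => by
        ext m
        exact (bp h).map_add₂ n.1 n'.1 m.1
      map_smul' := fun c n => by
        ext m
        exact (bp h).map_smul₂ c n.1 m.1 }
    fun n hn => by
      rw [LinearMap.mem_ker]
      ext m
      exact (bp_symm h n.1 m.1).trans (bp_Z h m.2 hn)

end anchored

section courant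
variable {Q : CourantAlgebroid.{u, v, w, z} X} (h : V ≤ f.pre U)

/-- The bracket. -/
def brP (x y : P Q.toAnchoredSheaf h) : P Q.toAnchoredSheaf h :=
  Quotient.map₂ (fun a b : N Q.toAnchoredSheaf h => (⟨br h a.1 b.1, br_N h a.2 b.2⟩ : N _ h))
    (fun a a' ha b b' hb => by
      have ha := (Submodule.quotientRel_def _).1 ha
      have hb := (Submodule.quotientRel_def _).1 hb
      refine (Submodule.quotientRel_def _).2 ?_
      change br h a.1 b.1 - br h a'.1 b'.1 ∈ Z _ h
      have e : br h a.1 b.1 - br h a'.1 b'.1 = br h (a.1 - a'.1) b.1 + br h a'.1 (b.1 - b'.1) := by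
        have e1 := add_br h (a.1 - a'.1) a'.1 b.1
        have e2 := br_add h a'.1 (b.1 - b'.1) b'.1
        rw [sub_add_cancel] at e1 e2
        rw [e1, e2]; abel
      rw [e]
      exact add_mem (Z_br h b.2 ha) (br_Z h a'.2 hb)) x y

theorem brP_mk (x y : N Q.toAnchoredSheaf h) :
    brP h (Submodule.Quotient.mk x) (Submodule.Quotient.mk y) =
      Submodule.Quotient.mk ⟨br h x.1 y.1, br_N h x.2 y.2⟩ := rfl

end courant

variable (f)

/-- Pairs of an open set `V` of `Y` and an open set `U` of `X` with `f(V) ⊆ U`. -/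
structure Idx where
  V : Opens Y.pt
  U : Opens X.pt
  le : V ≤ f.pre U

instance : Preorder (Idx f) where
  le i j := j.V ≤ i.V ∧ j.U ≤ i.U
  le_refl _ := ⟨le_rfl, le_rfl⟩
  le_trans _ _ _ h h' := ⟨h'.1.trans h.1, h'.2.trans h.2⟩

variable {f} in
theorem Idx.leV {i j : Idx f} (h : i ≤ j) : j.V ≤ i.V := h.1
variable {f} in
theorem Idx.leU {i j : Idx f} (h : i ≤ j) : j.U ≤ i.U := h.2
variable {f} in
theorem Idx.mk_le {i j : Idx f} (h : j.V ≤ i.V) (h' : j.U ≤ i.U) : i ≤ j := ⟨h, h'⟩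

/-- The system of the modules `P` for all pairs of open sets. -/
def ancPre (Q : AnchoredSheaf.{u, v, w, z} X) : AncPre Y where
  I := Idx f
  op i := i.V
  op_mono h := Idx.leV h
  dir y i j hi hj := ⟨⟨i.V ⊓ j.V, i.U ⊓ j.U, fun y hy => ⟨i.le hy.1, j.le hy.2⟩⟩,
    Idx.mk_le inf_le_left inf_le_left, Idx.mk_le inf_le_right inf_le_right, hi, hj⟩
  cut i W := ⟨i.V ⊓ W, i.U, inf_le_left.trans i.le⟩
  le_cut i W := Idx.mk_le inf_le_left le_rfl
  op_cut i W := rfl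
  top := ⟨⊤, ⊤, fun _ _ => trivial⟩
  op_top := rfl
  P i := P Q i.le
  acg i := inferInstanceAs (AddCommGroup (P Q i.le))
  mod i := inferInstanceAs (Module (Y.O i.V) (P Q i.le))
  res {i j} h := (resP i.le j.le (Idx.leU h) (Idx.leV h)).toAddMonoidHom
  res_self {i} p := by
    induction p using Submodule.Quotient.induction_on with
    | _ n =>
      refine congrArg Submodule.Quotient.mk (Subtype.ext (Prod.ext rfl (Prod.ext ?_ rfl)))
      change resTen _ _ n.1.2.1 = n.1.2.1
      induction n.1.2.1 using ten_ind with
      | h0 => simp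
      | h1 g q => rw [resTen_tmul, Q.res_self, resO_self]
      | h2 a b ha hb => rw [map_add, ha, hb]
  res_res {i j k} h h' p := by
    induction p using Submodule.Quotient.induction_on with
    | _ n =>
      refine congrArg Submodule.Quotient.mk (Subtype.ext (Prod.ext rfl (Prod.ext ?_ rfl)))
      change resTen _ _ (resTen _ _ n.1.2.1) = resTen _ _ n.1.2.1
      induction n.1.2.1 using ten_ind with
      | h0 => simp
      | h1 g q => rw [resTen_tmul, resTen_tmul, resTen_tmul, Q.res_res, resO_resO]
      | h2 a b ha hb => rw [map_add, map_add, map_add, ha, hb]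
  res_smul {i j} h c p := (resP i.le j.le (Idx.leU h) (Idx.leV h)).map_smulₛₗ c p
  anchor {i} := anchorP i.le
  coanchor {i} := coanchorP i.le
  pairing {i} := pairingP i.le
  anchor_res {i j} h p := by
    induction p using Submodule.Quotient.induction_on with
    | _ n => rfl
  coanchor_res {i j} h α := by
    refine congrArg Submodule.Quotient.mk (Subtype.ext (Prod.ext rfl (Prod.ext ?_ rfl)))
    exact (map_zero (resTen (Idx.leU h) (Idx.leV h))).symm
  pairing_res {i j} h p q := by
    induction p using Submodule.Quotient.induction_on with
    | _ n =>
      induction q using Submodule.Quotient.induction_on with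
      | _ m => exact res_bp i.le j.le (Idx.leU h) (Idx.leV h) n.1 m.1
  pairing_symm {i} p q := by
    induction p using Submodule.Quotient.induction_on with
    | _ n =>
      induction q using Submodule.Quotient.induction_on with
      | _ m => exact bp_symm i.le n.1 m.1
  anchor_coanchor _ := rfl
  adjunction {i} p α := by
    induction p using Submodule.Quotient.induction_on with
    | _ n =>
      change pair n.1.1 (0 : Y.T _) + pair α n.1.2.2 + tp Q i.le n.1.2.1 0 = pair α n.1.2.2
      rw [pair_zero, map_zero]; ring

/-- The system of the modules `P` with their brackets. -/
def couPre (Q : CourantAlgebroid.{u, v, w, z} X) : CouPre Y where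
  toAncPre := ancPre f Q.toAnchoredSheaf
  br {i} := brP (Q := Q) i.le
  br_add {i} p q r := by
    induction p using Submodule.Quotient.induction_on with
    | _ a =>
      induction q using Submodule.Quotient.induction_on with
      | _ b =>
        induction r using Submodule.Quotient.induction_on with
        | _ c => exact congrArg Submodule.Quotient.mk (Subtype.ext (br_add i.le a.1 b.1 c.1))
  add_br {i} p q r := by
    induction p using Submodule.Quotient.induction_on with
    | _ a =>
      induction q using Submodule.Quotient.induction_on with
      | _ b =>
        induction r using Submodule.Quotient.induction_on with
        | _ c => exact congrArg Submodule.Quotient.mk (Subtype.ext (add_br i.le a.1 b.1 c.1))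
  br_res {i j} h p q := by
    induction p using Submodule.Quotient.induction_on with
    | _ a =>
      induction q using Submodule.Quotient.induction_on with
      | _ b => exact congrArg Submodule.Quotient.mk (Subtype.ext (res_br i.le j.le (Idx.leU h) (Idx.leV h) a.1 b.1))
  jacobi {i} p q r := by
    induction p using Submodule.Quotient.induction_on with
    | _ a =>
      induction q using Submodule.Quotient.induction_on with
      | _ b =>
        induction r using Submodule.Quotient.induction_on with
        | _ c => exact (Submodule.Quotient.eq _).2 (br_br i.le a.2 b.2 c.2)
  anchor_br {i} p q := by
    induction p using Submodule.Quotient.induction_on with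
    | _ a =>
      induction q using Submodule.Quotient.induction_on with
      | _ b => rfl
  leibniz {i} p q c := by
    induction p using Submodule.Quotient.induction_on with
    | _ a =>
      induction q using Submodule.Quotient.induction_on with
      | _ b => exact congrArg Submodule.Quotient.mk (Subtype.ext (br_smul i.le c a.1 b.1))
  invariance {i} p q r := by
    induction p using Submodule.Quotient.induction_on with
    | _ a =>
      induction q using Submodule.Quotient.induction_on with
      | _ b =>
        induction r using Submodule.Quotient.induction_on with
        | _ c => exact invar i.le a.2 b.1 c.1
  br_coanchor {i} p α := by
    induction p using Submodule.Quotient.induction_on with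
    | _ a => exact congrArg Submodule.Quotient.mk (Subtype.ext (br_co i.le a.1 α))
  symmetrizer {i} p q := by
    induction p using Submodule.Quotient.induction_on with
    | _ a =>
      induction q using Submodule.Quotient.induction_on with
      | _ b => exact (Submodule.Quotient.eq _).2 (br_symm i.le a.1 b.1)

end Pull

/-- The inverse image `f⁺⁺Q`: the sheaf generated by the system of the modules `P`, which are
subquotients of `Ω¹(V) × (O(V) ⊗ Q(U)) × T(V)` for `f(V) ⊆ U`. It is the quotient of
`Ω¹ ⊕ (f^*Q ×_{f^*T} T)` by the image of `γ ↦ (f^*γ, -π†(γ), 0)`. -/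
def CourantAlgebroid.inverseImage (Q : CourantAlgebroid.{u, v, w, z} X) (f : Hom Y X) :
    CourantAlgebroid Y := (Pull.couPre f Q).sheafC

end DiffSpace


section Manifold
open scoped Manifold ContDiff
open DiffSpace

section diff
variable (𝕜 : Type*) [RCLike 𝕜] (𝕂 : Type*) [RCLike 𝕂] [NormedAlgebra 𝕜 𝕂]
variable {E : Type*} [NormedAddCommGroup E] [NormedSpace 𝕜 E]
variable {X : Type*} [TopologicalSpace X] [ChartedSpace E X]

/-- The differential at `x` of a `𝕂`-valued function. -/
def realDiff (h : X → 𝕂) (x : X) : TangentSpace 𝓘(𝕜, E) x →ₗ[𝕜] 𝕂 :=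
  (mfderiv 𝓘(𝕜, E) 𝓘(𝕜, 𝕂) h x).toLinearMap

/-- The differential at `x` of a `𝕂`-valued function, as a `𝕂`-linear form on the tangent space
with scalars extended to `𝕂`. -/
def diffAt (h : X → 𝕂) (x : X) : 𝕂 ⊗[𝕜] TangentSpace 𝓘(𝕜, E) x →ₗ[𝕂] 𝕂 :=
  LinearMap.liftBaseChange 𝕂 (realDiff 𝕜 𝕂 h x)

variable {𝕜 𝕂}

theorem diffAt_tmul (h : X → 𝕂) (x : X) (c : 𝕂) (v : TangentSpace 𝓘(𝕜, E) x) :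
    diffAt 𝕜 𝕂 h x (c ⊗ₜ v) = c * realDiff 𝕜 𝕂 h x v :=
  LinearMap.liftBaseChange_tmul ..

theorem diffAt_ext {x : X} {l l' : 𝕂 ⊗[𝕜] TangentSpace 𝓘(𝕜, E) x →ₗ[𝕂] 𝕂}
    (H : ∀ v : TangentSpace 𝓘(𝕜, E) x, l (1 ⊗ₜ v) = l' (1 ⊗ₜ v)) : l = l' := by
  ext v; exact H v

variable {n : WithTop ℕ∞}

theorem order_ne_zero (hn : ∞ ≤ n) : n ≠ 0 := by
  rintro rfl
  simp at hn

theorem order_add_one (hn : ∞ ≤ n) : n + 1 ≤ n := by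
  induction n using WithTop.recTopCoe with
  | top => exact le_top
  | coe m =>
    have : m = ⊤ := top_le_iff.1 (WithTop.coe_le_coe.1 hn)
    subst this
    exact le_rfl

theorem order_two (hn : ∞ ≤ n) : minSmoothness 𝕜 2 ≤ n := by
  rw [minSmoothness_of_isRCLikeNormedField]
  exact le_trans (WithTop.coe_le_coe.2 le_top) hn

theorem realDiff_congr {f g : X → 𝕂} {x : X} (h : f =ᶠ[𝓝 x] g) :
    realDiff (E := E) 𝕜 𝕂 f x = realDiff 𝕜 𝕂 g x := by
  refine LinearMap.ext fun v => ?_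
  have := h.mfderiv_eq (I := 𝓘(𝕜, E)) (I' := 𝓘(𝕜, 𝕂))
  exact congrArg (fun L : E →L[𝕜] 𝕂 => L v) this

theorem realDiff_const (c : 𝕂) (x : X) : realDiff (E := E) 𝕜 𝕂 (fun _ => c) x = 0 := by
  refine LinearMap.ext fun v => ?_
  have := mfderiv_const (I := 𝓘(𝕜, E)) (I' := 𝓘(𝕜, 𝕂)) (x := x) (c := c)
  exact congrArg (fun L : E →L[𝕜] 𝕂 => L v) this

theorem realDiff_add {f g : X → 𝕂} {x : X} (hf : MDifferentiableAt 𝓘(𝕜, E) 𝓘(𝕜, 𝕂) f x)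
    (hg : MDifferentiableAt 𝓘(𝕜, E) 𝓘(𝕜, 𝕂) g x) :
    realDiff (E := E) 𝕜 𝕂 (fun y => f y + g y) x = realDiff 𝕜 𝕂 f x + realDiff 𝕜 𝕂 g x :=
  LinearMap.ext fun v =>
    congrArg (fun L : E →L[𝕜] 𝕂 => L v) (hf.hasMFDerivAt.add hg.hasMFDerivAt).mfderiv

theorem realDiff_mul {f g : X → 𝕂} {x : X} (hf : MDifferentiableAt 𝓘(𝕜, E) 𝓘(𝕜, 𝕂) f x)
    (hg : MDifferentiableAt 𝓘(𝕜, E) 𝓘(𝕜, 𝕂) g x) (v : TangentSpace 𝓘(𝕜, E) x) :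
    realDiff (E := E) 𝕜 𝕂 (fun y => f y * g y) x v =
      f x * realDiff 𝕜 𝕂 g x v + g x * realDiff 𝕜 𝕂 f x v :=
  congrArg (fun L : E →L[𝕜] 𝕂 => L v) (hf.hasMFDerivAt.mul hg.hasMFDerivAt).mfderiv

theorem contMDiffAt_mul {f g : X → 𝕂} {x : X} (hf : ContMDiffAt 𝓘(𝕜, E) 𝓘(𝕜, 𝕂) n f x)
    (hg : ContMDiffAt 𝓘(𝕜, E) 𝓘(𝕜, 𝕂) n g x) :
    ContMDiffAt 𝓘(𝕜, E) 𝓘(𝕜, 𝕂) n (fun y => f y * g y) x :=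
  (contDiff_mul (𝔸 := 𝕂) (𝕜 := 𝕜) (n := n)).contMDiff.contMDiffAt.comp x (hf.prodMk_space hg)

section chart
variable (x₀ : X)

/-- The tangent vector at `x` whose expression in the chart at `x₀` is `w`. -/
def chartVec (w : E) (x : X) : TangentSpace 𝓘(𝕜, E) x :=
  (mfderiv 𝓘(𝕜, E) 𝓘(𝕜, E) (chartAt E x₀).symm (chartAt E x₀ x) w : E)

theorem realDiff_chartVec [IsManifold 𝓘(𝕜, E) 1 X] {x : X} (hx : x ∈ (chartAt E x₀).source)
    (h : X → 𝕂) (w : E) (hh : MDifferentiableAt 𝓘(𝕜, E) 𝓘(𝕜, 𝕂) h x) :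
    realDiff 𝕜 𝕂 h x (chartVec x₀ w x) =
      fderiv 𝕜 (h ∘ (chartAt E x₀).symm) (chartAt E x₀ x) w := by
  have e : (chartAt E x₀).symm (chartAt E x₀ x) = x := (chartAt E x₀).left_inv hx
  have h1 : MDifferentiableAt 𝓘(𝕜, E) 𝓘(𝕜, E) (chartAt E x₀).symm (chartAt E x₀ x) :=
    mdifferentiableAt_atlas_symm (chart_mem_atlas E x₀) ((chartAt E x₀).map_source hx)
  have h2 := mfderiv_comp_of_eq hh h1 e
  have h3 : ∀ y, y = x → ((mfderiv 𝓘(𝕜, E) 𝓘(𝕜, 𝕂) h y : E →L[𝕜] 𝕂)) =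
      (mfderiv 𝓘(𝕜, E) 𝓘(𝕜, 𝕂) h x : E →L[𝕜] 𝕂) := by rintro _ rfl; rfl
  rw [mfderiv_eq_fderiv] at h2
  refine Eq.trans ?_ (congrArg (fun L : E →L[𝕜] 𝕂 => L w) h2).symm
  exact congrArg (fun L : E →L[𝕜] 𝕂 => L _) (h3 _ e).symm

/-- `h` in the chart at `x₀` -/
theorem contDiffAt_chart [IsManifold 𝓘(𝕜, E) n X] {x : X} (hx : x ∈ (chartAt E x₀).source)
    {h : X → 𝕂} (hh : ContMDiffAt 𝓘(𝕜, E) 𝓘(𝕜, 𝕂) n h x) :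
    ContDiffAt 𝕜 n (h ∘ (chartAt E x₀).symm) (chartAt E x₀ x) := by
  rw [← contMDiffAt_iff_contDiffAt]
  refine ContMDiffAt.comp _ ?_ (contMDiffAt_symm_of_mem_maximalAtlas
    (IsManifold.chart_mem_maximalAtlas x₀) ((chartAt E x₀).map_source hx))
  rwa [(chartAt E x₀).left_inv hx]

theorem realDiff_chartVec_eventually [IsManifold 𝓘(𝕜, E) n X] (hn : ∞ ≤ n) {x : X}
    (hx : x ∈ (chartAt E x₀).source) {h : X → 𝕂}
    (hh : ContMDiffAt 𝓘(𝕜, E) 𝓘(𝕜, 𝕂) n h x) (w : E) :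
    (fun y => diffAt 𝕜 𝕂 h y (1 ⊗ₜ chartVec x₀ w y)) =ᶠ[𝓝 x]
      fun y => fderiv 𝕜 (h ∘ (chartAt E x₀).symm) (chartAt E x₀ y) w := by
  have h1 : (1 : WithTop ℕ∞) ≤ n := le_trans (WithTop.coe_le_coe.2 le_top) hn
  have : IsManifold 𝓘(𝕜, E) 1 X := IsManifold.of_le h1
  filter_upwards [(contMDiffAt_iff_contMDiffAt_nhds (by decide)).1 (hh.of_le h1),
    (chartAt E x₀).open_source.mem_nhds hx] with y hy hy'
  rw [diffAt_tmul, one_mul, realDiff_chartVec x₀ hy' h w (hy.mdifferentiableAt one_ne_zero)]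

theorem contMDiffAt_chartVec [IsManifold 𝓘(𝕜, E) n X] (hn : ∞ ≤ n) {x : X}
    (hx : x ∈ (chartAt E x₀).source) {h : X → 𝕂}
    (hh : ContMDiffAt 𝓘(𝕜, E) 𝓘(𝕜, 𝕂) n h x) (w : E) :
    ContMDiffAt 𝓘(𝕜, E) 𝓘(𝕜, 𝕂) n (fun y => diffAt 𝕜 𝕂 h y (1 ⊗ₜ chartVec x₀ w y)) x := by
  refine ContMDiffAt.congr_of_eventuallyEq ?_ (realDiff_chartVec_eventually x₀ hn hx hh w)
  have h1 : ContDiffAt 𝕜 n (fun z => fderiv 𝕜 (h ∘ (chartAt E x₀).symm) z w) (chartAt E x₀ x) :=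
    ((contDiffAt_chart x₀ hx hh).fderiv_right (order_add_one hn)).clm_apply contDiffAt_const
  exact ContMDiffAt.comp (I' := 𝓘(𝕜, E)) x h1.contMDiffAt (contMDiffAt_of_mem_maximalAtlas
    (IsManifold.chart_mem_maximalAtlas x₀) hx)

theorem chartVec_comm [IsManifold 𝓘(𝕜, E) n X] (hn : ∞ ≤ n) {x : X}
    (hx : x ∈ (chartAt E x₀).source) {h : X → 𝕂}
    (hh : ContMDiffAt 𝓘(𝕜, E) 𝓘(𝕜, 𝕂) n h x) (v w : E) :
    diffAt 𝕜 𝕂 (fun y => diffAt 𝕜 𝕂 h y (1 ⊗ₜ chartVec x₀ w y)) x (1 ⊗ₜ chartVec x₀ v x) =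
      fderiv 𝕜 (fderiv 𝕜 (h ∘ (chartAt E x₀).symm)) (chartAt E x₀ x) v w := by
  have h1 : (1 : WithTop ℕ∞) ≤ n := le_trans (WithTop.coe_le_coe.2 le_top) hn
  have : IsManifold 𝓘(𝕜, E) 1 X := IsManifold.of_le h1
  rw [diffAt_tmul, one_mul, realDiff_chartVec x₀ hx _ v
    ((contMDiffAt_chartVec x₀ hn hx hh w).mdifferentiableAt (order_ne_zero hn))]
  have key : ((fun y => diffAt 𝕜 𝕂 h y (1 ⊗ₜ chartVec x₀ w y)) ∘ (chartAt E x₀).symm)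
      =ᶠ[𝓝 (chartAt E x₀ x)] fun z => fderiv 𝕜 (h ∘ (chartAt E x₀).symm) z w := by
    have e := (chartAt E x₀).left_inv hx
    have t := (chartAt E x₀).symm.continuousAt ((chartAt E x₀).map_source hx)
    have e1 := realDiff_chartVec_eventually x₀ hn hx hh w
    unfold ContinuousAt at t
    rw [e] at t
    filter_upwards [t.eventually e1,
      (chartAt E x₀).open_target.mem_nhds ((chartAt E x₀).map_source hx)] with z hz hz'
    refine hz.trans ?_
    rw [(chartAt E x₀).right_inv hz']
  rw [key.fderiv_eq]
  have h2 : ContDiffAt 𝕜 n (fderiv 𝕜 (h ∘ (chartAt E x₀).symm)) (chartAt E x₀ x) :=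
    (contDiffAt_chart x₀ hx hh).fderiv_right (order_add_one hn)
  rw [fderiv_clm_apply (h2.differentiableAt (order_ne_zero hn)) (differentiableAt_const _)]
  simp

theorem chartVec_symm [IsManifold 𝓘(𝕜, E) n X] (hn : ∞ ≤ n) {x : X}
    (hx : x ∈ (chartAt E x₀).source) {h : X → 𝕂}
    (hh : ContMDiffAt 𝓘(𝕜, E) 𝓘(𝕜, 𝕂) n h x) (v w : E) :
    diffAt 𝕜 𝕂 (fun y => diffAt 𝕜 𝕂 h y (1 ⊗ₜ chartVec x₀ w y)) x (1 ⊗ₜ chartVec x₀ v x) =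
    diffAt 𝕜 𝕂 (fun y => diffAt 𝕜 𝕂 h y (1 ⊗ₜ chartVec x₀ v y)) x (1 ⊗ₜ chartVec x₀ w x) := by
  rw [chartVec_comm x₀ hn hx hh, chartVec_comm x₀ hn hx hh]
  exact ((contDiffAt_chart x₀ hx hh).isSymmSndFDerivAt (order_two hn)).eq v w

variable (𝕂) in
/-- The coordinate functions of the chart at `x₀`. -/
def chartCoord [FiniteDimensional 𝕜 E] (i : Fin (Module.finrank 𝕜 E)) (x : X) : 𝕂 :=
  algebraMap 𝕜 𝕂 ((Module.finBasis 𝕜 E).coord i (chartAt E x₀ x))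

theorem chartVec_expand [FiniteDimensional 𝕜 E] [IsManifold 𝓘(𝕜, E) 1 X] {x : X}
    (hx : x ∈ (chartAt E x₀).source) (v : TangentSpace 𝓘(𝕜, E) x) :
    v = ∑ i, (Module.finBasis 𝕜 E).coord i (mfderiv 𝓘(𝕜, E) 𝓘(𝕜, E) (chartAt E x₀) x v : E) •
      chartVec (𝕜 := 𝕜) x₀ (Module.finBasis 𝕜 E i) x := by
  have h := (mdifferentiable_chart (I := 𝓘(𝕜, E)) x₀).symm_comp_deriv hx
  have h1 := congrArg (fun L : E →L[𝕜] E => L v) h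
  refine h1.symm.trans ?_
  let L : E →L[𝕜] E := mfderiv 𝓘(𝕜, E) 𝓘(𝕜, E) (chartAt E x₀).symm (chartAt E x₀ x)
  let u : E := mfderiv 𝓘(𝕜, E) 𝓘(𝕜, E) (chartAt E x₀) x v
  have h2 : L u = ∑ i, (Module.finBasis 𝕜 E).coord i u • L (Module.finBasis 𝕜 E i) := by
    conv_lhs => rw [← (Module.finBasis 𝕜 E).sum_repr u]
    rw [map_sum]
    exact Finset.sum_congr rfl fun i _ => map_smul _ _ _
  exact h2

theorem contMDiffAt_chartCoord [FiniteDimensional 𝕜 E] [IsManifold 𝓘(𝕜, E) n X]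
    {x : X} (hx : x ∈ (chartAt E x₀).source) (i : Fin (Module.finrank 𝕜 E)) :
    ContMDiffAt 𝓘(𝕜, E) 𝓘(𝕜, 𝕂) n (chartCoord 𝕂 x₀ i) x :=
  ContMDiffAt.comp (I' := 𝓘(𝕜, E)) (g := ((Algebra.linearMap 𝕜 𝕂).comp
    ((Module.finBasis 𝕜 E).coord i)).toContinuousLinearMap) x
    (ContinuousLinearMap.contDiff _).contMDiff.contMDiffAt
      (contMDiffAt_of_mem_maximalAtlas (IsManifold.chart_mem_maximalAtlas x₀) hx)

theorem realDiff_chartCoord [FiniteDimensional 𝕜 E] [IsManifold 𝓘(𝕜, E) 1 X] {x : X}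
    (hx : x ∈ (chartAt E x₀).source) (i : Fin (Module.finrank 𝕜 E))
    (v : TangentSpace 𝓘(𝕜, E) x) :
    realDiff 𝕜 𝕂 (chartCoord 𝕂 x₀ i) x v = algebraMap 𝕜 𝕂
      ((Module.finBasis 𝕜 E).coord i (mfderiv 𝓘(𝕜, E) 𝓘(𝕜, E) (chartAt E x₀) x v : E)) := by
  let L : E →L[𝕜] 𝕂 := ((Algebra.linearMap 𝕜 𝕂).comp
    ((Module.finBasis 𝕜 E).coord i)).toContinuousLinearMap
  have h1 : MDifferentiableAt 𝓘(𝕜, E) 𝓘(𝕜, 𝕂) L (chartAt E x₀ x) :=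
    L.differentiableAt.mdifferentiableAt
  have h2 := mfderiv_comp x h1 ((mdifferentiable_chart (I := 𝓘(𝕜, E)) x₀).mdifferentiableAt hx)
  rw [mfderiv_eq_fderiv, L.fderiv] at h2
  exact congrArg (fun M : E →L[𝕜] 𝕂 => M v) h2

theorem diffAt_expand [FiniteDimensional 𝕜 E] [IsManifold 𝓘(𝕜, E) 1 X] {x : X}
    (hx : x ∈ (chartAt E x₀).source) (v : 𝕂 ⊗[𝕜] TangentSpace 𝓘(𝕜, E) x) :
    v = ∑ i, diffAt 𝕜 𝕂 (chartCoord 𝕂 x₀ i) x v •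
      ((1 : 𝕂) ⊗ₜ[𝕜] chartVec (𝕜 := 𝕜) x₀ (Module.finBasis 𝕜 E i) x) := by
  induction v with
  | zero => simp
  | add a b ha hb =>
    simp only [map_add, add_smul, Finset.sum_add_distrib]
    rw [← ha, ← hb]
  | tmul c w =>
    conv_lhs => rw [chartVec_expand x₀ hx w, TensorProduct.tmul_sum]
    refine Finset.sum_congr rfl fun i _ => ?_
    rw [diffAt_tmul, realDiff_chartCoord x₀ hx, TensorProduct.tmul_smul, mul_smul,
      algebraMap_smul]
    rw [smul_comm]
    exact congrArg (_ • ·) ((congrArg (· ⊗ₜ _) (mul_one c).symm).trans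
      (TensorProduct.smul_tmul' c (1 : 𝕂) _).symm)

end chart
end diff

section space
variable (𝕜 : Type*) [RCLike 𝕜] (𝕂 : Type*) [RCLike 𝕂] [NormedAlgebra 𝕜 𝕂]
variable (E : Type*) [NormedAddCommGroup E] [NormedSpace 𝕜 E]
variable {F : Type*} [NormedAddCommGroup F] [NormedSpace 𝕜 F]
variable (X : Type*) [TopologicalSpace X] [ChartedSpace E X]
variable {Y : Type*} [TopologicalSpace Y] [ChartedSpace F Y]
variable (n : WithTop ℕ∞)

/-- A manifold over `𝕜` modelled on `E` (smooth if `𝕜 = ℝ` and `n = ∞`, real-analytic if `𝕜 = ℝ`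
and `n = ω`, complex if `𝕜 = ℂ`), with its `𝕂`-valued functions. The tangent spaces are
tensored with `𝕂` over `𝕜`. -/
def manifoldSpace (hn : ∞ ≤ n) [FiniteDimensional 𝕜 E] [IsManifold 𝓘(𝕜, E) n X] : DiffSpace 𝕂 where
  pt := X
  V x := 𝕂 ⊗[𝕜] TangentSpace 𝓘(𝕜, E) x
  Reg h x := ContMDiffAt 𝓘(𝕜, E) 𝓘(𝕜, 𝕂) n h x
  d h x := diffAt 𝕜 𝕂 h x
  reg_congr e h := h.congr_of_eventuallyEq e.symm
  d_congr e := congrArg (LinearMap.liftBaseChange 𝕂) (realDiff_congr e)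
  reg_const _ _ := contMDiffAt_const
  reg_add h h' := h.add h'
  reg_mul h h' := contMDiffAt_mul h h'
  d_const c x := diffAt_ext fun v => by
    rw [diffAt_tmul, realDiff_const]; simp
  d_add h h' := diffAt_ext fun v => by
    rw [LinearMap.add_apply, diffAt_tmul, diffAt_tmul, diffAt_tmul, realDiff_add
      (h.mdifferentiableAt (order_ne_zero hn)) (h'.mdifferentiableAt (order_ne_zero hn))]
    exact mul_add _ _ _
  d_mul h h' := diffAt_ext fun v => by
    rw [LinearMap.add_apply, LinearMap.smul_apply, LinearMap.smul_apply, diffAt_tmul, diffAt_tmul,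
      diffAt_tmul, realDiff_mul
      (h.mdifferentiableAt (order_ne_zero hn)) (h'.mdifferentiableAt (order_ne_zero hn))]
    simp
  frames x₀ := by
    have h1 : (1 : WithTop ℕ∞) ≤ n := le_trans (WithTop.coe_le_coe.2 le_top) hn
    have : IsManifold 𝓘(𝕜, E) 1 X := IsManifold.of_le h1
    exact ⟨⟨(chartAt E x₀).source, (chartAt E x₀).open_source⟩, Module.finrank 𝕜 E,
      chartCoord 𝕂 x₀, fun i x => 1 ⊗ₜ chartVec x₀ (Module.finBasis 𝕜 E i) x,
      mem_chart_source E x₀, fun x hx => ⟨fun i => contMDiffAt_chartCoord x₀ hx i,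
        fun v => diffAt_expand x₀ hx v, fun f hf =>
          ⟨fun i => contMDiffAt_chartVec x₀ hn hx hf _, fun i j => chartVec_symm x₀ hn hx hf _ _⟩⟩⟩

variable {E X}

/-- The tangent map of `f` at `y`, with scalars extended to `𝕂`. -/
def tangentAt (f : Y → X) (y : Y) :
    𝕂 ⊗[𝕜] TangentSpace 𝓘(𝕜, F) y →ₗ[𝕂] 𝕂 ⊗[𝕜] TangentSpace 𝓘(𝕜, E) (f y) :=
  (mfderiv 𝓘(𝕜, F) 𝓘(𝕜, E) f y).toLinearMap.baseChange 𝕂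

theorem diffAt_comp (hn : ∞ ≤ n) {f : Y → X} {y : Y} (hf : ContMDiffAt 𝓘(𝕜, F) 𝓘(𝕜, E) n f y)
    {g : X → 𝕂} (hg : ContMDiffAt 𝓘(𝕜, E) 𝓘(𝕜, 𝕂) n g (f y)) :
    diffAt (E := F) 𝕜 𝕂 (g ∘ f) y = (diffAt (E := E) 𝕜 𝕂 g (f y)).comp (tangentAt (E := E) (F := F) 𝕜 𝕂 f y) :=
  diffAt_ext fun v => by
    have e := mfderiv_comp y (hg.mdifferentiableAt (order_ne_zero hn))
      (hf.mdifferentiableAt (order_ne_zero hn))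
    change diffAt 𝕜 𝕂 (g ∘ f) y (1 ⊗ₜ v) = diffAt 𝕜 𝕂 g (f y) (1 ⊗ₜ mfderiv 𝓘(𝕜, F) 𝓘(𝕜, E) f y v)
    rw [diffAt_tmul, diffAt_tmul]
    congr 1
    exact congrArg (fun M : F →L[𝕜] 𝕂 => M v) e

/-- A map of manifolds with its tangent maps. -/
def manifoldHom (hn : ∞ ≤ n) [FiniteDimensional 𝕜 E] [FiniteDimensional 𝕜 F]
    [IsManifold 𝓘(𝕜, E) n X] [IsManifold 𝓘(𝕜, F) n Y] (f : Y → X)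
    (hf : ContMDiff 𝓘(𝕜, F) 𝓘(𝕜, E) n f) :
    Hom (manifoldSpace 𝕜 𝕂 F Y n hn) (manifoldSpace 𝕜 𝕂 E X n hn) where
  toFun := f
  continuous := hf.continuous
  tan y := tangentAt 𝕜 𝕂 f y
  reg g y h := ContMDiffAt.comp (M' := X) (I' := 𝓘(𝕜, E)) (g := g) (f := f) y h (hf y)
  d_comp g y h := diffAt_comp 𝕜 𝕂 n hn (hf y) h

end space
end Manifold

end

/-!
The twist changes neither the module, the anchor, the co-anchor nor the pairing, and the
inverse image builds these four from `Q` without using its bracket. Both sides of the theorem thus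
have the same underlying anchored sheaf, and only the brackets are to be compared.

Sections of `f⁺⁺Q` are locally given by triples `(α, t, ξ)` with `df(ξ) = f^*π(t)`, modulo the
relations `(f^*γ, -π†(γ), 0)`. Replacing the bracket of `Q` by the one of `Q_H` adds the sum of the
terms `g k ⊗ π†(ι_{π(p)} ι_{π(q)} H)` to the middle component of the bracket of `(α, Σ g ⊗ q, ξ)`
and `(β, Σ k ⊗ p, η)`. The relations move this sum into the first component, as the 1-form
`Σ g k f^*(ι_{π(p)} ι_{π(q)} H)`, that is, `v ↦ H(f^*π(t), f^*π(s), df(v))`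
(`exists_form_tt_sub_tt_twist_mem_Z`). The conditions `df(ξ) = f^*π(t)` and `df(η) = f^*π(s)`
identify it with `ι_η ι_ξ f^*H` (`br_add_contract_sub_br_twist_mem_Z`), which is the summand that
the twist of `f⁺⁺Q` by `f^*H` adds.
-/

namespace DiffSpace
open Hom
variable {𝕂 : Type w} [Field 𝕂] {Y : DiffSpace.{u', v'} 𝕂} {X : DiffSpace.{u, v} 𝕂}

theorem Form3.val_zero (H : Form3 X) {x : X.pt} (b c : X.V x) : H.val x ![0, b, c] = 0 := by
  have := H.val_smul (0 : 𝕂) 0 b c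
  rwa [zero_smul, zero_mul] at this

theorem Form3.val_add_snd (H : Form3 X) {x : X.pt} (a b b' c : X.V x) :
    H.val x ![a, b + b', c] = H.val x ![a, b, c] + H.val x ![a, b', c] := by
  rw [← H.val_rot a, ← H.val_rot a, ← H.val_rot a, H.val_add]

theorem Form3.val_smul_snd (H : Form3 X) {x : X.pt} (r : 𝕂) (a b c : X.V x) :
    H.val x ![a, r • b, c] = r * H.val x ![a, b, c] := by
  rw [← H.val_rot a, ← H.val_rot a, H.val_smul]

theorem Form3.val_zero_snd (H : Form3 X) {x : X.pt} (a c : X.V x) : H.val x ![a, 0, c] = 0 := by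
  rw [← H.val_rot a, H.val_zero]

/-- Two Courant algebroids with the same anchored sheaf and the same bracket are equal. -/
theorem CourantAlgebroid.ext_of_bracket {A B : CourantAlgebroid.{u, v, w, z} X}
    (e : A.toAnchoredSheaf = B.toAnchoredSheaf)
    (h : ∀ U, HEq (A.bracket (U := U)) (B.bracket (U := U))) : A = B := by
  obtain ⟨A₀, br, _, _, _, _, _, _, _⟩ := A
  obtain ⟨B₀, br', _, _, _, _, _, _, _⟩ := B
  obtain rfl : A₀ = B₀ := e
  have : @br = @br' := funext fun U => eq_of_heq (h U)
  subst this
  rfl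

namespace Pull
variable {f : Hom Y X} {U : Opens X.pt} {V : Opens Y.pt}
variable (Q : CourantAlgebroid.{u, v, w, z} X) (h : V ≤ f.pre U) (H : Form3 X) (hH : H.IsClosed)

/-- The bracket of formal sums for the twist of `Q`, on the formal sums for `Q`, which are the same. -/
noncomputable def ttTwist : Ten U V Q.toAnchoredSheaf →ₗ[ℤ] Ten U V Q.toAnchoredSheaf →ₗ[ℤ]
    Ten U V Q.toAnchoredSheaf :=
  tt (Q.twist H hH)

theorem ttTwist_tmul (g k : Y.O V) (q p : Q.sec U) :
    ttTwist Q H hH (g ⊗ₜ q) (k ⊗ₜ p) = (g * k) ⊗ₜ[ℤ] (Q.bracket q p +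
      Q.coanchor (H.contract (Q.anchor q) (Q.anchor p))) := rfl

/-- The bracket of triples for the twist of `Q`, on the triples for `Q`, which are the same. -/
noncomputable def brTwist (x y : M U V Q.toAnchoredSheaf) : M U V Q.toAnchoredSheaf :=
  br (Q := Q.twist H hH) h x y

/-- Modulo the relations, the change of the bracket of formal sums caused by the twist is the 1-form
`v ↦ H(f^*π(t), f^*π(s), df(v))`. That this family of covectors is regular is part of the
assertion. -/
theorem exists_form_tt_sub_tt_twist_mem_Z (t s : Ten U V Q.toAnchoredSheaf) :
    ∃ γ : Y.Ω V, (∀ (y : V) (v : Y.V y), γ.1 y v =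
        H.val _ ![rho Q.toAnchoredSheaf h t y, rho Q.toAnchoredSheaf h s y, f.tan y v]) ∧
      ((γ, tt Q t s - ttTwist Q H hH t s, 0) : M U V Q.toAnchoredSheaf) ∈
        Z Q.toAnchoredSheaf h := by
  have h0 : ((0, 0 - 0, 0) : M U V Q.toAnchoredSheaf) ∈ Z Q.toAnchoredSheaf h := by
    rw [sub_zero]; exact zero_mem _
  induction t using ten_ind with
  | h0 =>
    refine ⟨0, fun y v => ?_, ?_⟩
    · rw [map_zero]; exact (H.val_zero _ _).symm
    · simpa only [map_zero, LinearMap.zero_apply] using h0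
  | h1 g q =>
    induction s using ten_ind with
    | h0 =>
      refine ⟨0, fun y v => ?_, ?_⟩
      · rw [map_zero]; exact (H.val_zero_snd _ _).symm
      · simpa only [map_zero, LinearMap.zero_apply] using h0
    | h1 k p =>
      refine ⟨(g * k) • pullΩ h (H.contract (Q.anchor q) (Q.anchor p)), fun y v => ?_, ?_⟩
      · rw [rho_tmul, rho_tmul, H.val_smul, H.val_smul_snd]
        exact mul_assoc _ _ _
      · convert Submodule.smul_mem _ (g * k)
          (z2_mem (Q := Q.toAnchoredSheaf) h (H.contract (Q.anchor q) (Q.anchor p))) using 1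
        refine Prod.ext rfl (Prod.ext ?_ (smul_zero _).symm)
        change _ =
          (g * k) • -((1 : Y.O V) ⊗ₜ[ℤ] Q.coanchor (H.contract (Q.anchor q) (Q.anchor p)))
        rw [tt_tmul, ttTwist_tmul, TensorProduct.tmul_add, smul_neg, smul_tmul'', mul_one]
        exact sub_add_cancel_left _ _
    | h2 a b ha hb =>
      obtain ⟨γ, e, hγ⟩ := ha
      obtain ⟨γ', e', hγ'⟩ := hb
      refine ⟨γ + γ', fun y v => ?_, ?_⟩
      · rw [map_add, Pi.add_apply, H.val_add_snd, ← e, ← e']; rfl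
      · convert add_mem hγ hγ' using 1
        refine Prod.ext rfl (Prod.ext ?_ (add_zero _).symm)
        rw [map_add, map_add]
        exact add_sub_add_comm _ _ _ _
  | h2 a b ha hb =>
    obtain ⟨γ, e, hγ⟩ := ha
    obtain ⟨γ', e', hγ'⟩ := hb
    refine ⟨γ + γ', fun y v => ?_, ?_⟩
    · rw [map_add, Pi.add_apply, H.val_add, ← e, ← e']; rfl
    · convert add_mem hγ hγ' using 1
      refine Prod.ext rfl (Prod.ext ?_ (add_zero _).symm)
      rw [map_add, map_add, LinearMap.add_apply, LinearMap.add_apply]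
      exact add_sub_add_comm _ _ _ _

/-- On the fibre product, the brackets built from `Q` and from its twist differ by the contraction of
`f^*H`, modulo the relations. -/
theorem br_add_contract_sub_br_twist_mem_Z {x y : M U V Q.toAnchoredSheaf}
    (hx : x ∈ N Q.toAnchoredSheaf h) (hy : y ∈ N Q.toAnchoredSheaf h) :
    (br h x y + ((H.pull f).contract x.2.2 y.2.2, 0, 0) - brTwist Q h H hH x y :
      M U V Q.toAnchoredSheaf) ∈ Z Q.toAnchoredSheaf h := by
  obtain ⟨γ, e, hγ⟩ := exists_form_tt_sub_tt_twist_mem_Z Q h H hH x.2.1 y.2.1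
  have hc : (H.pull f).contract x.2.2 y.2.2 = γ :=
    Subtype.ext <| funext fun z => LinearMap.ext fun v => by
      rw [e, ← hx z, ← hy z]
      exact H.pull_val f z _ _ _
  convert hγ using 1
  refine Prod.ext ?_ (Prod.ext ?_ ?_)
  · rw [← hc]
    exact add_sub_cancel_left _ _
  · change tt Q x.2.1 y.2.1 + da Q.toAnchoredSheaf x.2.2 y.2.1 -
        da Q.toAnchoredSheaf y.2.2 x.2.1 + 0 -
      (ttTwist Q H hH x.2.1 y.2.1 + da Q.toAnchoredSheaf x.2.2 y.2.1 -
        da Q.toAnchoredSheaf y.2.2 x.2.1) =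
        tt Q x.2.1 y.2.1 - ttTwist Q H hH x.2.1 y.2.1
    abel
  · change lb x.2.2 y.2.2 + 0 - lb x.2.2 y.2.2 = 0
    rw [add_zero, sub_self]

theorem brP_add_coanchorP_contract (x y : P Q.toAnchoredSheaf h) :
    brP h x y + coanchorP h ((H.pull f).contract (anchorP h x) (anchorP h y)) =
      brP (Q := Q.twist H hH) h x y := by
  induction x using Submodule.Quotient.induction_on with
  | _ a =>
    induction y using Submodule.Quotient.induction_on with
    | _ b =>
      exact (Submodule.Quotient.eq (ZN Q.toAnchoredSheaf h)).2
        (br_add_contract_sub_br_twist_mem_Z Q h H hH a.2 b.2)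

end Pull

namespace CourantAlgebroid
open AncPre CouPre
variable (Q : CourantAlgebroid.{u, v, w, z} X) (f : Hom Y X) (H : Form3 X) (hH : H.IsClosed)

theorem brF_add_coanchorF_contract {W : Opens Y.pt} (s s' : (Pull.couPre f Q).Sec W) :
    brF s s' + coanchorF ((H.pull f).contract (anchorF s) (anchorF s')) =
      brF (A := Pull.couPre f (Q.twist H hH)) s s' := sec_eq fun y hy => by
  obtain ⟨i, hi, h, p, p', e, e'⟩ := local₂ s s' hy
  refine ⟨_, h, hi, ?_⟩
  -- The sections for `Q` and for its twist agree only after unfolding, so that the two sides are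
  -- treated separately.
  have e₁ : resS h (brF s s' + coanchorF ((H.pull f).contract (anchorF s) (anchorF s'))) =
      toSec ((Pull.couPre f Q).br p p' + (Pull.couPre f Q).coanchor
        ((H.pull f).contract ((Pull.couPre f Q).anchor p) ((Pull.couPre f Q).anchor p'))) := by
    rw [map_add, ← resS_brF, coanchorF_toSec, Form3.res_contract, ← resT_anchorF, ← resT_anchorF,
      e, e', brF_toSec, anchorF_toSec, anchorF_toSec, ← toSec_add]
  have e₂ : resS h (brF (A := Pull.couPre f (Q.twist H hH)) s s') =
      toSec ((Pull.couPre f (Q.twist H hH)).br p p') :=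
    (congrArg₂ (brF (A := Pull.couPre f (Q.twist H hH))) e e').trans
      (brF_toSec (A := Pull.couPre f (Q.twist H hH)) p p')
  exact e₁.trans ((congrArg toSec
    (Pull.brP_add_coanchorP_contract Q i.le H hH p p')).trans e₂.symm)

theorem twist_inverseImage : (Q.inverseImage f).twist (H.pull f) (hH.pull f) =
    (Q.twist H hH).inverseImage f :=
  ext_of_bracket rfl fun _ => heq_of_eq <| AddMonoidHom.ext fun s => AddMonoidHom.ext fun s' =>
    brF_add_coanchorF_contract Q f H hH s s'

end CourantAlgebroid
end DiffSpace

theorem mainTheorem9 {𝕜 𝕂 : Type*} [RCLike 𝕜] [RCLike 𝕂] [NormedAlgebra 𝕜 𝕂]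
    {n : WithTop ℕ∞} (hn : ((⊤ : ℕ∞) : WithTop ℕ∞) ≤ n)
    {E F : Type*} [NormedAddCommGroup E] [NormedSpace 𝕜 E] [FiniteDimensional 𝕜 E]
    [NormedAddCommGroup F] [NormedSpace 𝕜 F] [FiniteDimensional 𝕜 F]
    {X : Type*} [TopologicalSpace X] [ChartedSpace E X]
    [IsManifold (modelWithCornersSelf 𝕜 E) n X]
    {Y : Type*} [TopologicalSpace Y] [ChartedSpace F Y]
    [IsManifold (modelWithCornersSelf 𝕜 F) n Y]
    (f : Y → X) (hf : ContMDiff (modelWithCornersSelf 𝕜 F) (modelWithCornersSelf 𝕜 E) n f)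
    (Q : DiffSpace.CourantAlgebroid (manifoldSpace 𝕜 𝕂 E X n hn))
    (H : DiffSpace.Form3 (manifoldSpace 𝕜 𝕂 E X n hn)) (hH : H.IsClosed) :
    (Q.inverseImage (manifoldHom 𝕜 𝕂 n hn f hf)).twist
        (H.pull (manifoldHom 𝕜 𝕂 n hn f hf)) (hH.pull (manifoldHom 𝕜 𝕂 n hn f hf)) =
      (Q.twist H hH).inverseImage (manifoldHom 𝕜 𝕂 n hn f hf) :=
  Q.twist_inverseImage _ H hH
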